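/- Let $(G,S)$ be a Garside system with Garside element $\Delta$: $G$ is a nontrivial group, the submonoid $G^+$ generated by $S\subseteq G$ is cancellative, Noetherian (for each $a\in G^+$ the lengths of the expressions of $a$ as a product of elements $\neq 1$ are bounded) and has left and right lcm's, $G$ is the group of fractions of $G^+$, the left divisors and the right divisors in $G^+$ of $\Delta\in G^+$ coincide, and $S$ is the set of these divisors, is finite and generates $G$. Assume that $(G,S)$ is of spindle type, i.e. for all $a,b\in S$ the left gcd $a\wedge b$ and the right gcd $a\,\tilde\wedge\, b$ in $G^+$ lie in $\{a,b,1\}$, and that $G$ is linear, i.e. $G$ embeds into $GL_n(K)$ for some $n$ and some field $K$ (of any characteristic). Let $X$ be the (finite) set of atoms of $G^+$. Then there is a deterministic logspace transducer that, given any word $w$ over the alphabet $X\cup X^{-1}$, halts and outputs the left Garside normal form $\Delta^p s_1\cdots s_l$ of the element $b\in G$ represented by $w$, written as a word over the alphabet $\{\Delta,\Delta^{-1}\}\sqcup (S\setminus\{1,\Delta\})$, with $|p|$ copies of $\Delta^{\pm1}$ in front. Here $p=\inf(b)$ is the maximal integer such that $b=c\Delta^p c'$ for some $c,c'\in G^+$,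 and $s_1,\dots,s_l\in S\setminus\{1,\Delta\}$ are such that $b=\Delta^p s_1\cdots s_l$ and $s_i=\Delta\wedge(s_i\cdots s_l)$ for $1\le i\le l$. A deterministic logspace transducer is a deterministic machine with a finite control, a read-only two-way input tape holding $w$ between end markers, a read-write work tape on which at most $C(\lfloor\log_2 |w|\rfloor+1)$ squares are used ($C$ a constant independent of $w$; read $\lfloor\log_2 0\rfloor$ as $0$), and a write-only output tape written from left to right, a bounded number of letters per step. -/

import Mathlib

/-! ### Logspace transducers -/

namespace Logspace

/-- Head movements on a tape. -/
inductive Move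
  | left
  | stay
  | right

/-- A head movement on a tape whose squares are numbered `0, 1, 2, …`; a head on square `0` that is
told to move left stays where it is. -/
def Move.apply : Move → ℕ → ℕ
  | .left, i => i - 1
  | .stay, i => i
  | .right, i => i + 1

/-- What the input head can see: a letter of the input word or one of the two end markers. -/
inductive InputSymbol (X : Type*)
  | leftEnd
  | letter (x : X)
  | rightEnd

/-- The content of square `i` of the input tape: the letters of `w` are on the squares
`1, …, w.length`, between the two end markers. -/
def inputAt {X : Type*} (w : List X) : ℕ → InputSymbol X
  | 0 => .leftEnd
  | i + 1 =>
    match w[i]? with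
    | some x => .letter x
    | none => .rightEnd

/-- A deterministic transducer: a finite control, a read-only two-way input tape, a read-write work
tape and a write-only left-to-right output tape. `trans q x a` is the move in state `q` when the
input head sees `x` and the work head sees `a`: it halts if this is `none`; if it is
`some (q', a', d, e, v)`, then it enters state `q'`, writes `a'` on the work tape, moves the input
head by `d` and the work head by `e`, and appends the word `v` to the output. -/
structure Transducer (X Y : Type*) where
  State : Type
  Work : Type
  finite_state : Finite State
  finite_work : Finite Work
  start : State
  blank : Work
  trans : State → InputSymbol X → Work → Option (State × Work × Move × Move × List Y)

namespace Transducer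

variable {X Y : Type*} (T : Transducer X Y)

/-- A configuration of a transducer. -/
structure Cfg where
  state : T.State
  inputPos : ℕ
  work : ℕ → T.Work
  workPos : ℕ
  out : List Y

/-- The initial configuration: blank work tape, empty output. -/
def init : T.Cfg where
  state := T.start
  inputPos := 0
  work := fun _ => T.blank
  workPos := 0
  out := []

/-- One step of the transducer on input `w`; `none` if it halts. The input head never leaves the
squares `0, …, w.length + 1`. -/
def step (w : List X) (c : T.Cfg) : Option T.Cfg :=
  (T.trans c.state (inputAt w c.inputPos) (c.work c.workPos)).map
    fun (q, a, d, e, v) =>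
      { state := q
        inputPos := min (d.apply c.inputPos) (w.length + 1)
        work := Function.update c.work c.workPos a
        workPos := e.apply c.workPos
        out := c.out ++ v }

/-- `c` occurs in the run of the transducer on input `w`. -/
def Reaches (w : List X) (c : T.Cfg) : Prop :=
  Relation.ReflTransGen (fun a b => T.step w a = some b) T.init c

/-- On every input `w`, the transducer halts with output `f w`. -/
def Computes (f : List X → List Y) : Prop :=
  ∀ w : List X, ∃ c : T.Cfg, T.Reaches w c ∧ T.step w c = none ∧ c.out = f w

/-- For a constant `C`, on every input of length `n` the work head only visits the first
`C (⌊log₂ n⌋ + 1)` squares of the work tape (here `Nat.log 2 0 = 0`). -/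
def UsesLogSpace : Prop :=
  ∃ C : ℕ, ∀ (w : List X) (c : T.Cfg), T.Reaches w c →
    c.workPos < C * (Nat.log 2 w.length + 1)

end Transducer

/-- `f` is a function between the words over two finite alphabets that is computed by a
deterministic logspace transducer. -/
def IsLogspaceComputable {X Y : Type*} (f : List X → List Y) : Prop :=
  Finite X ∧ Finite Y ∧ ∃ T : Transducer X Y, T.Computes f ∧ T.UsesLogSpace

end Logspace

/-! ### Garside systems -/

namespace Garside

section Monoid

variable {M : Type*} [Monoid M]

/-- `a ≼ b`: `a` is a left divisor of `b`. -/
def LeftDiv (a b : M) : Prop := ∃ c, b = a * c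

/-- `b ≽ a`: `a` is a right divisor of `b`. -/
def RightDiv (a b : M) : Prop := ∃ c, b = c * a

/-- `a` is an atom of the monoid. -/
def IsMonoidAtom (a : M) : Prop := a ≠ 1 ∧ ∀ b c : M, a = b * c → b = 1 ∨ c = 1

/-- `m` is a right lcm of `a` and `b`. -/
def IsRightLcm (a b m : M) : Prop :=
  LeftDiv a m ∧ LeftDiv b m ∧ ∀ c, LeftDiv a c → LeftDiv b c → LeftDiv m c

/-- `m` is a left lcm of `a` and `b`. -/
def IsLeftLcm (a b m : M) : Prop :=
  RightDiv a m ∧ RightDiv b m ∧ ∀ c, RightDiv a c → RightDiv b c → RightDiv m c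

/-- `d` is a left gcd of `a` and `b`, that is, `d = a ∧ b`. -/
def IsLeftGcd (a b d : M) : Prop :=
  LeftDiv d a ∧ LeftDiv d b ∧ ∀ c, LeftDiv c a → LeftDiv c b → LeftDiv c d

/-- `d` is a right gcd of `a` and `b`. -/
def IsRightGcd (a b d : M) : Prop :=
  RightDiv d a ∧ RightDiv d b ∧ ∀ c, RightDiv c a → RightDiv c b → RightDiv c d

/-- `d` is balanced: its left and its right divisors coincide. -/
def IsBalanced (d : M) : Prop := ∀ a : M, LeftDiv a d ↔ RightDiv a d

variable (M) in
/-- Noetherian (atomic) cancellative monoids with right and left lcms. -/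
structure IsLcmMonoid : Prop where
  noetherian : ∀ a : M, ∃ n : ℕ, ∀ L : List M, (∀ x ∈ L, x ≠ 1) → L.prod = a → L.length ≤ n
  cancellative : ∀ a b b' c : M, a * b * c = a * b' * c → b = b'
  right_lcm : ∀ a b : M, ∃ m, IsRightLcm a b m
  left_lcm : ∀ a b : M, ∃ m, IsLeftLcm a b m

/-- `L = [s₁, …, sₗ]` is in left normal form with respect to `Δ`: `sᵢ = Δ ∧ (sᵢ ⋯ sₗ)` for all `i`,
and `sₗ ≠ 1`. -/
def IsLeftNormal (Δ : M) (L : List M) : Prop :=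
  (∀ (s : M) (T : List M), s :: T <:+ L → IsLeftGcd Δ (s * T.prod) s) ∧
    ∀ h : L ≠ [], L.getLast h ≠ 1

end Monoid

section Group

variable {G : Type*} [Group G]

/-- `(G, S)` is a Garside system with Garside element `Δ`, so that `S = Div(Δ)`; here `G⁺` is the
submonoid `Submonoid.closure S`. -/
structure IsGarsideSystem (S : Set G) (Δ : Submonoid.closure S) : Prop where
  isLcmMonoid : IsLcmMonoid (Submonoid.closure S)
  fractions : ∀ g : G, ∃ a b : Submonoid.closure S, g = (a : G) * (b : G)⁻¹
  balanced : IsBalanced Δ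
  eq_div : S = {g : G | ∃ s : Submonoid.closure S, (s : G) = g ∧ LeftDiv s Δ}
  finite : S.Finite
  generates : Subgroup.closure S = ⊤

/-- For all `a, b ∈ S = Div(Δ)` the left gcd and the right gcd of `a` and `b` lie in
`{a, b, 1}`. -/
def IsSpindleType (S : Set G) : Prop :=
  ∀ a b : Submonoid.closure S, (a : G) ∈ S → (b : G) ∈ S →
    (∃ d, IsLeftGcd a b d ∧ (d = a ∨ d = b ∨ d = 1)) ∧
    (∃ d, IsRightGcd a b d ∧ (d = a ∨ d = b ∨ d = 1))

/-- The relation `a ≤ b` on `G`: `b = c a c'` for some `c, c' ∈ G⁺`. -/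
def Below (S : Set G) (a b : G) : Prop :=
  ∃ c ∈ Submonoid.closure S, ∃ c' ∈ Submonoid.closure S, b = c * a * c'

/-- `r` is the infimum of `g`: the maximal integer with `Δ ^ r ≤ g`. -/
def IsInf (S : Set G) (Δ : Submonoid.closure S) (g : G) (r : ℤ) : Prop :=
  IsGreatest {k : ℤ | Below S ((Δ : G) ^ k) g} r

/-- The set `X` of atoms of `G⁺`. -/
abbrev Atoms (S : Set G) : Type _ := {x : Submonoid.closure S // IsMonoidAtom x}

/-- The element of `G` represented by a word in the atoms, which are the letters `(x, true)`, and
their formal inverses, which are the letters `(x, false)`. -/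
def evalWord (S : Set G) (w : List (Atoms S × Bool)) : G :=
  (w.map fun l => if l.2 then (l.1.1 : G) else (l.1.1 : G)⁻¹).prod

/-- The set `S \ {1, Δ}` of proper simple elements. -/
abbrev ProperSimples (S : Set G) (Δ : Submonoid.closure S) : Type _ :=
  {s : Submonoid.closure S // (s : G) ∈ S ∧ s ≠ 1 ∧ s ≠ Δ}

/-- `Δ ^ p s₁ ⋯ sₗ` is the left Garside normal form of `g`, where `L = [s₁, …, sₗ]`. -/
def IsLeftGarsideNormalForm (S : Set G) (Δ : Submonoid.closure S) (g : G) (p : ℤ)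
    (L : List (ProperSimples S Δ)) : Prop :=
  IsInf S Δ g p ∧ IsLeftNormal Δ (L.map Subtype.val) ∧
    g = (Δ : G) ^ p * ((L.map Subtype.val).prod : Submonoid.closure S)

/-- The expression `Δ ^ p s₁ ⋯ sₗ` written out as a word: `|p|` copies of the letter `Δ`
(`Sum.inl true`) if `p ≥ 0`, of the letter `Δ⁻¹` (`Sum.inl false`) if `p < 0`, followed by the
letters `s₁, …, sₗ`. -/
def normalFormWord (S : Set G) (Δ : Submonoid.closure S) (p : ℤ)
    (L : List (ProperSimples S Δ)) : List (Bool ⊕ ProperSimples S Δ) :=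
  List.replicate p.natAbs (Sum.inl (decide (0 ≤ p))) ++ L.map Sum.inr

end Group

end Garside

/-!
Let `P` be the set of proper simple elements, those other than `1` and `Δ`. In a Garside system of
spindle type two elements of `P` with a common divisor `≠ 1`, or with a common multiple in `P`, are
comparable for divisibility, so that comparability is an equivalence relation on `P`
(`IsSpindle.comp_trans`); write `[s]` for the class of `s`, and `∂s` for the complement `s⁻¹ Δ`.
A product `s t` of two elements of `P` cannot be simplified exactly if `[∂s] ≠ [t]`, and words in
which no two neighbours can be simplified, followed by a power of `Δ`, are the normal forms
(`isLeftGarsideNormalForm`). Multiplying a normal form by one more simple element on the right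
changes its last letter only (`push`), without changing the class of this letter, so that a normal
form is a stack whose height changes by at most one in each step.

The stack may be too high for the work tape. Its bottom letter is found by a test that needs no stack:
after the longest prefix of the word whose product is of the form `s Δ ^ r` with `s` simple, the
stack never comes back to the height one, and the rest of the word can be treated in the same way
(`IsSpindle.run_of_cut`). The test is done in a representation of the group over `ℤ`
in which a normal form with at least one letter never acts as a permutation matrix
(`evalStack_ne_permOp`). Here `s` acts as a power of a permutation matrix, given by an additive
weight of `s`, between transvections attached to the classes `[s]` and `[∂s]`; these cancel in
products that can be simplified (`isGermHom_rep`), and along a normal form they make one coordinate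
dominate all the others, by a ping-pong argument (`exists_dominant`). So the representation
tells the elements `s Δ ^ r` apart from all the others, up to the finite order of the conjugation
by `Δ` on the simple elements (`eq_of_rep`).

The entries of a matrix product are at most exponential in the length of the word, so that two
matrices can be compared modulo all the numbers up to a linear bound (`Scheme.exists_bound`), with a
bounded number of counters of logarithmic size. The exponent of `Δ` in the normal form is
determined by the weights of the letters of the word and of the normal form: one pass over the
pieces computes it, and a second pass writes the letters, conjugated by the power of `Δ` that has to
be moved to the front. Programs with such counters are compiled to transducers, the binary digits of
all the counters being kept on parallel tracks of the work tape (`isLogspaceComputable_of_exec`).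
-/

/-! ### Transducers with arbitrary finite sets of states -/

namespace Logspace

/-- A configuration of a machine whose states and work letters range over arbitrary types. -/
structure RawCfg (Q W Y : Type*) where
  state : Q
  inputPos : ℕ
  work : ℕ → W
  workPos : ℕ
  out : List Y

variable {X Y Q W : Type*}

/-- One step of a machine with transition function `tr`, exactly as in `Transducer.step`, but
without the requirement that the states and the work letters form small finite types. -/
def rawStep (tr : Q → InputSymbol X → W → Option (Q × W × Move × Move × List Y)) (w : List X)
    (c : RawCfg Q W Y) : Option (RawCfg Q W Y) :=
  (tr c.state (inputAt w c.inputPos) (c.work c.workPos)).map fun o =>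
    { state := o.1
      inputPos := min (o.2.2.1.apply c.inputPos) (w.length + 1)
      work := Function.update c.work c.workPos o.2.1
      workPos := o.2.2.2.1.apply c.workPos
      out := c.out ++ o.2.2.2.2 }

/-- A step that is made with the work head on one of the first `b` squares. -/
def BoundedStep (tr : Q → InputSymbol X → W → Option (Q × W × Move × Move × List Y)) (w : List X)
    (b : ℕ) (c c' : RawCfg Q W Y) : Prop :=
  rawStep tr w c = some c' ∧ c.workPos < b

/-- A machine run that stays in a finite set `R` of states, halts, and visits logarithmically many
squares of the work tape, can be carried out by a transducer in the strict sense: the elements of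
`R` and the work letters are numbered. -/
theorem isLogspaceComputable_of_rawStep [Finite X] [Finite Y] [Finite W]
    (tr : Q → InputSymbol X → W → Option (Q × W × Move × Move × List Y)) (s₀ : Q) (bl : W)
    (R : Set Q) (hR : R.Finite) (h₀ : s₀ ∈ R)
    (hcl : ∀ s ∈ R, ∀ x a o, tr s x a = some o → o.1 ∈ R)
    (f : List X → List Y) (C : ℕ)
    (hrun : ∀ w : List X, ∃ c : RawCfg Q W Y,
      Relation.ReflTransGen (BoundedStep tr w (C * (Nat.log 2 w.length + 1)))
        ⟨s₀, 0, fun _ => bl, 0, []⟩ c ∧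
      rawStep tr w c = none ∧ c.workPos < C * (Nat.log 2 w.length + 1) ∧ c.out = f w) :
    IsLogspaceComputable f := by
  classical
  have : Finite R := hR
  let e := Finite.equivFin R
  let eW := Finite.equivFin W
  let enc : Q → Fin (Nat.card R) := fun s => if h : s ∈ R then e ⟨s, h⟩ else e ⟨s₀, h₀⟩
  have henc : ∀ s ∈ R, ((e.symm (enc s) : R) : Q) = s := by
    intro s hs
    have h : enc s = e ⟨s, hs⟩ := dif_pos hs
    rw [h, e.symm_apply_apply]
  let T : Transducer X Y :=
    { State := Fin (Nat.card R)
      Work := Fin (Nat.card W)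
      finite_state := inferInstance
      finite_work := inferInstance
      start := enc s₀
      blank := eW bl
      trans := fun q x a => (tr (e.symm q : R) x (eW.symm a)).map
        fun o => (enc o.1, eW o.2.1, o.2.2.1, o.2.2.2.1, o.2.2.2.2) }
  let F : RawCfg Q W Y → T.Cfg := fun c =>
    { state := enc c.state
      inputPos := c.inputPos
      work := fun i => eW (c.work i)
      workPos := c.workPos
      out := c.out }
  have hstep : ∀ w c, c.state ∈ R → T.step w (F c) = (rawStep tr w c).map F := by
    intro w c hc
    simp only [Transducer.step, rawStep, T, F, henc _ hc, Equiv.symm_apply_apply, Option.map_map]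
    congr 1
    funext o
    simp only [Function.comp]
    congr 1
    funext i
    by_cases hi : i = c.workPos
    · subst hi; simp
    · simp [Function.update_of_ne hi]
  have hmem : ∀ w c c', c.state ∈ R → rawStep tr w c = some c' → c'.state ∈ R := by
    intro w c c' hc h
    simp only [rawStep, Option.map_eq_some_iff] at h
    obtain ⟨o, ho, rfl⟩ := h
    exact hcl _ hc _ _ _ ho
  refine ⟨inferInstance, inferInstance, T, ?_, C, ?_⟩
  · intro w
    obtain ⟨c, hc, hn, -, ho⟩ := hrun w
    have key : T.Reaches w (F c) ∧ c.state ∈ R := by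
      clear hn ho
      induction hc with
      | refl => exact ⟨Relation.ReflTransGen.refl, h₀⟩
      | tail _ h ih =>
        refine ⟨ih.1.tail ?_, hmem _ _ _ ih.2 h.1⟩
        simp [hstep _ _ ih.2, h.1]
    exact ⟨F c, key.1, by simp [hstep _ _ key.2, hn], ho⟩
  · intro w d hd
    obtain ⟨c, hc, hn, hb, -⟩ := hrun w
    -- The machine is deterministic, so every reachable configuration lies on the run to `c`.
    have key : ∃ d', d = F d' ∧ d'.state ∈ R ∧
        Relation.ReflTransGen (BoundedStep tr w (C * (Nat.log 2 w.length + 1))) d' c := by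
      induction hd with
      | refl => exact ⟨_, rfl, h₀, hc⟩
      | tail _ h ih =>
        obtain ⟨d', rfl, hd', hp⟩ := ih
        rw [hstep _ _ hd'] at h
        rcases hp.cases_head with rfl | ⟨d'', h1, h2⟩
        · simp [hn] at h
        · rw [h1.1] at h
          simp only [Option.map_some, Option.some.injEq] at h
          exact ⟨d'', h.symm, hmem _ _ _ hd' h1.1, h2⟩
    obtain ⟨d', rfl, -, hp⟩ := key
    rcases hp.cases_head with rfl | ⟨d'', h1, -⟩
    · exact hb
    · exact h1.2

/-! ### Counter programs -/

/-- Programs for a machine with a finite control `F`, an input head, an output tape, and a finite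
set `V` of counters with values in `ℕ`.

* `arith dst a b neg c g` adds the counter `b` (its bitwise complement if `neg`) and the carry `c`
  to the counter `a`, stores the sum in `dst` (if any) and passes the final carry to the finite
  control through `g`. It is used in the forms `Cmd.add`, `Cmd.sub` and `Cmd.test`.
* `ctl g d o` updates the finite control by `g`, moves the input head by `d` and emits a word.
* `branch h` continues with a program that depends on the letter under the input head and on the
  finite control; `loop c p` repeats `p` as long as `c` holds. -/
inductive Cmd (X Y F V : Type*)
  | arith (dst : Option V) (a b : V) (neg c : Bool) (g : Bool → F → F)
  | ctl (g : InputSymbol X → F → F) (d : Move) (o : F → List Y)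
  | seq (p q : Cmd X Y F V)
  | branch (h : InputSymbol X → F → Cmd X Y F V)
  | loop (c : InputSymbol X → F → Bool) (p : Cmd X Y F V)

namespace Cmd

variable {F V : Type*}

/-- `v := a + b + c`. -/
def add (v a b : V) (c : Bool) : Cmd X Y F V := arith (some v) a b false c fun _ f => f

/-- `v := a - b`, for `b ≤ a`. -/
def sub (v a b : V) : Cmd X Y F V := arith (some v) a b true true fun _ f => f

/-- Report to the finite control whether `b ≤ a`. -/
def test (a b : V) (g : Bool → F → F) : Cmd X Y F V := arith none a b true true g

end Cmd

/-- The state of a counter program. -/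
structure Store (Y F V : Type*) where
  flag : F
  mem : V → ℕ
  pos : ℕ
  out : List Y

variable {F V : Type*}

/-! ### Counters in binary on the work tape -/

/-- A used square of the work tape: a mark that singles out the first square, and one bit for each
counter; the least significant bits are on the first square. -/
abbrev Sq (V : Type*) := Bool × (V → Bool)

/-- The value of the counter `v` on a list of squares. -/
def val (v : V) : List (Sq V) → ℕ
  | [] => 0
  | q :: l => (q.2 v).toNat + 2 * val v l

theorem val_lt (v : V) (l : List (Sq V)) : val v l < 2 ^ l.length := by
  induction l with
  | nil => simp [val]
  | cons q l ih =>
    have := Bool.toNat_le (q.2 v)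
    simp only [val, List.length_cons, pow_succ]
    omega

theorem val_append (v : V) (l l' : List (Sq V)) :
    val v (l ++ l') = val v l + 2 ^ l.length * val v l' := by
  induction l with
  | nil => simp [val]
  | cons q l ih => simp only [val, List.cons_append, ih, List.length_cons, pow_succ]; ring

variable [DecidableEq V]

/-! ### Execution of counter programs -/

/-- `Exec w B p s s'`: on the input word `w`, the program `p` turns the state `s` into `s'`, and no
counter is set to a value above `B` on the way. -/
inductive Exec (w : List X) (B : ℕ) : Cmd X Y F V → Store Y F V → Store Y F V → Prop
  | add {s : Store Y F V} {v a b : V} {c : Bool} (h : s.mem a + s.mem b + c.toNat ≤ B) :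
      Exec w B (.add v a b c) s
        { s with mem := Function.update s.mem v (s.mem a + s.mem b + c.toNat) }
  | sub {s : Store Y F V} {v a b : V} (h : s.mem b ≤ s.mem a) :
      Exec w B (.sub v a b) s { s with mem := Function.update s.mem v (s.mem a - s.mem b) }
  | test {s : Store Y F V} {a b : V} {g : Bool → F → F} :
      Exec w B (.test a b g) s { s with flag := g (decide (s.mem b ≤ s.mem a)) s.flag }
  | ctl {s : Store Y F V} {g : InputSymbol X → F → F} {d : Move} {o : F → List Y} :
      Exec w B (.ctl g d o) s
        { s with
          flag := g (inputAt w s.pos) s.flag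
          pos := min (d.apply s.pos) (w.length + 1)
          out := s.out ++ o s.flag }
  | seq {s s' s'' : Store Y F V} {p q : Cmd X Y F V} (h : Exec w B p s s')
      (h' : Exec w B q s' s'') : Exec w B (.seq p q) s s''
  | branch {s s' : Store Y F V} {k : InputSymbol X → F → Cmd X Y F V}
      (h : Exec w B (k (inputAt w s.pos) s.flag) s s') : Exec w B (.branch k) s s'
  | loop_false {s : Store Y F V} {c : InputSymbol X → F → Bool} {p : Cmd X Y F V}
      (h : c (inputAt w s.pos) s.flag = false) : Exec w B (.loop c p) s s
  | loop_true {s s' s'' : Store Y F V} {c : InputSymbol X → F → Bool} {p : Cmd X Y F V}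
      (hc : c (inputAt w s.pos) s.flag = true) (h : Exec w B p s s')
      (h' : Exec w B (.loop c p) s' s'') : Exec w B (.loop c p) s s''

/-! ### Binary addition in one sweep -/

/-- The sum bit of a full adder. -/
def sumBit (x y c : Bool) : Bool := xor x (xor y c)

/-- The carry bit of a full adder. -/
def carryBit (x y c : Bool) : Bool := (x && y) || (c && xor x y)

/-- The square `q` after the addition of the bits of `a` and `b` with carry `c`. -/
def sweepSq (dst : Option V) (a b : V) (neg c : Bool) (q : Sq V) : Sq V :=
  (q.1, fun v => if dst = some v then sumBit (q.2 a) (xor (q.2 b) neg) c else q.2 v)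

/-- The addition carried out along a list of squares, and the final carry. -/
def sweep (dst : Option V) (a b : V) (neg : Bool) : Bool → List (Sq V) → List (Sq V) × Bool
  | c, [] => ([], c)
  | c, q :: l =>
    let r := sweep dst a b neg (carryBit (q.2 a) (xor (q.2 b) neg) c) l
    (sweepSq dst a b neg c q :: r.1, r.2)

theorem length_sweep (dst : Option V) (a b : V) (neg c : Bool) (l : List (Sq V)) :
    (sweep dst a b neg c l).1.length = l.length := by
  induction l generalizing c with
  | nil => rfl
  | cons q l ih => simp [sweep, ih]

theorem map_fst_sweep (dst : Option V) (a b : V) (neg c : Bool) (l : List (Sq V)) :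
    (sweep dst a b neg c l).1.map Prod.fst = l.map Prod.fst := by
  induction l generalizing c with
  | nil => rfl
  | cons q l ih => simp [sweep, ih, sweepSq]

theorem val_sweep_of_ne {dst : Option V} {v : V} (h : dst ≠ some v) (a b : V) (neg c : Bool)
    (l : List (Sq V)) : val v (sweep dst a b neg c l).1 = val v l := by
  induction l generalizing c with
  | nil => rfl
  | cons q l ih => simp [sweep, val, ih, sweepSq, h]

theorem val_sweep_add (v a b : V) (c : Bool) (l : List (Sq V)) :
    val v (sweep (some v) a b false c l).1 +
      2 ^ l.length * (sweep (some v) a b false c l).2.toNat = val a l + val b l + c.toNat := by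
  induction l generalizing c with
  | nil => simp [sweep, val]
  | cons q l ih =>
    have := ih (carryBit (q.2 a) (xor (q.2 b) false) c)
    simp only [sweep, val, sweepSq, if_true, List.length_cons, pow_succ] at this ⊢
    have e : (sumBit (q.2 a) (xor (q.2 b) false) c).toNat +
        2 * (carryBit (q.2 a) (xor (q.2 b) false) c).toNat =
        (q.2 a).toNat + (q.2 b).toNat + c.toNat := by
      cases q.2 a <;> cases q.2 b <;> cases c <;> rfl
    linarith

theorem val_sweep_sub (v a b : V) (c : Bool) (l : List (Sq V)) :
    val v (sweep (some v) a b true c l).1 +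
      2 ^ l.length * (sweep (some v) a b true c l).2.toNat + val b l + 1 =
      val a l + c.toNat + 2 ^ l.length := by
  induction l generalizing c with
  | nil => simp [sweep, val]
  | cons q l ih =>
    have := ih (carryBit (q.2 a) (xor (q.2 b) true) c)
    simp only [sweep, val, sweepSq, if_true, List.length_cons, pow_succ] at this ⊢
    have e : (sumBit (q.2 a) (xor (q.2 b) true) c).toNat +
        2 * (carryBit (q.2 a) (xor (q.2 b) true) c).toNat + (q.2 b).toNat =
        (q.2 a).toNat + 1 + c.toNat := by
      cases q.2 a <;> cases q.2 b <;> cases c <;> rfl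
    linarith

theorem sweep_snd_congr (dst dst' : Option V) (a b : V) (neg c : Bool) (l : List (Sq V)) :
    (sweep dst a b neg c l).2 = (sweep dst' a b neg c l).2 := by
  induction l generalizing c with
  | nil => rfl
  | cons q l ih => simp [sweep, ih]

theorem sweep_none (a b : V) (neg c : Bool) (l : List (Sq V)) :
    (sweep none a b neg c l).1 = l := by
  induction l generalizing c with
  | nil => rfl
  | cons q l ih => simp [sweep, ih, sweepSq]

theorem sweep_snd_sub (dst : Option V) (a b : V) (l : List (Sq V)) :
    (sweep dst a b true true l).2 = decide (val b l ≤ val a l) := by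
  have h := val_sweep_sub a a b true l
  rw [sweep_snd_congr (some a) dst] at h
  have h1 := val_lt a (sweep (some a) a b true true l).1
  rw [length_sweep] at h1
  have h2 := val_lt a l
  have h3 := val_lt b l
  cases hc : (sweep dst a b true true l).2 <;> simp [hc] at h ⊢ <;> omega

/-- The used part of the work tape is the list `l`, and the first square is marked. -/
def IsMarked : List (Sq V) → Prop
  | [] => False
  | q :: l => q.1 = true ∧ ∀ q' ∈ l, q'.1 = false

/-- The list `l` of squares stores the counter values `m`, and it is no longer than needed for
values up to `B`. -/
structure Stores (B : ℕ) (l : List (Sq V)) (m : V → ℕ) : Prop where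
  marked : IsMarked l
  val_eq : ∀ v, val v l = m v
  length_le : l.length ≤ Nat.log 2 B + 1

end Logspace

/-! ### Compilation of counter programs -/

namespace Logspace

variable {X Y F V : Type*}

/-- What the compiled machine is doing: marking the first square of the work tape, being about to
execute the next command, sweeping to the right with a carry, or returning with the final carry. -/
inductive Phase
  | boot
  | ready
  | right (c : Bool)
  | left (c : Bool)

instance : Finite Phase :=
  Finite.of_surjective
    (fun x : Bool ⊕ Bool ⊕ Bool => match x with
      | .inl true => Phase.boot
      | .inl false => Phase.ready
      | .inr (.inl c) => Phase.right c
      | .inr (.inr c) => Phase.left c)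
    (by
      rintro (_ | _ | c | c)
      exacts [⟨.inl true, rfl⟩, ⟨.inl false, rfl⟩, ⟨.inr (.inl c), rfl⟩, ⟨.inr (.inr c), rfl⟩])

instance [Finite X] : Finite (InputSymbol X) :=
  Finite.of_surjective
    (fun x : Option (Option X) => match x with
      | none => InputSymbol.leftEnd
      | some none => InputSymbol.rightEnd
      | some (some x) => InputSymbol.letter x)
    (by
      rintro (_ | x | _)
      exacts [⟨none, rfl⟩, ⟨some (some x), rfl⟩, ⟨some none, rfl⟩])

theorem update_getElem? (l₁ l₂ : List (Sq V)) (q q' : Sq V) :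
    Function.update (fun i => (l₁ ++ q :: l₂)[i]?) l₁.length (some q') =
      fun i => (l₁ ++ q' :: l₂)[i]? := by
  funext i
  rcases lt_trichotomy i l₁.length with h | rfl | h
  · rw [Function.update_of_ne h.ne, List.getElem?_append_left h, List.getElem?_append_left h]
  · simp
  · rw [Function.update_of_ne h.ne', List.getElem?_append_right h.le,
      List.getElem?_append_right h.le]
    obtain ⟨m, hm⟩ := Nat.exists_eq_add_of_lt h
    have : i - l₁.length = m + 1 := by omega
    simp [this]

theorem update_getElem?_end (l : List (Sq V)) (o : Option (Sq V)) :
    Function.update (fun i => l[i]?) l.length o = fun i => (l ++ o.toList)[i]? := by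
  funext i
  rcases lt_trichotomy i l.length with h | rfl | h
  · rw [Function.update_of_ne h.ne, List.getElem?_append_left h]
  · cases o <;> simp
  · rw [Function.update_of_ne h.ne', List.getElem?_append_right h.le]
    cases o
    · simp [h.le]
    · have : i - l.length ≠ 0 := by omega
      obtain ⟨m, hm⟩ := Nat.exists_eq_succ_of_ne_zero this
      simp [h.le, hm]

/-- The stacks that occur while the program `p` is executed on top of the stack `k`. -/
def stackSet : Cmd X Y F V → List (Cmd X Y F V) → Set (List (Cmd X Y F V))
  | .arith dst a b neg c g, k => {.arith dst a b neg c g :: k}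
  | .ctl g d o, k => {.ctl g d o :: k}
  | .seq p q, k => {.seq p q :: k} ∪ (stackSet p (q :: k) ∪ stackSet q k)
  | .branch h, k => {.branch h :: k} ∪ ⋃ x, ⋃ f, stackSet (h x f) k
  | .loop c p, k => {.loop c p :: k} ∪ stackSet p (.loop c p :: k)

theorem finite_stackSet [Finite X] [Finite F] (p : Cmd X Y F V) (k : List (Cmd X Y F V)) :
    (stackSet p k).Finite := by
  induction p generalizing k with
  | arith => exact Set.finite_singleton _
  | ctl => exact Set.finite_singleton _
  | seq p q hp hq => exact (Set.finite_singleton _).union ((hp _).union (hq _))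
  | branch h ih =>
    exact (Set.finite_singleton _).union
      (Set.finite_iUnion fun x => Set.finite_iUnion fun f => ih x f k)
  | loop c p hp => exact (Set.finite_singleton _).union (hp _)

theorem cons_mem_stackSet (p : Cmd X Y F V) (k : List (Cmd X Y F V)) : p :: k ∈ stackSet p k := by
  cases p <;> simp [stackSet]

variable [DecidableEq V]

/-- The states of the compiled machine: a stack of programs that remain to be executed, the finite
control, and the phase. -/
abbrev MState (X Y F V : Type*) := List (Cmd X Y F V) × F × Phase

/-- The transition function of the machine that executes counter programs. -/
def machine : MState X Y F V → InputSymbol X → Option (Sq V) →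
    Option (MState X Y F V × Option (Sq V) × Move × Move × List Y)
  | (k, f, .boot), _, _ =>
    some ((k, f, .ready), some (true, fun _ => false), .stay, .stay, [])
  | ([], _, .ready), _, _ => none
  | (.arith dst a b neg c g :: k, f, .ready), _, z =>
    some ((.arith dst a b neg c g :: k, f, .right c), z, .stay, .stay, [])
  | (.ctl g d o :: k, f, .ready), x, z => some ((k, g x f, .ready), z, d, .stay, o f)
  | (.seq p q :: k, f, .ready), _, z => some ((p :: q :: k, f, .ready), z, .stay, .stay, [])
  | (.branch h :: k, f, .ready), x, z => some ((h x f :: k, f, .ready), z, .stay, .stay, [])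
  | (.loop c p :: k, f, .ready), x, z =>
    some ((if c x f then p :: .loop c p :: k else k, f, .ready), z, .stay, .stay, [])
  | (.arith dst a b neg c₀ g :: k, f, .right c), _, some q =>
    some ((.arith dst a b neg c₀ g :: k, f, .right (carryBit (q.2 a) (xor (q.2 b) neg) c)),
      some (sweepSq dst a b neg c q), .stay, .right, [])
  | (.arith dst a b neg c₀ g :: k, f, .right c), _, none =>
    some ((.arith dst a b neg c₀ g :: k, f, .left c),
      if c && !neg then some (false, fun v => decide (dst = some v)) else none, .stay, .left, [])
  | (.arith dst a b neg c₀ g :: k, f, .left c), _, some q =>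
    some (if q.1 then (k, g c f, .ready) else (.arith dst a b neg c₀ g :: k, f, .left c),
      some q, .stay, if q.1 then .stay else .left, [])
  | _, _, _ => none

theorem machine_mem_stackSet (p : Cmd X Y F V) (k : List (Cmd X Y F V)) :
    ∀ l ∈ stackSet p k, ∀ f ph x z o, machine (l, f, ph) x z = some o →
      o.1.1 ∈ stackSet p k ∪ {k} := by
  induction p generalizing k with
  | arith dst a b neg c g =>
    rintro l rfl f (_ | _ | _ | _) x (_ | z) o h <;> simp [machine] at h <;>
      subst h <;> simp [stackSet]
    split <;> simp
  | ctl g d o =>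
    rintro l rfl f (_ | _ | _ | _) x (_ | z) o h <;> simp [machine] at h <;>
      subst h <;> simp [stackSet]
  | seq p q hp hq =>
    rintro l (rfl | h | h) f ph x z o ho
    · rcases ph with _ | _ | _ | _ <;> rcases z with _ | z <;> simp [machine] at ho <;>
        subst ho <;> simp [stackSet, cons_mem_stackSet]
    · rcases hp _ l h f ph x z o ho with h | h
      · exact .inl (.inr (.inl h))
      · exact .inl (.inr (.inr (h ▸ cons_mem_stackSet _ _)))
    · rcases hq _ l h f ph x z o ho with h | h
      · exact .inl (.inr (.inr h))
      · exact .inr h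
  | branch h ih =>
    rintro l (rfl | hl) f ph x z o ho
    · rcases ph with _ | _ | _ | _ <;> rcases z with _ | z <;> simp [machine] at ho <;>
        subst ho <;> simp only [stackSet] <;> first
          | exact .inl (.inl rfl)
          | exact .inl (.inr (Set.mem_iUnion₂.2 ⟨x, f, cons_mem_stackSet _ _⟩))
    · obtain ⟨x', f', hl⟩ := Set.mem_iUnion₂.1 hl
      rcases ih x' f' k l hl f ph x z o ho with h | h
      · exact .inl (.inr (Set.mem_iUnion₂.2 ⟨x', f', h⟩))
      · exact .inr h
  | loop c p hp =>
    rintro l (rfl | hl) f ph x z o ho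
    · rcases ph with _ | _ | _ | _ <;> rcases z with _ | z <;> simp [machine] at ho <;>
        subst ho <;> simp [stackSet] <;>
        by_cases hc : c x f = true <;> simp [hc, cons_mem_stackSet]
    · rcases hp _ l hl f ph x z o ho with h | h
      · exact .inl (.inr h)
      · exact .inl (.inl h)

/-- The configuration of the machine that is about to execute the stack `k` in the state `s`, with
the counters stored in the squares `l`. -/
def readyCfg (k : List (Cmd X Y F V)) (s : Store Y F V) (l : List (Sq V)) :
    RawCfg (MState X Y F V) (Option (Sq V)) Y :=
  ⟨(k, s.flag, .ready), s.pos, fun i => l[i]?, 0, s.out⟩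

variable {w : List X} {b : ℕ}

/-- The sweep to the right. -/
theorem run_right (dst : Option V) (a a' : V) (neg c₀ : Bool) (g : Bool → F → F)
    (k : List (Cmd X Y F V)) (f : F) (pos : ℕ) (out : List Y) (hpos : pos ≤ w.length + 1)
    (l₂ l₁ : List (Sq V)) (c : Bool) (hb : l₁.length + l₂.length ≤ b) :
    Relation.ReflTransGen (BoundedStep machine w b)
      ⟨(.arith dst a a' neg c₀ g :: k, f, .right c), pos, fun i => (l₁ ++ l₂)[i]?,
        l₁.length, out⟩
      ⟨(.arith dst a a' neg c₀ g :: k, f, .right (sweep dst a a' neg c l₂).2), pos,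
        fun i => (l₁ ++ (sweep dst a a' neg c l₂).1)[i]?, l₁.length + l₂.length, out⟩ := by
  induction l₂ generalizing l₁ c with
  | nil => exact .refl
  | cons q l₂ ih =>
    rw [List.length_cons] at hb
    have h := ih (l₁ ++ [sweepSq dst a a' neg c q]) (carryBit (q.2 a) (xor (q.2 a') neg) c)
      (by simp; omega)
    have e : l₁.length + (q :: l₂).length = (l₁ ++ [sweepSq dst a a' neg c q]).length + l₂.length := by
      simp; omega
    rw [e]
    refine .head (b := ⟨(.arith dst a a' neg c₀ g :: k, f,
      .right (carryBit (q.2 a) (xor (q.2 a') neg) c)), pos,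
      fun i => (l₁ ++ [sweepSq dst a a' neg c q] ++ l₂)[i]?,
      (l₁ ++ [sweepSq dst a a' neg c q]).length, out⟩) ⟨?_, ?_⟩ ?_
    · simp [rawStep, machine, Move.apply, hpos, update_getElem?]
    · exact Nat.lt_of_lt_of_le (by omega : l₁.length < l₁.length + (l₂.length + 1)) hb
    · convert h using 2
      all_goals simp [sweep]

/-- The way back to the first square. -/
theorem run_left (dst : Option V) (a a' : V) (neg c₀ : Bool) (g : Bool → F → F)
    (k : List (Cmd X Y F V)) (f : F) (pos : ℕ) (out : List Y) (hpos : pos ≤ w.length + 1)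
    (q : Sq V) (l : List (Sq V)) (hl : IsMarked (q :: l)) (c : Bool) (n : ℕ)
    (hn : n ≤ l.length) (hb : n < b) :
    Relation.ReflTransGen (BoundedStep machine w b)
      ⟨(.arith dst a a' neg c₀ g :: k, f, .left c), pos, fun i => (q :: l)[i]?, n, out⟩
      ⟨(k, g c f, .ready), pos, fun i => (q :: l)[i]?, 0, out⟩ := by
  induction n with
  | zero =>
    refine .single ⟨?_, hb⟩
    simp [rawStep, machine, Move.apply, hpos, hl.1]
  | succ n ih =>
    refine .head ⟨?_, hb⟩ (ih (by omega) (by omega))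
    have h1 : (q :: l)[n + 1]? = some l[n] := by simp
    have h2 : (l[n]).1 = false := hl.2 _ (List.getElem_mem _)
    simp [rawStep, machine, Move.apply, hpos, h1, h2]

/-- Execution of an arithmetical command, with the list of squares that it leaves behind. -/
theorem run_arith (dst : Option V) (a a' : V) (neg c : Bool) (g : Bool → F → F)
    (k : List (Cmd X Y F V)) (s : Store Y F V) (hpos : s.pos ≤ w.length + 1)
    (l : List (Sq V)) (hl : IsMarked l) (hb : l.length < b) (l' : List (Sq V))
    (hl' : l' = (sweep dst a a' neg c l).1 ++
      (if (sweep dst a a' neg c l).2 && !neg then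
        some ((false, fun v => decide (dst = some v)) : Sq V) else none).toList) :
    IsMarked l' ∧ Relation.ReflTransGen (BoundedStep machine w b)
      (readyCfg (.arith dst a a' neg c g :: k) s l)
      (readyCfg k { s with flag := g (sweep dst a a' neg c l).2 s.flag } l') := by
  obtain _ | ⟨q, t⟩ := l
  · exact hl.elim
  have hm : IsMarked l' := by
    subst hl'
    simp only [sweep, List.cons_append]
    refine ⟨hl.1, fun q' hq' => ?_⟩
    rcases List.mem_append.1 hq' with h | h
    · have := List.mem_map_of_mem (f := Prod.fst) h
      rw [map_fst_sweep, List.mem_map] at this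
      obtain ⟨q'', h'', e⟩ := this
      rw [← e]; exact hl.2 _ h''
    · simp at h
      rw [← h.2]
  refine ⟨hm, ?_⟩
  have h1 := run_right (w := w) (b := b) dst a a' neg c g k s.flag s.pos s.out hpos (q :: t) [] c
    (by simp at hb ⊢; omega)
  obtain _ | ⟨q', t'⟩ := l'
  · exact hm.elim
  have ht : t.length ≤ t'.length := by
    have := congrArg List.length hl'
    simp [sweep, length_sweep] at this
    omega
  have h2 := run_left (w := w) (b := b) dst a a' neg c g k s.flag s.pos s.out hpos q' t' hm
    (sweep dst a a' neg c (q :: t)).2 t.length ht (by simp at hb; omega)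
  refine .head (b := ⟨(.arith dst a a' neg c g :: k, s.flag, .right c), s.pos,
    fun i => (q :: t)[i]?, 0, s.out⟩) ⟨?_, by simp [readyCfg]; omega⟩ ?_
  · simp [readyCfg, rawStep, machine, Move.apply, hpos]
  refine h1.trans (.head ⟨?_, by simpa using hb⟩ h2)
  have h3 := update_getElem?_end (sweep dst a a' neg c (q :: t)).1
      (if (sweep dst a a' neg c (q :: t)).2 && !neg then
        some ((false, fun v => decide (dst = some v)) : Sq V) else none)
  rw [← hl', length_sweep] at h3
  have h4 : (sweep dst a a' neg c (q :: t)).1[(q :: t).length]? = none := by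
    simp [length_sweep]
  simp only [rawStep, machine, List.nil_append, List.length_nil, zero_add, h4, Move.apply,
    Option.map_some, min_eq_left hpos, List.append_nil, h3]
  simp

/-- The machine executes counter programs. -/
theorem run_of_exec {B : ℕ} {p : Cmd X Y F V} {s s' : Store Y F V} (h : Exec w B p s s')
    (hb : Nat.log 2 B + 1 < b) (k : List (Cmd X Y F V)) (l : List (Sq V))
    (hl : Stores B l s.mem) (hpos : s.pos ≤ w.length + 1) :
    s'.pos ≤ w.length + 1 ∧ ∃ l', Stores B l' s'.mem ∧
      Relation.ReflTransGen (BoundedStep machine w b) (readyCfg (p :: k) s l)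
        (readyCfg k s' l') := by
  induction h generalizing k l with
  | @add s v a a' c h =>
    refine ⟨hpos, ?_⟩
    obtain ⟨h1, h2⟩ := run_arith (w := w) (b := b) (some v) a a' false c (fun _ f => f) k s hpos l
      hl.marked (hl.length_le.trans_lt hb) _ rfl
    refine ⟨_, ⟨h1, fun u => ?_, ?_⟩, h2⟩
    · rw [val_append, length_sweep]
      rcases eq_or_ne u v with rfl | hu
      · have := val_sweep_add u a a' c l
        rw [hl.val_eq, hl.val_eq] at this
        simp only [Function.update_self, ← this]
        split_ifs with hc <;> simp at hc <;> simp [hc, val]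
      · rw [val_sweep_of_ne (by simpa using hu.symm), hl.val_eq]
        simp only [Function.update_of_ne hu]
        split_ifs <;> simp [val, hu.symm]
    · rw [List.length_append, length_sweep]
      have := val_sweep_add v a a' c l
      rw [hl.val_eq, hl.val_eq] at this
      split_ifs with hc
      · simp only [Bool.and_eq_true] at hc
        simp only [hc.1, Bool.toNat_true] at this
        have h2 : 2 ^ l.length ≤ B := by omega
        have := Nat.le_log_of_pow_le (by norm_num) h2
        simpa using this
      · simpa using hl.length_le
  | @sub s v a a' h =>
    refine ⟨hpos, ?_⟩
    obtain ⟨h1, h2⟩ := run_arith (w := w) (b := b) (some v) a a' true true (fun _ f => f) k s hpos l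
      hl.marked (hl.length_le.trans_lt hb) _ rfl
    refine ⟨_, ⟨h1, fun u => ?_, ?_⟩, h2⟩
    · simp only [Bool.not_true, Bool.and_false, Bool.false_eq_true, if_false, Option.toList_none,
        List.append_nil]
      rcases eq_or_ne u v with rfl | hu
      · have := val_sweep_sub u a a' true l
        rw [sweep_snd_sub, hl.val_eq, hl.val_eq, decide_eq_true h] at this
        simp only [Function.update_self]
        simp at this
        omega
      · rw [val_sweep_of_ne (by simpa using hu.symm), hl.val_eq, Function.update_of_ne hu]
    · simpa [length_sweep] using hl.length_le
  | @test s a a' g =>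
    refine ⟨hpos, ?_⟩
    obtain ⟨h1, h2⟩ := run_arith (w := w) (b := b) none a a' true true g k s hpos l
      hl.marked (hl.length_le.trans_lt hb) _ rfl
    rw [Bool.not_true, Bool.and_false, if_neg Bool.false_ne_true, Option.toList_none, List.append_nil,
      sweep_none] at h1 h2
    rw [sweep_snd_sub, hl.val_eq, hl.val_eq] at h2
    exact ⟨l, hl, h2⟩
  | ctl =>
    refine ⟨min_le_right _ _, l, hl, .single ⟨?_, by simp [readyCfg]; omega⟩⟩
    simp [readyCfg, rawStep, machine, Move.apply]
  | seq _ _ ih ih' =>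
    obtain ⟨hp, l', hl', h⟩ := ih (_ :: k) l hl hpos
    obtain ⟨hp', l'', hl'', h'⟩ := ih' k l' hl' hp
    refine ⟨hp', l'', hl'', .head ⟨?_, by simp [readyCfg]; omega⟩ (h.trans h')⟩
    simp [readyCfg, rawStep, machine, Move.apply, hpos]
  | branch _ ih =>
    obtain ⟨hp, l', hl', h⟩ := ih k l hl hpos
    refine ⟨hp, l', hl', .head ⟨?_, by simp [readyCfg]; omega⟩ h⟩
    simp [readyCfg, rawStep, machine, Move.apply, hpos]
  | loop_false h =>
    refine ⟨hpos, l, hl, .single ⟨?_, by simp [readyCfg]; omega⟩⟩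
    simp [readyCfg, rawStep, machine, Move.apply, hpos, h]
  | loop_true hc _ _ ih ih' =>
    obtain ⟨hp, l', hl', h⟩ := ih (_ :: k) l hl hpos
    obtain ⟨hp', l'', hl'', h'⟩ := ih' k l' hl' hp
    refine ⟨hp', l'', hl'', .head ⟨?_, by simp [readyCfg]; omega⟩ (h.trans h')⟩
    simp [readyCfg, rawStep, machine, Move.apply, hpos, hc]

/-- A function that is computed by a counter program whose counters stay below a linear bound is
logspace computable. -/
theorem isLogspaceComputable_of_exec [Finite X] [Finite Y] [Finite F] [Finite V]
    (p : Cmd X Y F V) (f₀ : F) (f : List X → List Y) (m : ℕ)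
    (h : ∀ w : List X, ∃ s' : Store Y F V,
      Exec w (m * (w.length + 1)) p ⟨f₀, fun _ => 0, 0, []⟩ s' ∧ s'.out = f w) :
    IsLogspaceComputable f := by
  have hlog : ∀ n : ℕ, Nat.log 2 (m * (n + 1)) + 1 < (m + 4) * (Nat.log 2 n + 1) := by
    intro n
    have h1 : m * (n + 1) < 2 ^ (m + (Nat.log 2 n + 1)) := by
      rw [pow_add]
      exact Nat.mul_lt_mul_of_lt_of_le Nat.lt_two_pow_self
        (Nat.lt_pow_succ_log_self (by norm_num) n) (by positivity)
    have h2 : Nat.log 2 (m * (n + 1)) ≤ m + (Nat.log 2 n + 1) :=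
      (Nat.log_mono_right h1.le).trans (by rw [Nat.log_pow (by norm_num)])
    nlinarith
  refine isLogspaceComputable_of_rawStep machine ([p], f₀, .boot) none
    {x | x.1 ∈ stackSet p [] ∪ {[]}} ?_ (.inl (cons_mem_stackSet _ _)) ?_ f (m + 4) fun w => ?_
  · exact ((finite_stackSet p []).union (Set.finite_singleton _)).preimage' (by
      intro k _
      exact Set.Finite.subset (Set.finite_range fun x : F × Phase => (k, x))
        (by rintro ⟨k', x⟩ rfl; exact ⟨x, rfl⟩))
  · rintro ⟨k, g, ph⟩ (hk | hk) x z o ho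
    · exact machine_mem_stackSet _ _ k hk g ph x z o ho
    · cases hk
      rcases ph with _ | _ | _ | _ <;> simp [machine] at ho
      subst ho
      exact .inr rfl
  · obtain ⟨s', h1, h2⟩ := h w
    obtain ⟨-, l', hl', hr⟩ := run_of_exec (b := (m + 4) * (Nat.log 2 w.length + 1)) h1 (hlog _) []
      [(true, fun _ => false)] ⟨by simp [IsMarked], by simp [val], by simp⟩ (by simp)
    refine ⟨_, .head ⟨?_, by positivity⟩ hr, ?_, by simp [readyCfg], h2⟩
    · simp [readyCfg, rawStep, machine, Move.apply]
      funext i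
      cases i <;> simp
    · simp [readyCfg, rawStep, machine]

end Logspace

/-! ### Arithmetic modulo a counter -/

namespace Logspace

/-- The finite control of the programs below: a scratch bit, one bit for each target, and an
integer modulo `E`. -/
structure Flag (T : Type*) (E : ℕ) where
  b : Bool
  ok : T → Bool
  r : ZMod E

instance {T : Type*} [Finite T] {E : ℕ} [NeZero E] : Finite (Flag T E) :=
  Finite.of_surjective (fun x : Bool × (T → Bool) × ZMod E => (⟨x.1, x.2.1, x.2.2⟩ : Flag T E))
    fun f => ⟨(f.b, f.ok, f.r), rfl⟩

/-- The counters of the programs below: the constants `0` and `1`; the length `len` of the input;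
the bound `top` for the moduli; the ends `lo` and `hi` of the current segment of the input; the
positive and the negative part of a weight; the modulus `j`; the current position `t`; and the
entries, modulo `j`, of the target matrices, of the current matrix and of an auxiliary matrix. -/
inductive Ctr (T Ω : Type*)
  | zero | one | len | top | lo | hi | plus | minus | j | t
  | tgt (T : T) (ω b : Ω)
  | mat (ω b : Ω)
  | tmp (ω b : Ω)

noncomputable instance {T Ω : Type*} : DecidableEq (Ctr T Ω) := Classical.decEq _

instance {T Ω : Type*} [Finite T] [Finite Ω] : Finite (Ctr T Ω) :=
  Finite.of_surjective
    (fun x : (Fin 10) ⊕ (T × Ω × Ω) ⊕ (Ω × Ω) ⊕ (Ω × Ω) => match x with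
      | .inl 0 => Ctr.zero | .inl 1 => .one | .inl 2 => .len | .inl 3 => .top | .inl 4 => .lo
      | .inl 5 => .hi | .inl 6 => .plus | .inl 7 => .minus | .inl 8 => .j | .inl 9 => .t
      | .inr (.inl (T, ω, b)) => .tgt T ω b
      | .inr (.inr (.inl (ω, b))) => .mat ω b
      | .inr (.inr (.inr (ω, b))) => .tmp ω b)
    (by
      rintro (_ | _ | _ | _ | _ | _ | _ | _ | _ | _ | ⟨T, ω, b⟩ | ⟨ω, b⟩ | ⟨ω, b⟩)
      exacts [⟨.inl 0, rfl⟩, ⟨.inl 1, rfl⟩, ⟨.inl 2, rfl⟩, ⟨.inl 3, rfl⟩, ⟨.inl 4, rfl⟩,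
        ⟨.inl 5, rfl⟩, ⟨.inl 6, rfl⟩, ⟨.inl 7, rfl⟩, ⟨.inl 8, rfl⟩, ⟨.inl 9, rfl⟩,
        ⟨.inr (.inl (T, ω, b)), rfl⟩, ⟨.inr (.inr (.inl (ω, b))), rfl⟩,
        ⟨.inr (.inr (.inr (ω, b))), rfl⟩])

variable {X Y T Ω : Type*} {E : ℕ}

/-- The programs considered from here on. -/
abbrev Prog (X Y T Ω : Type*) (E : ℕ) := Cmd X Y (Flag T E) (Ctr T Ω)

/-- The states of such programs. -/
abbrev St (Y T Ω : Type*) (E : ℕ) := Store Y (Flag T E) (Ctr T Ω)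

namespace Prog

/-- The program that does nothing. -/
def skip : Prog X Y T Ω E := .loop (fun _ _ => false) (.ctl (fun _ f => f) .stay fun _ => [])

/-- Apply a function to the finite control. -/
def setFlag (g : Flag T E → Flag T E) : Prog X Y T Ω E := .test .zero .zero fun _ f => g f

/-- Move the input head. -/
def move (d : Move) : Prog X Y T Ω E := .ctl (fun _ f => f) d fun _ => []

/-- Emit a word that depends on the finite control. -/
def emit (o : Flag T E → List Y) : Prog X Y T Ω E := .ctl (fun _ f => f) .stay o

/-- `v := v + 1`. -/
def inc (v : Ctr T Ω) : Prog X Y T Ω E := .add v v .zero true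

/-- `v := 0`. -/
def clear (v : Ctr T Ω) : Prog X Y T Ω E := .sub v v v

/-- Execute `p` exactly `n` times. -/
def rep : ℕ → Prog X Y T Ω E → Prog X Y T Ω E
  | 0, _ => skip
  | n + 1, p => .seq p (rep n p)

/-- Execute the programs `p i` for the entries `i` of a list. -/
def each {ι : Type*} (l : List ι) (p : ι → Prog X Y T Ω E) : Prog X Y T Ω E :=
  l.foldr (fun i q => .seq (p i) q) skip

/-- `v := v mod j`, for `v < 2 j`. -/
def reduce (v : Ctr T Ω) : Prog X Y T Ω E :=
  .seq (.test v .j fun c f => { f with b := c })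
    (.branch fun _ f =>
      if f.b then .seq (.sub v v .j) (setFlag fun f => { f with b := false }) else skip)

/-- `v := v + z u mod j`. -/
def addMul (v u : Ctr T Ω) (z : ℤ) : Prog X Y T Ω E :=
  rep z.natAbs (if 0 ≤ z then .seq (.add v v u false) (reduce v)
    else .seq (.add v v .j false) (.seq (.sub v v u) (reduce v)))

/-- `v` becomes a linear combination, modulo `j`, of other counters. -/
def lin (v : Ctr T Ω) (l : List (Ctr T Ω × ℤ)) : Prog X Y T Ω E :=
  .seq (clear v) (each l fun p => addMul v p.1 p.2)

/-- Repeat `p` as long as `a < b`. -/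
def whileLt (a b : Ctr T Ω) (p : Prog X Y T Ω E) : Prog X Y T Ω E :=
  .seq (.test a b fun c f => { f with b := !c })
    (.loop (fun _ f => f.b)
      (.seq (setFlag fun f => { f with b := false })
        (.seq p (.test a b fun c f => { f with b := !c }))))

end Prog

open Prog

variable {w : List X} {B : ℕ} {s : St Y T Ω E}

theorem exec_skip : Exec w B (skip : Prog X Y T Ω E) s s := .loop_false rfl

theorem exec_setFlag (g : Flag T E → Flag T E) :
    Exec w B (setFlag g : Prog X Y T Ω E) s { s with flag := g s.flag } := .test

theorem exec_inc {v : Ctr T Ω} (h0 : s.mem .zero = 0) (h : s.mem v + 1 ≤ B) :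
    Exec w B (inc v : Prog X Y T Ω E) s
      { s with mem := Function.update s.mem v (s.mem v + 1) } := by
  have := Exec.add (w := w) (B := B) (s := s) (v := v) (a := v) (b := .zero) (c := true)
    (by simpa [h0] using h)
  simpa [inc, h0] using this

theorem exec_clear (v : Ctr T Ω) :
    Exec w B (clear v : Prog X Y T Ω E) s { s with mem := Function.update s.mem v 0 } := by
  have := Exec.sub (w := w) (B := B) (s := s) (v := v) (a := v) (b := v) le_rfl
  simpa [clear] using this

theorem exec_move (d : Move) :
    Exec w B (move d : Prog X Y T Ω E) s
      { s with pos := min (d.apply s.pos) (w.length + 1) } := by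
  have := Exec.ctl (w := w) (B := B) (s := s) (g := fun _ f => f) (d := d) (o := fun _ => [])
  simpa [move] using this

theorem exec_emit (h : s.pos ≤ w.length + 1) (o : Flag T E → List Y) :
    Exec w B (emit o : Prog X Y T Ω E) s { s with out := s.out ++ o s.flag } := by
  have := Exec.ctl (w := w) (B := B) (s := s) (g := fun _ f => f) (d := .stay) (o := o)
  simpa [emit, Move.apply, h] using this

/-- Execution of a repeated program, with an invariant indexed by the number of repetitions. -/
theorem exec_rep {p : Prog X Y T Ω E} (n : ℕ) (I : ℕ → St Y T Ω E → Prop)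
    (h : ∀ m < n, ∀ s, I m s → ∃ s', Exec w B p s s' ∧ I (m + 1) s') (h0 : I 0 s) :
    ∃ s', Exec w B (rep n p) s s' ∧ I n s' := by
  induction n generalizing s I with
  | zero => exact ⟨s, exec_skip, h0⟩
  | succ n ih =>
    obtain ⟨s', h1, h2⟩ := h 0 (by omega) s h0
    obtain ⟨s'', h3, h4⟩ := ih (fun m => I (m + 1)) (fun m hm => h (m + 1) (by omega)) h2
    exact ⟨s'', .seq h1 h3, h4⟩

theorem exec_rep_inc {v : Ctr T Ω} (hv : v ≠ .zero) (n : ℕ) (h0 : s.mem .zero = 0)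
    (h : s.mem v + n ≤ B) :
    Exec w B (rep n (inc v) : Prog X Y T Ω E) s
      { s with mem := Function.update s.mem v (s.mem v + n) } := by
  obtain ⟨s', h1, rfl⟩ := exec_rep (w := w) (B := B) (s := s) (p := inc v) n
    (fun m s' => s' = { s with mem := Function.update s.mem v (s.mem v + m) }) (by
      rintro m hm _ rfl
      refine ⟨_, exec_inc (by simp [hv.symm, h0]) (by simp; omega), ?_⟩
      simp [add_assoc]) (by simp)
  exact h1

theorem exec_reduce {v : Ctr T Ω} (hb : s.flag.b = false)
    (h : s.mem v < 2 * s.mem .j) :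
    Exec w B (reduce v : Prog X Y T Ω E) s
      { s with mem := Function.update s.mem v (s.mem v % s.mem .j) } := by
  refine .seq .test (.branch ?_)
  obtain ⟨⟨b, ok, r⟩, m, pos, out⟩ := s
  simp only at hb h ⊢
  subst hb
  by_cases hle : m .j ≤ m v
  · have := Exec.seq (Exec.sub (w := w) (B := B) (s := ⟨⟨true, ok, r⟩, m, pos, out⟩)
      (v := v) (a := v) (b := .j) hle) (exec_setFlag fun f => { f with b := false })
    have e : m v % m .j = m v - m .j := by
      rw [Nat.mod_eq_sub_mod hle, Nat.mod_eq_of_lt (by omega)]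
    simpa [hle, e] using this
  · have e : m v % m .j = m v := Nat.mod_eq_of_lt (by omega)
    simpa [hle, e] using exec_skip

/-- The residue of `z` modulo `j`, as a natural number. -/
def res (j : ℕ) (z : ℤ) : ℕ := (z % (j : ℤ)).toNat

theorem res_lt {j : ℕ} (hj : 0 < j) (z : ℤ) : res j z < j := by
  have := Int.emod_lt_of_pos z (by exact_mod_cast hj : (0 : ℤ) < j)
  have := Int.emod_nonneg z (by exact_mod_cast hj.ne' : (j : ℤ) ≠ 0)
  unfold res
  omega

theorem cast_res {j : ℕ} (hj : 0 < j) (z : ℤ) : (res j z : ℤ) = z % j :=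
  Int.toNat_of_nonneg (Int.emod_nonneg z (by exact_mod_cast hj.ne'))

theorem res_add {j : ℕ} (hj : 0 < j) (x y : ℤ) : (res j x + res j y) % j = res j (x + y) := by
  zify
  rw [cast_res hj, cast_res hj, cast_res hj, ← Int.add_emod]

theorem res_sub {j : ℕ} (hj : 0 < j) (x y : ℤ) :
    (res j x + j - res j y) % j = res j (x - y) := by
  have := res_lt hj y
  zify [show res j y ≤ res j x + j by omega]
  rw [cast_res hj, cast_res hj, cast_res hj, add_sub_right_comm, Int.add_emod_right,
    ← Int.sub_emod]

theorem exec_addMul {v u : Ctr T Ω} (hv : v ≠ .j) (hu : u ≠ v) (hb : s.flag.b = false)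
    (hj : 0 < s.mem .j) (hB : 2 * s.mem .j ≤ B) (x y z : ℤ) (hx : s.mem v = res (s.mem .j) x)
    (hy : s.mem u = res (s.mem .j) y) :
    Exec w B (addMul v u z : Prog X Y T Ω E) s
      { s with mem := Function.update s.mem v (res (s.mem .j) (x + z * y)) } := by
  have hlx := fun x => res_lt hj x
  obtain ⟨s', h1, rfl⟩ := exec_rep (w := w) (B := B) (s := s) (p := if 0 ≤ z then
      .seq (.add v v u false) (reduce v)
      else .seq (.add v v .j false) (.seq (.sub v v u) (reduce v))) z.natAbs
    (fun m s' => s' = { s with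
      mem := Function.update s.mem v (res (s.mem .j) (x + z.sign * m * y)) }) (by
      rintro m hm _ rfl
      have ha := hlx (x + z.sign * m * y)
      have hb' := hlx y
      split_ifs with hz
      · refine ⟨_, .seq (.add ?_) (exec_reduce hb ?_), ?_⟩
        · simp [hu, hy]; omega
        · simp [hu, hy, hv.symm]; omega
        · simp only [Function.update_self, Function.update_of_ne hu, Function.update_of_ne hv.symm,
            hy, Function.update_idem, Bool.toNat_false, add_zero]
          rw [res_add hj]
          rcases hz.eq_or_lt with rfl | hz
          · simp at hm
          · rw [Int.sign_eq_one_of_pos hz]; push_cast; ring_nf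
      · refine ⟨_, .seq (.add ?_) (.seq (.sub ?_) (exec_reduce hb ?_)), ?_⟩
        · simp [hv.symm]; omega
        · simp [hu, hy, hv.symm]; omega
        · simp [hu, hy, hv.symm]; omega
        · simp only [Function.update_self, Function.update_of_ne hu, Function.update_of_ne hv.symm,
            hy, Function.update_idem, Bool.toNat_false, add_zero]
          rw [res_sub hj, Int.sign_eq_neg_one_of_neg (by omega)]; push_cast; ring_nf) (by simp [← hx])
  have e : z.sign * (z.natAbs : ℤ) = z := Int.sign_mul_natAbs z
  rw [e] at h1
  exact h1

/-- Execution of `each`, with an invariant indexed by the list of the entries that are done. -/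
theorem exec_each {ι : Type*} {p : ι → Prog X Y T Ω E} (l : List ι)
    (I : List ι → St Y T Ω E → Prop)
    (h : ∀ l' i, l' ++ [i] <+: l → ∀ s, I l' s → ∃ s', Exec w B (p i) s s' ∧ I (l' ++ [i]) s')
    (h0 : I [] s) : ∃ s', Exec w B (each l p) s s' ∧ I l s' := by
  induction l generalizing s I with
  | nil => exact ⟨s, exec_skip, h0⟩
  | cons i l ih =>
    obtain ⟨s', h1, h2⟩ := h [] i (by simp) s h0
    obtain ⟨s'', h3, h4⟩ := ih (fun l' => I (i :: l'))
      (fun l' i' hl => h (i :: l') i' (by simpa using hl)) h2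
    exact ⟨s'', .seq h1 h3, h4⟩

theorem exec_lin {v : Ctr T Ω} (hv : v ≠ .j) (hb : s.flag.b = false) (hj : 0 < s.mem .j)
    (hB : 2 * s.mem .j ≤ B) (l : List (Ctr T Ω × ℤ)) (y : Ctr T Ω → ℤ)
    (hl : ∀ p ∈ l, p.1 ≠ v ∧ s.mem p.1 = res (s.mem .j) (y p.1)) :
    Exec w B (lin v l : Prog X Y T Ω E) s
      { s with
        mem := Function.update s.mem v (res (s.mem .j) (l.map fun p => p.2 * y p.1).sum) } := by
  obtain ⟨s', h1, rfl⟩ := exec_each (w := w) (B := B)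
    (s := { s with mem := Function.update s.mem v 0 }) (p := fun p => addMul v p.1 p.2) l
    (fun l' s' => s' = { s with
      mem := Function.update s.mem v (res (s.mem .j) (l'.map fun p => p.2 * y p.1).sum) }) (by
      rintro l' p hp _ rfl
      obtain ⟨h1, h2⟩ := hl p (hp.subset (by simp))
      have := exec_addMul (X := X) (w := w) (B := B)
        (s := { s with
          mem := Function.update s.mem v (res (s.mem .j) (l'.map fun p => p.2 * y p.1).sum) })
        (v := v) (u := p.1) hv h1 hb
          (by simpa [hv.symm] using hj) (by simpa [hv.symm] using hB)
          (l'.map fun p => p.2 * y p.1).sum (y p.1) p.2 (by simp [hv.symm])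
          (by simp [hv.symm, h1, h2])
      refine ⟨_, this, ?_⟩
      simp [hv.symm]) (by simp [res])
  exact .seq (exec_clear v) h1

/-- Simultaneous assignment of linear combinations modulo `j`. -/
theorem exec_each_lin {ι : Type*} (l : List ι) (dst : ι → Ctr T Ω) (hinj : Function.Injective dst)
    (src : ι → List (Ctr T Ω × ℤ)) (hdj : ∀ i, dst i ≠ .j) (hb : s.flag.b = false)
    (hj : 0 < s.mem .j) (hB : 2 * s.mem .j ≤ B) (y : Ctr T Ω → ℤ)
    (hl : ∀ i, ∀ p ∈ src i, (∀ i', p.1 ≠ dst i') ∧ s.mem p.1 = res (s.mem .j) (y p.1)) :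
    ∃ m, Exec w B (each l fun i => lin (dst i) (src i) : Prog X Y T Ω E) s { s with mem := m } ∧
      (∀ i ∈ l, m (dst i) = res (s.mem .j) ((src i).map fun p => p.2 * y p.1).sum) ∧
      ∀ v, (∀ i, v ≠ dst i) → m v = s.mem v := by
  obtain ⟨s', h1, m, rfl, h2, h3⟩ := exec_each (w := w) (B := B) (s := s)
    (p := fun i => lin (dst i) (src i)) l
    (fun l' s' => ∃ m, s' = { s with mem := m } ∧
      (∀ i ∈ l', m (dst i) = res (s.mem .j) ((src i).map fun p => p.2 * y p.1).sum) ∧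
      ∀ v, (∀ i, v ≠ dst i) → m v = s.mem v) (by
      rintro l' i - _ ⟨m, rfl, h2, h3⟩
      have hm : m .j = s.mem .j := h3 _ fun i => (hdj i).symm
      refine ⟨_, exec_lin (s := { s with mem := m }) (hdj i) hb (by simpa [hm] using hj) (by simpa [hm] using hB) (src i) y
        fun p hp => ⟨(hl i p hp).1 i, ?_⟩, _, rfl, ?_, ?_⟩
      · simp only [hm, h3 _ (hl i p hp).1, (hl i p hp).2]
      · intro i' hi'
        by_cases e : dst i' = dst i
        · cases hinj e
          simp [hm]
        · rw [Function.update_of_ne e]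
          rcases List.mem_append.1 hi' with h | h
          · exact h2 _ h
          · exact (e (congrArg dst (by simpa using h))).elim
      · intro v hv
        simp only [Function.update_of_ne (hv i), h3 v hv]) ⟨s.mem, rfl, by simp, by simp⟩
  exact ⟨m, h1, h2, h3⟩

/-- Total correctness of `whileLt`: an invariant, and a measure that decreases. -/
theorem exec_whileLt {a b : Ctr T Ω} {p : Prog X Y T Ω E} (I : St Y T Ω E → Prop)
    (μ : St Y T Ω E → ℕ) (hI : ∀ s, I s → s.flag.b = false)
    (hp : ∀ s, I s → s.mem a < s.mem b → ∃ s', Exec w B p s s' ∧ I s' ∧ μ s' < μ s) (hs : I s) :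
    ∃ s', Exec w B (whileLt a b p) s s' ∧ I s' ∧ s'.mem b ≤ s'.mem a := by
  have key : ∀ n s, μ s < n → I s → ∃ s', Exec w B (.loop (fun _ f => f.b)
      (.seq (setFlag fun f => { f with b := false })
        (.seq p (.test a b fun c f => { f with b := !c }))))
      { s with flag := { s.flag with b := !decide (s.mem b ≤ s.mem a) } } s' ∧ I s' ∧
      s'.mem b ≤ s'.mem a := by
    intro n
    induction n with
    | zero => intro s h; omega
    | succ n ih =>
      intro s hn hs
      have e : ∀ s : St Y T Ω E, I s → { s with flag := { s.flag with b := false } } = s := by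
        rintro ⟨⟨b, ok, r⟩, m, pos, out⟩ h
        have := hI _ h
        simp only at this
        subst this
        rfl
      by_cases hle : s.mem b ≤ s.mem a
      · refine ⟨s, ?_, hs, hle⟩
        simp only [hle, decide_true, Bool.not_true]
        rw [e s hs]
        exact .loop_false (hI s hs)
      · obtain ⟨s', h1, h2, h3⟩ := hp s hs (by omega)
        obtain ⟨s'', h4, h5⟩ := ih s' (by omega) h2
        refine ⟨s'', .loop_true (by simp [hle]) (.seq (exec_setFlag _) (.seq ?_ .test)) h4, h5⟩
        simp only
        rw [e s hs]
        exact h1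
  obtain ⟨s', h1, h2⟩ := key (μ s + 1) s (by omega) hs
  exact ⟨s', .seq .test h1, h2⟩

end Logspace

/-! ### Comparing matrix products in logarithmic space -/

set_option linter.unusedSectionVars false

namespace Logspace

open Prog

variable {X Y T Ω : Type*} {E : ℕ}

/-- The data of the algorithm. An input letter acts by an integer matrix, and each of finitely many
targets is an integer matrix. Moreover letters and targets have weights (counted in units of
`unit`), and targets come with an angle modulo `E` and with words to be emitted. The moduli used
for an input of length `n` go up to `bound * (n + 1)`. -/
structure Scheme (X Y T Ω : Type*) (E : ℕ) where
  letter : X → Matrix Ω Ω ℤ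
  target : T → Matrix Ω Ω ℤ
  letterWt : X → ℤ
  targetWt : T → ℕ
  unit : ℕ
  rot : T → ZMod E
  word : ZMod E → T → List Y
  up : Y
  down : Y
  bound : ℕ

/-- The letters of `w` from position `i` up to position `k`. -/
def slice (w : List X) (i k : ℕ) : List X := (w.drop i).take (k - i)

theorem slice_self (w : List X) (i : ℕ) : slice w i i = [] := by simp [slice]

theorem slice_succ (w : List X) {i k : ℕ} (hi : i ≤ k) (hk : k < w.length) :
    slice w i (k + 1) = slice w i k ++ [w[k]] := by
  unfold slice
  rw [Nat.succ_sub hi, List.take_add_one]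
  simp [hi, hk]

theorem slice_append (w : List X) {i k m : ℕ} (hi : i ≤ k) (hk : k ≤ m) :
    slice w i k ++ slice w k m = slice w i m := by
  unfold slice
  rw [show m - i = (k - i) + (m - k) by omega, List.take_add, List.drop_drop,
    Nat.add_sub_cancel' hi]

theorem length_slice_le (w : List X) (i k : ℕ) : (slice w i k).length ≤ w.length := by
  simp [slice]

theorem inputAt_succ (w : List X) {k : ℕ} (hk : k < w.length) :
    inputAt w (k + 1) = .letter w[k] := by
  simp [inputAt, hk]

variable [Fintype T] [Fintype Ω] [DecidableEq T] [DecidableEq Ω]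

namespace Scheme

variable (S : Scheme X Y T Ω E)

/-- The product of the matrices of the letters of a word, in reverse order. -/
def prod (l : List X) : Matrix Ω Ω ℤ := l.foldl (fun A x => S.letter x * A) 1

theorem prod_append_singleton (l : List X) (x : X) :
    S.prod (l ++ [x]) = S.letter x * S.prod l := by
  simp [prod]

/-- The entries of a matrix. -/
noncomputable def pairs (Ω : Type*) [Fintype Ω] : List (Ω × Ω) := Finset.univ.toList

/-- Initialize the current matrix with `1`, and the target matrices. -/
noncomputable def setup : Prog X Y T Ω E :=
  .seq (each (pairs Ω) fun p => lin (.mat p.1 p.2) [(.one, (1 : Matrix Ω Ω ℤ) p.1 p.2)])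
    (each (Finset.univ : Finset (T × Ω × Ω)).toList fun q =>
      lin (.tgt q.1 q.2.1 q.2.2) [(.one, S.target q.1 q.2.1 q.2.2)])

/-- Multiply the current matrix from the left by `M`. -/
noncomputable def mulLeft (M : Matrix Ω Ω ℤ) : Prog X Y T Ω E :=
  .seq (each (pairs Ω) fun p =>
      lin (.tmp p.1 p.2) ((Finset.univ : Finset Ω).toList.map fun k => (.mat k p.2, M p.1 k)))
    (each (pairs Ω) fun p => lin (.mat p.1 p.2) [(.tmp p.1 p.2, 1)])

/-- Discard the targets that differ from the current matrix. -/
noncomputable def compare : Prog X Y T Ω E :=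
  each (Finset.univ : Finset (T × Ω × Ω)).toList fun q =>
    .seq (.test (.tgt q.1 q.2.1 q.2.2) (.mat q.2.1 q.2.2)
        fun c f => { f with ok := Function.update f.ok q.1 (f.ok q.1 && c) })
      (.test (.mat q.2.1 q.2.2) (.tgt q.1 q.2.1 q.2.2)
        fun c f => { f with ok := Function.update f.ok q.1 (f.ok q.1 && c) })

/-- Move the input head to the first letter of the current segment. -/
def seek : Prog X Y T Ω E :=
  .seq (.loop (fun x _ => match x with | .leftEnd => false | _ => true) (move .left))
    (.seq (move .right) (.seq (clear .t) (whileLt .t .lo (.seq (move .right) (inc .t)))))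

/-- Multiply the matrices of the letters of the current segment. -/
noncomputable def scan : Prog X Y T Ω E :=
  whileLt .t .hi (.seq
    (.branch fun x _ => match x with
      | .letter y => mulLeft (S.letter y)
      | _ => skip)
    (.seq (move .right) (inc .t)))

/-- Compare the matrix product of the current segment with all targets, modulo all moduli. -/
noncomputable def check : Prog X Y T Ω E :=
  .seq (setFlag fun f => { f with ok := fun _ => true }) (.seq (clear .j) (.seq (inc .j)
    (whileLt .j .top (.seq (inc .j) (.seq S.setup (.seq seek (.seq S.scan compare)))))))

end Scheme

open Scheme

variable {w : List X} {B : ℕ} {s : St Y T Ω E} (S : Scheme X Y T Ω E)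

theorem exec_setup (hb : s.flag.b = false) (hj : 1 < s.mem .j) (hB : 2 * s.mem .j ≤ B)
    (h1 : s.mem .one = 1) :
    ∃ m, Exec w B S.setup s { s with mem := m } ∧
      (∀ ω b, m (.mat ω b) = res (s.mem .j) ((1 : Matrix Ω Ω ℤ) ω b)) ∧
      (∀ T ω b, m (.tgt T ω b) = res (s.mem .j) (S.target T ω b)) ∧
      ∀ v, (∀ ω b, v ≠ .mat ω b) → (∀ T ω b, v ≠ .tgt T ω b) → m v = s.mem v := by
  have hone : s.mem .one = res (s.mem .j) 1 := by
    rw [h1, res, Int.emod_eq_of_lt (by norm_num) (by exact_mod_cast hj)]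
    rfl
  obtain ⟨m, e1, e2, e3⟩ := exec_each_lin (X := X) (w := w) (B := B) (s := s) (pairs Ω)
    (fun p => .mat p.1 p.2) (by rintro ⟨a, b⟩ ⟨c, d⟩ h; simpa using h)
    (fun p => [(.one, (1 : Matrix Ω Ω ℤ) p.1 p.2)]) (by simp) hb (by omega) hB (fun _ => 1)
    (by simpa using fun _ _ => hone)
  have hm : m .j = s.mem .j := e3 _ (by simp)
  have hone' : m .one = s.mem .one := e3 _ (by simp)
  obtain ⟨m', f1, f2, f3⟩ := exec_each_lin (X := X) (w := w) (B := B) (s := { s with mem := m })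
    (Finset.univ : Finset (T × Ω × Ω)).toList
    (fun q => .tgt q.1 q.2.1 q.2.2)
    (by rintro ⟨a, b, c⟩ ⟨a', b', c'⟩ h; simpa using h)
    (fun q => [(.one, S.target q.1 q.2.1 q.2.2)]) (by simp) hb (by simp only [hm]; omega)
    (by simp only [hm]; omega) (fun _ => 1) (by simpa [hm, hone'] using fun _ _ _ => hone)
  refine ⟨m', .seq e1 f1, fun ω b => ?_, fun T ω b => ?_, fun v h1 h2 => ?_⟩
  · rw [f3 _ (by simp)]
    simpa using e2 (ω, b) (by simp [pairs])
  · simpa [hm] using f2 (T, ω, b) (by simp)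
  · rw [f3 _ fun q => h2 _ _ _]
    exact e3 _ fun p => h1 _ _

theorem exec_mulLeft (M A : Matrix Ω Ω ℤ) (hb : s.flag.b = false) (hj : 0 < s.mem .j)
    (hB : 2 * s.mem .j ≤ B) (hA : ∀ ω b, s.mem (.mat ω b) = res (s.mem .j) (A ω b)) :
    ∃ m, Exec w B (mulLeft M : Prog X Y T Ω E) s { s with mem := m } ∧
      (∀ ω b, m (.mat ω b) = res (s.mem .j) ((M * A) ω b)) ∧
      ∀ v, (∀ ω b, v ≠ .mat ω b) → (∀ ω b, v ≠ .tmp ω b) → m v = s.mem v := by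
  obtain ⟨m, e1, e2, e3⟩ := exec_each_lin (X := X) (w := w) (B := B) (s := s) (pairs Ω)
    (fun p => .tmp p.1 p.2) (by rintro ⟨a, b⟩ ⟨c, d⟩ h; simpa using h)
    (fun p => (Finset.univ : Finset Ω).toList.map fun k => (.mat k p.2, M p.1 k))
    (by simp) hb hj hB (fun v => match v with | .mat ω b => A ω b | _ => 0)
    (by simpa using fun i j k => hA k j)
  have hm : m .j = s.mem .j := e3 _ (by simp)
  obtain ⟨m', f1, f2, f3⟩ := exec_each_lin (X := X) (w := w) (B := B) (s := { s with mem := m })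
    (pairs Ω) (fun p => .mat p.1 p.2) (by rintro ⟨a, b⟩ ⟨c, d⟩ h; simpa using h)
    (fun p => [(.tmp p.1 p.2, 1)]) (by simp) hb (by simp only [hm]; omega)
    (by simp only [hm]; omega) (fun v => match v with | .tmp ω b => (M * A) ω b | _ => 0) (by
      rintro ⟨ω, b⟩ p hp
      simp only [List.mem_singleton] at hp
      subst hp
      refine ⟨by simp, ?_⟩
      have := e2 (ω, b) (by simp [pairs])
      simp only [hm]
      rw [this]
      simp [Matrix.mul_apply, Function.comp_def])
  refine ⟨m', .seq e1 f1, fun ω b => ?_, fun v h1 h2 => ?_⟩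
  · simpa [hm] using f2 (ω, b) (by simp [pairs])
  · rw [f3 _ fun q => h1 _ _]
    exact e3 _ fun p => h2 _ _

theorem exec_compare : ∃ ok, Exec w B (Scheme.compare : Prog X Y T Ω E) s
      { s with flag := { s.flag with ok := ok } } ∧
    ∀ T, ok T = true ↔ s.flag.ok T = true ∧ ∀ ω b, s.mem (.tgt T ω b) = s.mem (.mat ω b) := by
  obtain ⟨s', h1, ok, rfl, h2⟩ := exec_each (w := w) (B := B) (s := s)
    (p := fun q : T × Ω × Ω => .seq (.test (.tgt q.1 q.2.1 q.2.2) (.mat q.2.1 q.2.2)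
        fun c f => { f with ok := Function.update f.ok q.1 (f.ok q.1 && c) })
      (.test (.mat q.2.1 q.2.2) (.tgt q.1 q.2.1 q.2.2)
        fun c f => { f with ok := Function.update f.ok q.1 (f.ok q.1 && c) }))
    (Finset.univ : Finset (T × Ω × Ω)).toList
    (fun l s' => ∃ ok, s' = { s with flag := { s.flag with ok := ok } } ∧
      ∀ T, ok T = true ↔ s.flag.ok T = true ∧
        ∀ q ∈ l, q.1 = T → s.mem (.tgt T q.2.1 q.2.2) = s.mem (.mat q.2.1 q.2.2)) (by
      rintro l ⟨T, ω, b⟩ - _ ⟨ok, rfl, h⟩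
      refine ⟨_, .seq .test .test, _, rfl, fun T' => ?_⟩
      by_cases hT : T' = T
      · subst hT
        simp only [Function.update_self, Bool.and_eq_true, decide_eq_true_eq, h, List.mem_append,
          List.mem_singleton, or_imp, forall_and, forall_eq, forall_const, and_assoc]
        exact and_congr_right fun _ => and_congr_right fun _ =>
          ⟨fun h => le_antisymm h.2 h.1, fun h => ⟨h.ge, h.le⟩⟩
      · simp only [ne_eq, hT, not_false_eq_true, Function.update_of_ne, h, List.mem_append,
          List.mem_singleton, or_imp, forall_and, forall_eq, Ne.symm hT, IsEmpty.forall_iff,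
          and_true]) ⟨s.flag.ok, rfl, by simp⟩
  refine ⟨ok, h1, fun T => (h2 T).trans (and_congr_right fun _ => ?_)⟩
  simp only [Finset.mem_toList, Finset.mem_univ, forall_const, Prod.forall]
  exact ⟨fun h ω b => h T ω b rfl, by rintro h _ ω b rfl; exact h ω b⟩

theorem exec_seek (hb : s.flag.b = false) (h0 : s.mem .zero = 0) (hlo : s.mem .lo ≤ w.length)
    (hB : w.length ≤ B) :
    Exec w B (seek : Prog X Y T Ω E) s
      { s with pos := s.mem .lo + 1, mem := Function.update s.mem .t (s.mem .lo) } := by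
  have h1 : ∀ n, Exec w B (.loop (fun x _ => match x with | .leftEnd => false | _ => true)
      (move .left) : Prog X Y T Ω E) { s with pos := n } { s with pos := 0 } := by
    intro n
    induction n using Nat.strong_induction_on with
    | _ n ih =>
      obtain _ | n := n
      · exact .loop_false rfl
      · refine .loop_true ?_ (exec_move _) (ih (min n (w.length + 1)) (by omega))
        simp only [inputAt]
        cases w[n]? <;> rfl
  obtain ⟨s', h2, ⟨h3, h4, h5⟩, h6⟩ := exec_whileLt (w := w) (B := B)
    (s := { s with pos := 1, mem := Function.update s.mem .t 0 }) (a := .t) (b := .lo)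
    (p := .seq (move .right) (inc .t))
    (fun s' => s'.mem .t ≤ s.mem .lo ∧ s'.pos = s'.mem .t + 1 ∧
      s' = { s with pos := s'.pos, mem := Function.update s.mem .t (s'.mem .t) })
    (fun s' => s.mem .lo - s'.mem .t) (by rintro s' ⟨-, -, h⟩; rw [h]; exact hb) (by
      rintro s' ⟨h1, h2, h3⟩ h4
      have h0' : s'.mem .zero = 0 := by rw [h3]; simpa using h0
      have hl' : s'.mem .lo = s.mem .lo := by rw [h3]; simp
      refine ⟨_, .seq (exec_move _) (exec_inc (by exact h0') (by simp; omega)), ⟨?_, ?_, ?_⟩, ?_⟩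
      · simp; omega
      · simp [Move.apply]; omega
      · rw [h3]; simp
      · simp; omega) ⟨by simp, by simp, by simp⟩
  have e : s'.mem .t = s.mem .lo := by
    have hl' : s'.mem .lo = s.mem .lo := by rw [h5]; simp
    omega
  rw [h4, e] at h5
  rw [← h5]
  refine .seq (h1 s.pos) (.seq (exec_move _) (.seq (exec_clear _) ?_))
  simpa [Move.apply] using h2

theorem exec_scan (hb : s.flag.b = false) (h0 : s.mem .zero = 0) (hlo : s.mem .lo ≤ s.mem .hi)
    (hhi : s.mem .hi ≤ w.length) (hB : w.length ≤ B) (hj : 0 < s.mem .j)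
    (hBj : 2 * s.mem .j ≤ B) (hpos : s.pos = s.mem .lo + 1) (ht : s.mem .t = s.mem .lo)
    (hA : ∀ ω b, s.mem (.mat ω b) = res (s.mem .j) ((1 : Matrix Ω Ω ℤ) ω b)) :
    ∃ s', Exec w B S.scan s s' ∧ s'.flag = s.flag ∧ s'.out = s.out ∧ s'.pos ≤ w.length + 1 ∧
      (∀ ω b, s'.mem (.mat ω b) =
        res (s.mem .j) (S.prod (slice w (s.mem .lo) (s.mem .hi)) ω b)) ∧
      ∀ v, (∀ ω b, v ≠ .mat ω b) → (∀ ω b, v ≠ .tmp ω b) → v ≠ .t → s'.mem v = s.mem v := by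
  obtain ⟨s', h1, ⟨h2, h3, h4, h5, h6, h7, h8⟩, h9⟩ := exec_whileLt (w := w) (B := B)
    (s := s) (a := .t) (b := .hi)
    (p := .seq (.branch fun x _ => match x with
      | .letter y => mulLeft (S.letter y)
      | _ => skip) (.seq (move .right) (inc .t)))
    (fun s' => s'.flag = s.flag ∧ s'.out = s.out ∧ s'.pos = s'.mem .t + 1 ∧
      s.mem .lo ≤ s'.mem .t ∧ s'.mem .t ≤ s.mem .hi ∧
      (∀ ω b, s'.mem (.mat ω b) =
        res (s.mem .j) (S.prod (slice w (s.mem .lo) (s'.mem .t)) ω b)) ∧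
      ∀ v, (∀ ω b, v ≠ .mat ω b) → (∀ ω b, v ≠ .tmp ω b) → v ≠ .t → s'.mem v = s.mem v)
    (fun s' => s.mem .hi - s'.mem .t) (by rintro s' ⟨h, -⟩; rw [h]; exact hb) (by
      rintro s' ⟨h2, h3, h4, h5, h6, h7, h8⟩ h9
      have ej : s'.mem .j = s.mem .j := h8 _ (by simp) (by simp) (by simp)
      have ehi : s'.mem .hi = s.mem .hi := h8 _ (by simp) (by simp) (by simp)
      have ezero : s'.mem .zero = s.mem .zero := h8 _ (by simp) (by simp) (by simp)
      have hlt : s'.mem .t < w.length := by omega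
      obtain ⟨m, e1, e2, e3⟩ := exec_mulLeft (X := X) (w := w) (B := B) (s := s')
        (S.letter w[s'.mem .t]) (S.prod (slice w (s.mem .lo) (s'.mem .t))) (by rw [h2]; exact hb)
        (by omega) (by omega) (by rw [ej]; exact h7)
      have et : m .t = s'.mem .t := e3 _ (by simp) (by simp)
      have ez : m .zero = 0 := by rw [e3 _ (by simp) (by simp), ezero, h0]
      refine ⟨_, .seq (.branch (s' := { s' with mem := m }) ?_)
          (.seq (exec_move _) (exec_inc (by exact ez) (by simp; omega))),
        ⟨h2, h3, ?_, ?_, ?_, fun ω b => ?_, fun v hv hv' hv'' => ?_⟩, ?_⟩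
      · rw [show inputAt w s'.pos = .letter w[s'.mem .t] by rw [h4, inputAt_succ w hlt]]
        exact e1
      · simp [Move.apply]; omega
      · simp; omega
      · simp; omega
      · simp only [Function.update_self, ne_eq, reduceCtorEq, not_false_eq_true,
          Function.update_of_ne, et]
        rw [slice_succ w h5 hlt, S.prod_append_singleton, e2, ej]
      · simp only [Function.update_of_ne hv'', e3 v hv hv', h8 v hv hv' hv'']
      · simp; omega)
    ⟨rfl, rfl, by omega, by omega, by omega, by rw [ht, slice_self]; exact hA, by simp⟩
  have ehi : s'.mem .hi = s.mem .hi := h8 _ (by simp) (by simp) (by simp)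
  have et : s'.mem .t = s.mem .hi := by omega
  refine ⟨s', h1, h2, h3, by omega, ?_, h8⟩
  rw [← et]
  exact h7

end Logspace

/-! ### Cutting the input into segments -/

namespace Logspace

open Prog Scheme

variable {X Y T Ω : Type*} {E : ℕ} [Fintype T] [Fintype Ω] [DecidableEq T] [DecidableEq Ω]

/-- The counters that are not working memory of `Scheme.check`. -/
def Ctr.IsMain : Ctr T Ω → Prop
  | .j | .t | .tgt _ _ _ | .mat _ _ | .tmp _ _ => False
  | _ => True

/-- What holds between the parts of the main program. -/
structure Base (S : Scheme X Y T Ω E) (w : List X) (s : St Y T Ω E) : Prop where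
  zero : s.mem .zero = 0
  one : s.mem .one = 1
  len : s.mem .len = w.length
  top : s.mem .top = S.bound * (w.length + 1)
  flag : s.flag.b = false
  pos : s.pos ≤ w.length + 1

/-- `s'` arises from `s` by changes to the working memory of `Scheme.check` only. -/
structure Frame (w : List X) (s s' : St Y T Ω E) : Prop where
  flag : s'.flag.b = false
  r : s'.flag.r = s.flag.r
  out : s'.out = s.out
  pos : s'.pos ≤ w.length + 1
  mem : ∀ v : Ctr T Ω, v.IsMain → s'.mem v = s.mem v

/-- The moduli used for `w` tell matrix products over segments of `w` from the targets. -/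
def Scheme.Separates (S : Scheme X Y T Ω E) (w : List X) : Prop :=
  ∀ i k T, (∀ j, 2 ≤ j → j ≤ S.bound * (w.length + 1) → ∀ ω b,
    res j (S.target T ω b) = res j (S.prod (slice w i k) ω b)) →
    S.prod (slice w i k) = S.target T

variable {w : List X} {B : ℕ} {s s' : St Y T Ω E} {S : Scheme X Y T Ω E}

theorem Frame.base (h : Frame w s s') (hs : Base S w s) : Base S w s' :=
  ⟨by rw [h.mem .zero trivial, hs.zero], by rw [h.mem .one trivial, hs.one],
    by rw [h.mem .len trivial, hs.len], by rw [h.mem .top trivial, hs.top], h.flag, h.pos⟩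

theorem exec_check (hs : Base S w s) (hsep : S.Separates w) (h1 : 1 ≤ S.bound)
    (hB : 2 * (S.bound * (w.length + 1)) ≤ B) (hlo : s.mem .lo ≤ s.mem .hi)
    (hhi : s.mem .hi ≤ w.length) :
    ∃ s', Exec w B S.check s s' ∧ Frame w s s' ∧
      ∀ T, s'.flag.ok T = true ↔ S.prod (slice w (s.mem .lo) (s.mem .hi)) = S.target T := by
  have hN : w.length + 1 ≤ S.bound * (w.length + 1) := Nat.le_mul_of_pos_left _ h1
  let s₁ : St Y T Ω E :=
    { s with flag := { s.flag with ok := fun _ => true }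
             mem := Function.update s.mem .j 1 }
  have hs₁ : Exec w B (.seq (setFlag fun f => { f with ok := fun _ => true })
      (.seq (clear .j) (inc .j)) : Prog X Y T Ω E) s s₁ := by
    refine .seq (exec_setFlag _) (.seq (exec_clear _) ?_)
    have := exec_inc (X := X) (w := w) (B := B) (v := .j)
      (s := { s with flag := { s.flag with ok := fun _ => true }
                     mem := Function.update s.mem .j 0 })
      (by simpa using hs.zero) (by simp; omega)
    simpa using this
  obtain ⟨s', e1, ⟨e2, e3, e4, e5⟩, e6⟩ := exec_whileLt (w := w) (B := B) (s := s₁) (a := .j)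
    (b := .top) (p := .seq (inc .j) (.seq S.setup (.seq seek (.seq S.scan Scheme.compare))))
    (fun s' => Frame w s s' ∧ 1 ≤ s'.mem .j ∧ s'.mem .j ≤ S.bound * (w.length + 1) ∧
      ∀ T, s'.flag.ok T = true ↔ ∀ j, 2 ≤ j → j ≤ s'.mem .j → ∀ ω b,
        res j (S.target T ω b) = res j (S.prod (slice w (s.mem .lo) (s.mem .hi)) ω b))
    (fun s' => S.bound * (w.length + 1) - s'.mem .j) (fun s' h => h.1.flag) (by
      rintro s' ⟨e2, e3, e4, e5⟩ e6
      have hs' := e2.base hs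
      rw [hs'.top] at e6
      have elo : s'.mem .lo = s.mem .lo := e2.mem .lo trivial
      have ehi : s'.mem .hi = s.mem .hi := e2.mem .hi trivial
      have a1 := exec_inc (X := X) (w := w) (B := B) (v := .j) (s := s') hs'.zero (by omega)
      obtain ⟨m, a2, a3, a4, a5⟩ := exec_setup (w := w) (B := B)
        (s := { s' with mem := Function.update s'.mem .j (s'.mem .j + 1) }) S hs'.flag
        (by simp; omega) (by simp; omega) (by simpa using hs'.one)
      have mj : m .j = s'.mem .j + 1 := by rw [a5 _ (by simp) (by simp)]; simp
      have mlo : m .lo = s.mem .lo := by rw [a5 _ (by simp) (by simp)]; simpa using elo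
      have mhi : m .hi = s.mem .hi := by rw [a5 _ (by simp) (by simp)]; simpa using ehi
      have mz : m .zero = 0 := by rw [a5 _ (by simp) (by simp)]; simpa using hs'.zero
      simp only [Function.update_self] at a3 a4
      have a6 := exec_seek (X := X) (w := w) (B := B) (s := { s' with mem := m }) hs'.flag mz
        (by simp only [mlo]; omega) (by omega)
      obtain ⟨s₂, b1, b2, b3, b4, b5, b6⟩ := exec_scan (w := w) (B := B) (s :=
        { s' with pos := m .lo + 1, mem := Function.update m .t (m .lo) }) S hs'.flag
        (by simpa using mz) (by simpa [mlo, mhi] using hlo) (by simpa [mhi] using hhi) (by omega)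
        (by simp; omega) (by simp; omega) (by simp) (by simp) (by simpa [mj] using a3)
      simp only [ne_eq, reduceCtorEq, not_false_eq_true, Function.update_of_ne, mj, mlo, mhi]
        at b5
      obtain ⟨ok, c1, c2⟩ := exec_compare (X := X) (w := w) (B := B) (s := s₂)
      have hj₂ : s₂.mem .j = s'.mem .j + 1 := by
        rw [b6 _ (by simp) (by simp) (by simp)]; simpa using mj
      refine ⟨_, .seq a1 (.seq a2 (.seq a6 (.seq b1 c1))), ⟨⟨?_, ?_, ?_, b4, ?_⟩, ?_, ?_, ?_⟩, ?_⟩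
      · simpa [b2] using hs'.flag
      · simpa [b2] using e2.r
      · simpa [b3] using e2.out
      · intro v hv
        have h1 : ∀ ω b, v ≠ .mat ω b := by rintro ω b rfl; exact hv
        have h2 : ∀ ω b, v ≠ .tmp ω b := by rintro ω b rfl; exact hv
        have h3 : ∀ T ω b, v ≠ .tgt T ω b := by rintro T ω b rfl; exact hv
        have h4 : v ≠ .t := by rintro rfl; exact hv
        have h5 : v ≠ .j := by rintro rfl; exact hv
        simp only [b6 v h1 h2 h4, Function.update_of_ne h4, a5 v h1 h3, Function.update_of_ne h5]
        exact e2.mem v hv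
      · simp only [hj₂]; omega
      · simp only [hj₂]; omega
      · intro T
        have ht : ∀ ω b, s₂.mem (.tgt T ω b) = res (s'.mem .j + 1) (S.target T ω b) := by
          intro ω b
          rw [b6 _ (by simp) (by simp) (by simp)]
          simpa using a4 T ω b
        simp only [c2, b2, e5, ht, b5, hj₂]
        refine ⟨fun h j hj hj' => ?_, fun h => ⟨fun j hj hj' => h j hj (by omega),
          h _ (by omega) le_rfl⟩⟩
        rcases Nat.lt_or_ge (s'.mem .j) j with h' | h'
        · obtain rfl : j = s'.mem .j + 1 := by omega
          exact h.2
        · exact h.1 j hj h'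
      · simp only [hj₂]; omega)
    ⟨⟨hs.flag, rfl, rfl, hs.pos, fun v hv => by
        have h5 : v ≠ .j := by rintro rfl; exact hv
        simp [s₁, h5]⟩, by simp [s₁], by simp [s₁]; omega, by simp [s₁]; intros; omega⟩
  have ej : s'.mem .j = S.bound * (w.length + 1) := by
    have := (e2.base hs).top
    omega
  refine ⟨s', ?_, e2, fun T => (e5 T).trans ?_⟩
  · cases hs₁ with
    | seq h1 h2 => cases h2 with
      | seq h2 h3 => exact .seq h1 (.seq h2 (.seq h3 e1))
  · rw [ej]
    exact ⟨fun h => hsep _ _ _ h, fun h j _ _ ω b => by rw [h]⟩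

namespace Scheme

variable (S)

/-- Set `hi` to the end of the longest segment from `lo` on whose product is a target. -/
noncomputable def find : Prog X Y T Ω E :=
  .seq (.add .hi .len .zero false) (.seq S.check
    (.loop (fun _ f => decide (∀ T, f.ok T = false)) (.seq (.sub .hi .hi .one) S.check)))

/-- A canonical choice of an element of a nonempty set of targets. -/
noncomputable def pick [Nonempty T] (ok : T → Bool) : T := Classical.epsilon fun T => ok T = true

/-- Cut the input into segments, and execute `act T` when the target `T` has been found. -/
noncomputable def segments [Nonempty T] (act : T → Prog X Y T Ω E) : Prog X Y T Ω E :=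
  .seq (clear .lo) (whileLt .lo .len
    (.seq S.find (.seq (.branch fun _ f => act (pick f.ok)) (.add .lo .hi .zero false))))

open Classical in
/-- `S.Cut w i l`: the list `l` of targets arises by cutting the word `w` from position `i` on into
segments, each of them as long as possible subject to the condition that the product of its letters
is a target. -/
inductive Cut [Nonempty T] (w : List X) : ℕ → List T → Prop
  | nil : Cut w w.length []
  | cons {i k : ℕ} {t : T} {l : List T} (hik : i < k) (hk : k ≤ w.length)
      (h : S.prod (slice w i k) = S.target t)
      (ht : t = pick fun t => decide (S.prod (slice w i k) = S.target t))
      (hmax : ∀ m, k < m → m ≤ w.length → ∀ t, S.prod (slice w i m) ≠ S.target t)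
      (hl : Cut w k l) : Cut w i (t :: l)

variable {S}

theorem Cut.unique [Nonempty T] {i : ℕ} {l l' : List T} (h : S.Cut w i l) (h' : S.Cut w i l') :
    l = l' := by
  induction h generalizing l' with
  | nil =>
    cases h' with
    | nil => rfl
    | cons hik hk => omega
  | @cons i k t l hik hk h ht hmax hl ih =>
    cases h' with
    | nil => omega
    | @cons _ k' t' l' hik' hk' h' ht' hmax' hl' =>
      obtain rfl : k = k' := by
        rcases lt_trichotomy k k' with hlt | rfl | hlt
        · exact absurd h' (hmax k' hlt hk' _)
        · rfl
        · exact absurd h (hmax' k hlt hk _)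
      rw [ih hl', ht, ht']

end Scheme

theorem exec_find (hs : Base S w s) (hsep : S.Separates w) (h1 : 1 ≤ S.bound)
    (hB : 2 * (S.bound * (w.length + 1)) ≤ B) (hone : ∃ T, S.target T = 1)
    (hlo : s.mem .lo ≤ w.length) :
    ∃ s', Exec w B S.find s s' ∧ Frame w { s with mem := Function.update s.mem .hi (s'.mem .hi) } s' ∧
      s.mem .lo ≤ s'.mem .hi ∧ s'.mem .hi ≤ w.length ∧
      (∀ T, s'.flag.ok T = true ↔ S.prod (slice w (s.mem .lo) (s'.mem .hi)) = S.target T) ∧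
      (∃ T, s'.flag.ok T = true) ∧
      ∀ m, s'.mem .hi < m → m ≤ w.length → ∀ T, S.prod (slice w (s.mem .lo) m) ≠ S.target T := by
  have hN : w.length + 1 ≤ S.bound * (w.length + 1) := Nat.le_mul_of_pos_left _ h1
  -- The loop, from a state in which all ends beyond `hi` have been tried.
  have key : ∀ n s', s'.mem .hi - s.mem .lo = n →
      Frame w { s with mem := Function.update s.mem .hi (s'.mem .hi) } s' →
      s.mem .lo ≤ s'.mem .hi → s'.mem .hi ≤ w.length →
      (∀ T, s'.flag.ok T = true ↔ S.prod (slice w (s.mem .lo) (s'.mem .hi)) = S.target T) →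
      (∀ m, s'.mem .hi < m → m ≤ w.length → ∀ T,
        S.prod (slice w (s.mem .lo) m) ≠ S.target T) →
      ∃ s'', Exec w B (.loop (fun _ f => decide (∀ T, f.ok T = false))
          (.seq (.sub .hi .hi .one) S.check)) s' s'' ∧
        Frame w { s with mem := Function.update s.mem .hi (s''.mem .hi) } s'' ∧
        s.mem .lo ≤ s''.mem .hi ∧ s''.mem .hi ≤ w.length ∧
        (∀ T, s''.flag.ok T = true ↔
          S.prod (slice w (s.mem .lo) (s''.mem .hi)) = S.target T) ∧
        (∃ T, s''.flag.ok T = true) ∧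
        ∀ m, s''.mem .hi < m → m ≤ w.length → ∀ T,
          S.prod (slice w (s.mem .lo) m) ≠ S.target T := by
    intro n
    induction n with
    | zero =>
      intro s' hn hf ha hb hok hmax
      obtain ⟨T, hT⟩ := hone
      have hT' : s'.flag.ok T = true := by
        rw [hok, show s'.mem .hi = s.mem .lo by omega, slice_self, hT]; rfl
      exact ⟨s', .loop_false (by simpa using ⟨T, hT'⟩), hf, ha, hb, hok, ⟨T, hT'⟩, hmax⟩
    | succ n ih =>
      intro s' hn hf ha hb hok hmax
      by_cases hT : ∃ T, s'.flag.ok T = true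
      · exact ⟨s', .loop_false (by simpa using hT), hf, ha, hb, hok, hT, hmax⟩
      · have hs' : Base S w s' := hf.base ⟨by simpa using hs.zero, by simpa using hs.one,
          by simpa using hs.len, by simpa using hs.top, hs.flag, hs.pos⟩
        have c1 := Exec.sub (w := w) (B := B) (s := s') (v := .hi) (a := .hi) (b := .one)
          (by rw [hs'.one]; omega)
        rw [hs'.one] at c1
        have elo : s'.mem .lo = s.mem .lo := by rw [hf.mem .lo trivial]; simp
        obtain ⟨s'', c2, c3, c4⟩ := exec_check (S := S) (w := w) (B := B)
          (s := { s' with mem := Function.update s'.mem .hi (s'.mem .hi - 1) })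
          ⟨by simpa using hs'.zero, by simpa using hs'.one,
          by simpa using hs'.len, by simpa using hs'.top, hs'.flag, hs'.pos⟩ hsep h1 hB
          (by simp; omega) (by simp; omega)
        have ehi : s''.mem .hi = s'.mem .hi - 1 := by rw [c3.mem .hi trivial]; simp
        obtain ⟨s₃, d1, d2⟩ := ih s'' (by omega) ⟨c3.flag, by rw [c3.r]; exact hf.r,
          by rw [c3.out]; exact hf.out, c3.pos, fun v hv => by
            rw [c3.mem v hv]
            by_cases hv' : v = .hi
            · subst hv'; simp [ehi]
            · simp only [Function.update_of_ne hv']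
              rw [hf.mem v hv]
              simp [hv']⟩ (by omega) (by omega)
          (by simpa [elo, ehi] using c4) (by
            intro m hm hm' T hT'
            rcases Nat.lt_or_ge (s'.mem .hi) m with h | h
            · exact hmax m h hm' T hT'
            · obtain rfl : m = s'.mem .hi := by omega
              exact hT ⟨T, (hok T).2 hT'⟩)
        exact ⟨s₃, .loop_true (by simpa using hT) (.seq c1 c2) d1, d2⟩
  have c1 := Exec.add (w := w) (B := B) (s := s) (v := .hi) (a := .len) (b := .zero) (c := false)
    (by rw [hs.zero, hs.len]; simp; omega)
  simp only [hs.zero, hs.len, Bool.toNat_false, add_zero] at c1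
  obtain ⟨s', c2, c3, c4⟩ := exec_check (S := S) (w := w) (B := B)
    (s := { s with mem := Function.update s.mem .hi w.length })
    ⟨by simpa using hs.zero, by simpa using hs.one,
    by simpa using hs.len, by simpa using hs.top, hs.flag, hs.pos⟩ hsep h1 hB
    (by simpa using hlo) (by simp)
  have ehi : s'.mem .hi = w.length := by rw [c3.mem .hi trivial]; simp
  obtain ⟨s'', d1, d2⟩ := key _ s' rfl (by rw [ehi]; exact c3) (by omega) (by omega)
    (by simpa [ehi] using c4) (by intro m _ _; omega)
  exact ⟨s'', .seq c1 (.seq c2 d1), d2⟩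

end Logspace

/-! ### The main program -/

namespace Logspace

open Prog Scheme

variable {X Y T Ω : Type*} {E : ℕ} [Fintype T] [Fintype Ω] [DecidableEq T] [DecidableEq Ω]
variable {w : List X} {B : ℕ} {s s' : St Y T Ω E} {S : Scheme X Y T Ω E}

theorem exec_segments [Nonempty T] (hs : Base S w s) (hsep : S.Separates w) (h1 : 1 ≤ S.bound)
    (hB : 2 * (S.bound * (w.length + 1)) ≤ B) (hone : ∃ T, S.target T = 1)
    (hletter : ∀ x, ∃ T, S.target T = S.letter x) (act : T → Prog X Y T Ω E)
    (I : ℕ → List T → St Y T Ω E → Prop)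
    (hI : ∀ i l s s', I i l s → s'.mem .plus = s.mem .plus → s'.mem .minus = s.mem .minus →
      s'.flag.r = s.flag.r → s'.out = s.out → I i l s')
    (hact : ∀ i k l t s, Base S w s → i < k → k ≤ w.length → I i l s → ∃ s', Exec w B (act t) s s' ∧
      Base S w s' ∧ s'.mem .hi = s.mem .hi ∧ I k (l ++ [t]) s')
    (h0 : I 0 [] s) :
    ∃ s' l, Exec w B (segments S act) s s' ∧ Base S w s' ∧ S.Cut w 0 l ∧ I w.length l s' := by
  have hN : w.length + 1 ≤ S.bound * (w.length + 1) := Nat.le_mul_of_pos_left _ h1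
  obtain ⟨s', e1, ⟨l, e2, e3, e4, e5⟩, e6⟩ := exec_whileLt (w := w) (B := B)
    (s := { s with mem := Function.update s.mem .lo 0 }) (a := .lo)
    (b := .len) (p := .seq S.find (.seq (.branch fun _ f => act (pick f.ok))
      (.add .lo .hi .zero false)))
    (fun s' => ∃ l, Base S w s' ∧ s'.mem .lo ≤ w.length ∧ I (s'.mem .lo) l s' ∧
      ∀ l', S.Cut w (s'.mem .lo) l' → S.Cut w 0 (l ++ l'))
    (fun s' => w.length - s'.mem .lo) (fun s' h => by obtain ⟨l, h, -⟩ := h; exact h.flag) (by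
      rintro s' ⟨l, hs', e2, e3, e4⟩ e5
      rw [hs'.len] at e5
      obtain ⟨s₁, a1, a2, a3, a4, a5, a6, a7⟩ := exec_find (S := S) (s := s') hs' hsep h1 hB hone e2
      have hlt : s'.mem .lo < s₁.mem .hi := by
        refine lt_of_le_of_ne a3 fun e => ?_
        obtain ⟨T, hT⟩ := hletter (w[s'.mem .lo])
        refine a7 (s'.mem .lo + 1) (by omega) e5 T ?_
        rw [slice_succ w le_rfl e5, slice_self, List.nil_append, hT]
        simp [Scheme.prod]
      have hs₁ : Base S w s₁ := a2.base ⟨by simpa using hs'.zero, by simpa using hs'.one,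
        by simpa using hs'.len, by simpa using hs'.top, hs'.flag, hs'.pos⟩
      have hI₁ : I (s'.mem .lo) l s₁ := hI _ _ _ _ e3
        (by rw [a2.mem .plus trivial]; simp) (by rw [a2.mem .minus trivial]; simp) a2.r a2.out
      obtain ⟨s₂, b1, b2, b3, b4⟩ := hact (s'.mem .lo) (s₁.mem .hi) l (pick s₁.flag.ok) s₁ hs₁ hlt
        a4 hI₁
      have c1 := Exec.add (w := w) (B := B) (s := s₂) (v := .lo) (a := .hi) (b := .zero)
        (c := false) (by rw [b2.zero, b3]; simp; omega)
      simp only [b2.zero, b3, Bool.toNat_false, add_zero] at c1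
      refine ⟨_, .seq a1 (.seq (.branch b1) c1), ⟨l ++ [pick s₁.flag.ok], ⟨by simpa using b2.zero,
        by simpa using b2.one, by simpa using b2.len, by simpa using b2.top, b2.flag, b2.pos⟩,
        by simpa using a4, ?_, ?_⟩, ?_⟩
      · simp only [Function.update_self]
        exact hI _ _ _ _ b4 (by simp) (by simp) rfl rfl
      · intro l' hl'
        rw [List.append_assoc]
        refine e4 _ (.cons hlt a4 ?_ ?_ a7 (by simpa using hl'))
        · exact (a5 _).1 (Classical.epsilon_spec (p := fun T => s₁.flag.ok T = true) a6)
        · congr 1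
          funext t
          rw [Bool.eq_iff_iff, a5, decide_eq_true_iff]
      · simp; omega)
    ⟨[], ⟨by simpa using hs.zero, by simpa using hs.one, by simpa using hs.len,
      by simpa using hs.top, hs.flag, hs.pos⟩, by simp,
      by simpa using hI _ _ _ { s with mem := Function.update s.mem .lo 0 } h0
          (by simp) (by simp) rfl rfl, by simp⟩
  have e : s'.mem .lo = w.length := by
    have := e2.len
    omega
  rw [e] at e4 e5
  exact ⟨s', l, .seq (exec_clear _) e1, e2, by simpa using e5 [] .nil, e4⟩

namespace Scheme

variable (S)

/-- The words emitted for a list of targets, starting with the angle `r`. -/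
def words : ZMod E → List T → List Y
  | _, [] => []
  | r, t :: l => S.word r t ++ words (r - S.rot t) l

theorem words_append_singleton (r : ZMod E) (l : List T) (t : T) :
    S.words r (l ++ [t]) = S.words r l ++ S.word (r - (l.map S.rot).sum) t := by
  induction l generalizing r with
  | nil => simp [words]
  | cons a l ih => simp [words, ih, sub_sub]

/-- Read the input once, in order to initialize the constants and the weight. -/
def init : Prog X Y T Ω E :=
  .seq (inc .one) (.seq (rep S.bound (inc .top)) (.seq (move .right)
    (.loop (fun x _ => match x with | .letter _ => true | _ => false)
      (.seq (inc .len) (.seq (rep S.bound (inc .top)) (.seq (.branch fun x _ => match x with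
        | .letter x => rep (S.letterWt x).natAbs (inc (if 0 ≤ S.letterWt x then .plus else .minus))
        | _ => skip) (move .right)))))))

/-- Subtract the weight of a target from the total weight, and add its angle to the total angle. -/
def account (t : T) : Prog X Y T Ω E :=
  .seq (rep (S.targetWt t) (inc .minus)) (setFlag fun f => { f with r := f.r + S.rot t })

/-- Emit the total weight in unary. -/
def signs : Prog X Y T Ω E :=
  .seq (whileLt .minus .plus (.seq (emit fun _ => [S.up]) (rep S.unit (inc .minus))))
    (whileLt .plus .minus (.seq (emit fun _ => [S.down]) (rep S.unit (inc .plus))))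

/-- Emit the word of a target. -/
def write (t : T) : Prog X Y T Ω E :=
  .seq (emit fun f => S.word f.r t) (setFlag fun f => { f with r := f.r - S.rot t })

/-- The main program. -/
noncomputable def main [Nonempty T] : Prog X Y T Ω E :=
  .seq S.init (.seq (S.segments S.account) (.seq S.signs (S.segments S.write)))

end Scheme

theorem exec_init (W : ℕ) (hW : ∀ x, (S.letterWt x).natAbs ≤ W)
    (hB : (S.bound + W + 1) * (w.length + 1) ≤ B) :
    ∃ s : St Y T Ω E, Exec w B S.init ⟨⟨false, fun _ => false, 0⟩, fun _ => 0, 0, []⟩ s ∧ Base S w s ∧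
      (s.mem .plus : ℤ) - s.mem .minus = (w.map S.letterWt).sum ∧
      s.mem .plus ≤ W * w.length ∧ s.mem .minus ≤ W * w.length ∧ s.flag.r = 0 ∧ s.out = [] := by
  have hB' : S.bound * (w.length + 1) + W * w.length + W + w.length + 1 ≤ B := by
    nlinarith
  -- The loop, from a state in which `i` letters have been read.
  have key : ∀ n i, i + n = w.length → ∀ s : St Y T Ω E,
      s.mem .zero = 0 → s.mem .one = 1 → s.mem .len = i → s.mem .top = S.bound * (i + 1) →
      s.flag.b = false → s.pos = i + 1 →
      (s.mem .plus : ℤ) - s.mem .minus = ((w.take i).map S.letterWt).sum →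
      s.mem .plus ≤ W * i → s.mem .minus ≤ W * i → s.flag.r = 0 → s.out = [] →
      ∃ s' : St Y T Ω E, Exec w B (.loop (fun x _ => match x with
          | .letter _ => true
          | _ => false)
        (.seq (inc .len) (.seq (rep S.bound (inc .top)) (.seq (.branch fun x _ => match x with
          | .letter x =>
            rep (S.letterWt x).natAbs (inc (if 0 ≤ S.letterWt x then .plus else .minus))
          | _ => skip) (move .right))))) s s' ∧ Base S w s' ∧
        (s'.mem .plus : ℤ) - s'.mem .minus = (w.map S.letterWt).sum ∧
        s'.mem .plus ≤ W * w.length ∧ s'.mem .minus ≤ W * w.length ∧ s'.flag.r = 0 ∧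
        s'.out = [] := by
    intro n
    induction n with
    | zero =>
      intro i hi s h0 h1 h2 h3 h4 h5 h6 h7 h8 h9 h10
      obtain rfl : i = w.length := by omega
      refine ⟨s, .loop_false ?_, ⟨h0, h1, h2, h3, h4, h5.le⟩, by simpa using h6, h7, h8, h9, h10⟩
      simp [h5, inputAt]
    | succ n ih =>
      intro i hi s h0 h1 h2 h3 h4 h5 h6 h7 h8 h9 h10
      have hi' : i < w.length := by omega
      have hin := inputAt_succ w hi'
      have hWi : W * i ≤ W * w.length := Nat.mul_le_mul_left _ hi'.le
      have hbi : S.bound * (i + 1) + S.bound ≤ S.bound * (w.length + 1) := by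
        have := Nat.mul_le_mul_left S.bound (show i + 1 + 1 ≤ w.length + 1 by omega)
        linarith
      have hx := hW w[i]
      have a1 := exec_inc (X := X) (w := w) (B := B) (s := s) (v := .len) h0 (by omega)
      have a2 := exec_rep_inc (X := X) (w := w) (B := B)
        (s := { s with mem := Function.update s.mem .len (s.mem .len + 1) }) (v := .top) (by simp)
        S.bound (by simpa using h0) (by simp; omega)
      have a3 := exec_rep_inc (X := X) (w := w) (B := B)
        (s := { s with
          mem := Function.update (Function.update s.mem .len (s.mem .len + 1)) .top
            (s.mem .top + S.bound) })
        (v := if 0 ≤ S.letterWt w[i] then .plus else .minus) (by split_ifs <;> simp)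
        (S.letterWt w[i]).natAbs (by simpa using h0) (by split_ifs <;> simp <;> omega)
      have a4 := exec_move (w := w) (B := B) (s := { s with
        mem := Function.update (Function.update (Function.update s.mem .len (s.mem .len + 1)) .top
          (s.mem .top + S.bound)) (if 0 ≤ S.letterWt w[i] then .plus else .minus)
          ((Function.update (Function.update s.mem .len (s.mem .len + 1)) .top
          (s.mem .top + S.bound)) (if 0 ≤ S.letterWt w[i] then .plus else .minus) +
          (S.letterWt w[i]).natAbs) }) .right
      have hsum : ((w.take (i + 1)).map S.letterWt).sum =
          ((w.take i).map S.letterWt).sum + S.letterWt w[i] := by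
        rw [List.take_add_one]
        simp [hi']
      obtain ⟨s', b1, b2⟩ := ih (i + 1) (by omega) { s with
        pos := min (Move.right.apply s.pos) (w.length + 1)
        mem := Function.update (Function.update (Function.update s.mem .len (s.mem .len + 1)) .top
          (s.mem .top + S.bound)) (if 0 ≤ S.letterWt w[i] then .plus else .minus)
          ((Function.update (Function.update s.mem .len (s.mem .len + 1)) .top
          (s.mem .top + S.bound)) (if 0 ≤ S.letterWt w[i] then .plus else .minus) +
          (S.letterWt w[i]).natAbs) } (by split_ifs <;> simp [h0])
        (by split_ifs <;> simp [h1]) (by split_ifs <;> simp [h2])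
        (by split_ifs <;> simp [h3] <;> ring) h4 (by simp [h5, Move.apply]; omega)
        (by
          rw [hsum, ← h6]
          split_ifs with hz
          · simp [abs_of_nonneg hz]; ring
          · simp [abs_of_neg (not_le.1 hz)]; ring)
        (by split_ifs <;> simp <;> nlinarith) (by split_ifs <;> simp <;> nlinarith) h9 h10
      refine ⟨s', .loop_true (by rw [h5, hin]) (.seq a1 (.seq (by simpa using a2)
        (.seq (.branch ?_) a4))) b1, b2⟩
      rw [show inputAt w _ = .letter w[i] by simp only; rw [h5, hin]]
      exact a3
  have a1 := exec_inc (X := X) (w := w) (B := B) (v := .one)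
    (s := (⟨⟨false, fun _ => false, 0⟩, fun _ => 0, 0, []⟩ : St Y T Ω E)) rfl (by simp; omega)
  have a2 := exec_rep_inc (X := X) (w := w) (B := B) (v := .top)
    (s := (⟨⟨false, fun _ => false, 0⟩, Function.update (fun _ => 0) .one 1, 0, []⟩ : St Y T Ω E))
    (by simp) S.bound (by simp) (by simp; nlinarith)
  have a3 := exec_move (w := w) (B := B) (s := (⟨⟨false, fun _ => false, 0⟩,
    Function.update (Function.update (fun _ => 0) .one 1) .top S.bound, 0, []⟩ : St Y T Ω E)) .right
  obtain ⟨s, b1, b2⟩ := key w.length 0 (by simp) ⟨⟨false, fun _ => false, 0⟩,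
    Function.update (Function.update (fun _ => 0) .one 1) .top S.bound,
    min (Move.right.apply 0) (w.length + 1), []⟩ (by simp) (by simp) (by simp) (by simp) rfl
    (by simp [Move.apply]) (by simp) (by simp) (by simp) rfl rfl
  exact ⟨s, .seq a1 (.seq (by simpa using a2) (.seq a3 b1)), b2⟩

theorem exec_signs (hs : Base S w s) (hu : 0 < S.unit) (p : ℤ)
    (hp : (s.mem .plus : ℤ) - s.mem .minus = p * S.unit) (h1 : s.mem .plus ≤ B)
    (h2 : s.mem .minus ≤ B) :
    ∃ s', Exec w B S.signs s s' ∧ Base S w s' ∧ s'.flag.r = s.flag.r ∧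
      s'.out = s.out ++ List.replicate p.natAbs (if 0 ≤ p then S.up else S.down) := by
  obtain ⟨s₁, a1, ⟨n, a2, a3, a4, a5, a6, a7⟩, a8⟩ := exec_whileLt (w := w) (B := B) (s := s)
    (a := .minus) (b := .plus) (p := .seq (emit fun _ => [S.up]) (rep S.unit (inc .minus)))
    (fun s' => ∃ n : ℕ, Base S w s' ∧ s'.flag.r = s.flag.r ∧
      s'.out = s.out ++ List.replicate n S.up ∧ s'.mem .plus = s.mem .plus ∧
      s'.mem .minus = s.mem .minus + n * S.unit ∧ n ≤ p.toNat)
    (fun s' => s.mem .plus - s'.mem .minus) (fun s' h => by obtain ⟨l, h, -⟩ := h; exact h.flag) (by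
      rintro s' ⟨n, a2, a3, a4, a5, a6, a7⟩ a8
      have hn : (n + 1 : ℤ) ≤ p := by
        rw [a5, a6] at a8
        by_contra hlt
        have : p * (S.unit : ℤ) ≤ n * S.unit := by gcongr; omega
        zify at a8
        linarith
      have hn' : s.mem .minus + n * S.unit + S.unit ≤ s.mem .plus := by
        have : (n + 1) * (S.unit : ℤ) ≤ p * S.unit := by gcongr
        zify
        linarith
      have b1 := exec_emit (B := B) (s := s') a2.pos fun _ => [S.up]
      have b2 := exec_rep_inc (X := X) (w := w) (B := B) (v := .minus)
        (s := { s' with out := s'.out ++ [S.up] }) (by simp) S.unit a2.zero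
        (by simp only [a6]; omega)
      refine ⟨_, .seq b1 b2, ⟨n + 1, ⟨by simpa using a2.zero, by simpa using a2.one,
        by simpa using a2.len, by simpa using a2.top, a2.flag, a2.pos⟩, a3, ?_, by simpa using a5,
        ?_, by omega⟩, ?_⟩
      · simp [a4, List.replicate_succ']
      · simp [a6]; ring
      · simp only [Function.update_self, a6]; omega)
    ⟨0, hs, rfl, by simp, rfl, by simp, by simp⟩
  obtain ⟨s₂, b1, ⟨m, b2, b3, b4, b5, b6, b7⟩, b8⟩ := exec_whileLt (w := w) (B := B) (s := s₁)
    (a := .plus) (b := .minus) (p := .seq (emit fun _ => [S.down]) (rep S.unit (inc .plus)))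
    (fun s' => ∃ n : ℕ, Base S w s' ∧ s'.flag.r = s₁.flag.r ∧
      s'.out = s₁.out ++ List.replicate n S.down ∧ s'.mem .minus = s₁.mem .minus ∧
      s'.mem .plus = s₁.mem .plus + n * S.unit ∧ n ≤ (-p).toNat)
    (fun s' => s₁.mem .minus - s'.mem .plus) (fun s' h => by obtain ⟨l, h, -⟩ := h; exact h.flag) (by
      rintro s' ⟨m, b2, b3, b4, b5, b6, b7⟩ b8
      have hp' : p < 0 := by
        rw [b5, b6, a5, a6] at b8
        by_contra hlt
        have : (n : ℤ) * (S.unit : ℤ) ≤ p * S.unit := by gcongr; omega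
        zify at b8
        nlinarith
      have hn0 : n = 0 := by omega
      subst hn0
      have hn : (m + 1 : ℤ) ≤ -p := by
        rw [b5, b6, a5, a6] at b8
        by_contra hlt
        have : (-p) * (S.unit : ℤ) ≤ m * S.unit := by gcongr; omega
        zify at b8
        linarith
      have hn' : s₁.mem .plus + m * S.unit + S.unit ≤ s₁.mem .minus := by
        have : (m + 1) * (S.unit : ℤ) ≤ (-p) * S.unit := by gcongr
        rw [a5, a6]
        zify
        linarith
      have hm' : s₁.mem .minus ≤ B := by rw [a6]; omega
      have c1 := exec_emit (B := B) (s := s') b2.pos fun _ => [S.down]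
      have c2 := exec_rep_inc (X := X) (w := w) (B := B) (v := .plus)
        (s := { s' with out := s'.out ++ [S.down] }) (by simp) S.unit b2.zero
        (by simp only [b6]; omega)
      refine ⟨_, .seq c1 c2, ⟨m + 1, ⟨by simpa using b2.zero, by simpa using b2.one,
        by simpa using b2.len, by simpa using b2.top, b2.flag, b2.pos⟩, b3, ?_, by simpa using b5,
        ?_, by omega⟩, ?_⟩
      · simp [b4, List.replicate_succ']
      · simp [b6]; ring
      · simp only [Function.update_self, b6]; omega)
    ⟨0, a2, rfl, by simp, rfl, by simp, by simp⟩
  refine ⟨s₂, .seq a1 b1, b2, by rw [b3, a3], ?_⟩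
  rw [b4, a4]
  rcases le_or_gt 0 p with h0 | h0
  · have hm : m = 0 := by omega
    have hn : n = p.natAbs := by
      have : p ≤ n := by
        rw [a5, a6] at a8
        zify at a8
        have : p * (S.unit : ℤ) ≤ n * S.unit := by linarith
        exact le_of_mul_le_mul_right this (by exact_mod_cast hu)
      omega
    simp [hm, hn, h0]
  · have hn : n = 0 := by omega
    have hm : m = p.natAbs := by
      have : -p ≤ m := by
        rw [b5, b6, a5, a6, hn] at b8
        zify at b8
        have : (-p) * (S.unit : ℤ) ≤ m * S.unit := by linarith
        exact le_of_mul_le_mul_right this (by exact_mod_cast hu)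
      omega
    simp [hm, hn, h0.not_ge]

/-- The function computed by the main program is logspace computable. -/
theorem isLogspaceComputable_of_scheme [Finite X] [Finite Y] [Nonempty T] [NeZero E]
    (S : Scheme X Y T Ω E) (h1 : 1 ≤ S.bound) (hu : 0 < S.unit) (hone : ∃ T, S.target T = 1)
    (hletter : ∀ x, ∃ T, S.target T = S.letter x) (hsep : ∀ w, S.Separates w)
    (f : List X → List Y)
    (hf : ∀ w l, S.Cut w 0 l → ∃ p : ℤ,
      p * S.unit = (w.map S.letterWt).sum - ((l.map S.targetWt).sum : ℕ) ∧
      f w = List.replicate p.natAbs (if 0 ≤ p then S.up else S.down) ++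
        S.words (l.map S.rot).sum l) :
    IsLogspaceComputable f := by
  obtain ⟨W₁, hW₁⟩ := (Set.finite_range fun x => (S.letterWt x).natAbs).bddAbove
  obtain ⟨W₂, hW₂⟩ := (Set.finite_range S.targetWt).bddAbove
  have hW₁' : ∀ x, (S.letterWt x).natAbs ≤ W₁ := fun x => hW₁ ⟨x, rfl⟩
  have hW₂' : ∀ t, S.targetWt t ≤ W₂ := fun t => hW₂ ⟨t, rfl⟩
  refine isLogspaceComputable_of_exec S.main ⟨false, fun _ => false, 0⟩ f
    (2 * S.bound + W₁ + W₂ + 1) fun w => ?_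
  set B := (2 * S.bound + W₁ + W₂ + 1) * (w.length + 1) with hB
  have hB' : B = 2 * (S.bound * (w.length + 1)) + W₁ * w.length + W₁ + W₂ * w.length + W₂ +
    w.length + 1 := by rw [hB]; ring
  obtain ⟨s₁, a1, a2, a3, a4, a5, a6, a7⟩ := exec_init (S := S) (w := w) (B := B) W₁ hW₁'
    (by rw [hB]; exact Nat.mul_le_mul_right _ (by omega))
  obtain ⟨s₂, l, b1, b2, b3, b4, b5, b6, b7, b8⟩ := exec_segments (B := B) a2 (hsep w) h1
    (by omega) hone hletter S.account
    (fun i l s => s.mem .plus = s₁.mem .plus ∧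
      s.mem .minus = s₁.mem .minus + (l.map S.targetWt).sum ∧ (l.map S.targetWt).sum ≤ W₂ * i ∧
      s.flag.r = (l.map S.rot).sum ∧ s.out = [])
    (by
      rintro i l s s' ⟨h1, h2, h3, h4, h5⟩ e1 e2 e3 e4
      rw [e1, e2, e3, e4]
      exact ⟨h1, h2, h3, h4, h5⟩) (by
      rintro i k l t s hs hik hk ⟨h1, h2, h3, h4, h5⟩
      have hk' : W₂ * (i + 1) ≤ W₂ * k := Nat.mul_le_mul_left _ hik
      have hk'' : W₂ * k ≤ W₂ * w.length := Nat.mul_le_mul_left _ hk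
      have ht := hW₂' t
      have c1 := exec_rep_inc (X := X) (w := w) (B := B) (v := .minus) (s := s) (by simp)
        (S.targetWt t) hs.zero (by rw [h2]; rw [mul_add] at hk'; omega)
      refine ⟨_, .seq c1 (exec_setFlag _), ⟨by simpa using hs.zero, by simpa using hs.one,
        by simpa using hs.len, by simpa using hs.top, hs.flag, hs.pos⟩, by simp, by simpa using h1,
        ?_, ?_, ?_, h5⟩
      · simp [h2, add_assoc]
      · rw [mul_add] at hk'; simp; omega
      · simp [h4]) ⟨rfl, by simp, by simp, by simpa using a6, a7⟩
  obtain ⟨p, hp, hfw⟩ := hf w l b3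
  obtain ⟨s₃, c1, c2, c3, c4⟩ := exec_signs (B := B) b2 hu p
    (by rw [hp, b4, b5, ← a3]; push_cast; ring) (by omega) (by omega)
  obtain ⟨s₄, l', d1, d2, d3, d4, d5⟩ := exec_segments (B := B) c2 (hsep w) h1
    (by omega) hone hletter S.write
    (fun i l' s => s.out = s₃.out ++ S.words (l.map S.rot).sum l' ∧
      s.flag.r = (l.map S.rot).sum - (l'.map S.rot).sum)
    (by
      rintro i l s s' ⟨h1, h2⟩ e1 e2 e3 e4
      rw [e3, e4]
      exact ⟨h1, h2⟩) (by
      rintro i k l' t s hs hik hk ⟨h1, h2⟩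
      refine ⟨_, .seq (exec_emit hs.pos _) (exec_setFlag _), ⟨hs.zero, hs.one, hs.len, hs.top,
        hs.flag, hs.pos⟩, rfl, ?_, ?_⟩
      · simp only [h1, h2, S.words_append_singleton, List.append_assoc]
      · simp [h2, sub_sub]) ⟨by simp [Scheme.words], by simpa [b7] using c3⟩
  refine ⟨s₄, .seq a1 (.seq b1 (.seq c1 d1)), ?_⟩
  rw [d4, c4, b8, hfw, d3.unique b3, List.nil_append]

end Logspace

/-! ### Small moduli tell integers apart -/

namespace Logspace

theorem two_pow_le_centralBinom (n : ℕ) : 2 ^ n ≤ n.centralBinom := by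
  induction n with
  | zero => simp
  | succ n ih =>
    have h := Nat.succ_mul_centralBinom_succ n
    have h' : (n + 1) * 2 ^ (n + 1) ≤ (n + 1) * (n + 1).centralBinom := by
      rw [h, pow_succ]
      nlinarith
    exact Nat.le_of_mul_le_mul_left h' (by omega)

/-- A nonzero integer of `m` bits is not divisible by all integers up to `2 m`: the least common
multiple of these is a multiple of the central binomial coefficient. -/
theorem exists_not_dvd {x : ℤ} (hx : x ≠ 0) {m : ℕ} (h : x.natAbs < 2 ^ m) :
    ∃ j : ℕ, 2 ≤ j ∧ j ≤ 2 * m ∧ ¬ (j : ℤ) ∣ x := by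
  by_contra! hdvd
  have hc : m.centralBinom ∣ x.natAbs := by
    rw [Nat.dvd_iff_prime_pow_dvd_dvd]
    intro p k hp hk
    rcases Nat.eq_zero_or_pos k with rfl | hk0
    · simp
    have h1 : p ^ k ≤ 2 * m := by
      have h2 : k ≤ m.centralBinom.factorization p :=
        (hp.pow_dvd_iff_le_factorization (Nat.centralBinom_ne_zero m)).1 hk
      have h3 : p ^ m.centralBinom.factorization p ≤ 2 * m := by
        refine Nat.pow_factorization_choose_le ?_
        rcases Nat.eq_zero_or_pos m with rfl | hm
        · simp at h2; omega
        · omega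
      exact (Nat.pow_le_pow_right hp.pos h2).trans h3
    have h2 : 2 ≤ p ^ k := hp.two_le.trans (Nat.le_self_pow hk0.ne' p)
    exact Int.natCast_dvd.1 (hdvd _ h2 h1)
  have := Nat.le_of_dvd (Int.natAbs_pos.2 hx) hc
  have := two_pow_le_centralBinom m
  omega

theorem dvd_sub_of_res_eq {j : ℕ} (hj : 0 < j) {x y : ℤ} (h : res j x = res j y) :
    (j : ℤ) ∣ x - y := by
  refine Int.dvd_of_emod_eq_zero (Int.emod_eq_emod_iff_emod_sub_eq_zero.1 ?_)
  rw [← cast_res hj, ← cast_res hj, h]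

variable {X Y T Ω : Type*} {E : ℕ} [Fintype T] [Fintype Ω] [DecidableEq T] [DecidableEq Ω]

theorem Scheme.natAbs_prod_le (S : Scheme X Y T Ω E) {C : ℕ}
    (h : ∀ x ω, ∑ k, (S.letter x ω k).natAbs ≤ C) (l : List X) (ω b : Ω) :
    (S.prod l ω b).natAbs ≤ C ^ l.length := by
  induction l using List.reverseRecOn generalizing ω b with
  | nil =>
    simp only [Scheme.prod, List.foldl_nil, Matrix.one_apply, List.length_nil, pow_zero]
    split_ifs <;> simp
  | append_singleton l x ih =>
    rw [S.prod_append_singleton, Matrix.mul_apply, List.length_append, List.length_singleton,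
      pow_succ']
    calc (∑ k, S.letter x ω k * S.prod l k b).natAbs
        ≤ ∑ k, (S.letter x ω k * S.prod l k b).natAbs := Int.natAbs_sum_le _ _
      _ ≤ ∑ k, (S.letter x ω k).natAbs * C ^ l.length := by
          refine Finset.sum_le_sum fun k _ => ?_
          rw [Int.natAbs_mul]
          exact Nat.mul_le_mul_left _ (ih k b)
      _ ≤ C * C ^ l.length := by
          rw [← Finset.sum_mul]
          exact Nat.mul_le_mul_right _ (h x ω)

/-- Linearly many moduli suffice to compare matrix products with the targets. -/
theorem Scheme.exists_bound [Finite X] (S : Scheme X Y T Ω E) :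
    ∃ c, 1 ≤ c ∧ ∀ w, Separates { S with bound := c } w := by
  obtain ⟨a, ha⟩ := (Set.finite_range fun p : X × Ω =>
    ∑ k, (S.letter p.1 p.2 k).natAbs).bddAbove
  obtain ⟨b, hb⟩ := (Set.finite_range fun p : T × Ω × Ω =>
    (S.target p.1 p.2.1 p.2.2).natAbs).bddAbove
  set s := a + b with hs
  have hs2 : s < 2 ^ s := Nat.lt_two_pow_self
  have ha' : ∀ x ω, ∑ k, (S.letter x ω k).natAbs ≤ 2 ^ s := fun x ω => by
    have := ha ⟨(x, ω), rfl⟩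
    simp only at this
    omega
  have hb' : ∀ t ω b, (S.target t ω b).natAbs ≤ 2 ^ s := fun t ω b' => by
    have := hb ⟨(t, ω, b'), rfl⟩
    simp only at this
    omega
  refine ⟨2 * (s + 2), by omega, fun w i k t h => ?_⟩
  by_contra hne
  obtain ⟨ω, b', hωb⟩ : ∃ ω b', S.prod (slice w i k) ω b' ≠ S.target t ω b' := by
    by_contra! h
    exact hne (Matrix.ext h)
  have h1 := S.natAbs_prod_le ha' (slice w i k) ω b'
  have h2 : (2 ^ s) ^ (slice w i k).length ≤ (2 ^ s) ^ w.length :=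
    Nat.pow_le_pow_right (by positivity) (length_slice_le w i k)
  have h3 : (S.target t ω b' - S.prod (slice w i k) ω b').natAbs < 2 ^ ((s + 2) * (w.length + 1)) := by
    have h4 : (2 ^ s) ^ w.length ≤ 2 ^ (s * (w.length + 1)) := by
      rw [← pow_mul]
      exact Nat.pow_le_pow_right (by norm_num) (by nlinarith)
    have h5 : 2 ^ s ≤ 2 ^ (s * (w.length + 1)) :=
      Nat.pow_le_pow_right (by norm_num) (by nlinarith)
    have h6 : 2 ^ (s * (w.length + 1) + 2) ≤ 2 ^ ((s + 2) * (w.length + 1)) :=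
      Nat.pow_le_pow_right (by norm_num) (by nlinarith)
    have h7 := hb' t ω b'
    have h8 := Nat.one_le_two_pow (n := s * (w.length + 1))
    rw [pow_add] at h6
    have h9 := Int.natAbs_sub_le (S.target t ω b') (S.prod (slice w i k) ω b')
    omega
  obtain ⟨j, hj, hj', hd⟩ := exists_not_dvd (sub_ne_zero.2 hωb.symm) h3
  exact hd (dvd_sub_of_res_eq (by omega) (h j hj (by simpa [mul_assoc] using hj') ω b'))

end Logspace

/-! ### Simple elements of a spindle -/

namespace Garside

/-- The properties of Garside systems of spindle type that are used below, in terms of elements of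
the group: `M` is the monoid, `S` the set of simple elements and `δ` the Garside element; the
relation `a⁻¹ * b ∈ M` says that `a` is a left divisor of `b`. -/
structure IsSpindle {G : Type*} [Group G] (M : Submonoid G) (S : Set G) (δ : G) : Prop where
  closure_eq : Submonoid.closure S = M
  finite : S.Finite
  mem_iff_left : ∀ s, s ∈ S ↔ s ∈ M ∧ s⁻¹ * δ ∈ M
  mem_iff_right : ∀ s, s ∈ S ↔ s ∈ M ∧ δ * s⁻¹ ∈ M
  eq_one : ∀ a ∈ M, a⁻¹ ∈ M → a = 1
  ne_one : δ ≠ 1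
  delta_mem_monoid : δ ∈ M
  lcm : ∀ a ∈ M, ∀ b ∈ M, ∃ m ∈ M, a⁻¹ * m ∈ M ∧ b⁻¹ * m ∈ M ∧
    ∀ c ∈ M, a⁻¹ * c ∈ M → b⁻¹ * c ∈ M → m⁻¹ * c ∈ M
  left_gcd : ∀ a ∈ S, ∀ b ∈ S, ∀ c ∈ M, c ≠ 1 → c⁻¹ * a ∈ M → c⁻¹ * b ∈ M →
    a⁻¹ * b ∈ M ∨ b⁻¹ * a ∈ M
  right_gcd : ∀ a ∈ S, ∀ b ∈ S, ∀ c ∈ M, c ≠ 1 → a * c⁻¹ ∈ M → b * c⁻¹ ∈ M →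
    b * a⁻¹ ∈ M ∨ a * b⁻¹ ∈ M

theorem IsGarsideSystem.isSpindle {G : Type*} [Group G] [Nontrivial G] {S : Set G}
    {Δ : Submonoid.closure S} (hG : IsGarsideSystem S Δ) (hS : IsSpindleType S) :
    IsSpindle (Submonoid.closure S) S (Δ : G) := by
  have hleft : ∀ s, s ∈ S ↔ s ∈ Submonoid.closure S ∧ s⁻¹ * (Δ : G) ∈ Submonoid.closure S := by
    intro s
    constructor
    · intro h
      rw [hG.eq_div] at h
      obtain ⟨s', rfl, c, hc⟩ := h
      refine ⟨s'.2, ?_⟩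
      rw [hc]
      simp
    · rintro ⟨h1, h2⟩
      rw [hG.eq_div]
      exact ⟨⟨s, h1⟩, rfl, ⟨_, h2⟩, Subtype.ext (by simp)⟩
  have hone : ∀ a ∈ Submonoid.closure S, a⁻¹ ∈ Submonoid.closure S → a = 1 := by
    intro a ha ha'
    by_contra hne
    obtain ⟨n, hn⟩ := hG.isLcmMonoid.noetherian 1
    have key : ∀ k : ℕ, (List.replicate k [(⟨a, ha⟩ : Submonoid.closure S), ⟨a⁻¹, ha'⟩]).flatten.prod
        = 1 := by
      intro k
      induction k with
      | zero => rfl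
      | succ k ih =>
        rw [List.replicate_succ, List.flatten_cons, List.prod_append, ih]
        exact Subtype.ext (by simp)
    have := hn (List.replicate (n + 1) [(⟨a, ha⟩ : Submonoid.closure S), ⟨a⁻¹, ha'⟩]).flatten (by
      intro x hx
      simp only [List.mem_flatten, List.mem_replicate] at hx
      obtain ⟨l, ⟨-, rfl⟩, hx⟩ := hx
      simp only [List.mem_cons, List.not_mem_nil, or_false] at hx
      rcases hx with rfl | rfl <;> simpa [← Subtype.coe_inj] using hne) (key _)
    simp at this
    omega
  refine ⟨rfl, hG.finite, hleft, ?_, hone, ?_, Δ.2, ?_, ?_, ?_⟩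
  · intro s
    rw [hleft]
    refine and_congr_right fun hs => ?_
    have := hG.balanced ⟨s, hs⟩
    constructor
    · intro h
      obtain ⟨c, hc⟩ := this.1 ⟨⟨_, h⟩, Subtype.ext (by simp)⟩
      have hc' : (Δ : G) = c * s := congrArg Subtype.val hc
      rw [hc', mul_inv_cancel_right]
      exact c.2
    · intro h
      obtain ⟨c, hc⟩ := this.2 ⟨⟨_, h⟩, Subtype.ext (by simp)⟩
      have hc' : (Δ : G) = s * c := congrArg Subtype.val hc
      rw [hc', inv_mul_cancel_left]
      exact c.2
  · intro hΔ
    -- If `Δ` were trivial, then so would be `S`, which generates `G`.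
    have hS1 : S ⊆ {1} := by
      intro s hs
      obtain ⟨h1, h2⟩ := (hleft s).1 hs
      rw [hΔ, mul_one] at h2
      exact hone s h1 h2
    have := hG.generates
    rw [eq_top_iff] at this
    obtain ⟨x, hx⟩ := exists_ne (1 : G)
    have hx' := (Subgroup.closure_mono hS1) (this (Subgroup.mem_top x))
    exact hx (Subgroup.closure_singleton_one.le hx')
  · intro a ha b hb
    obtain ⟨m, ⟨c, hc⟩, ⟨d, hd⟩, hm⟩ := hG.isLcmMonoid.right_lcm ⟨a, ha⟩ ⟨b, hb⟩
    refine ⟨m, m.2, ?_, ?_, ?_⟩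
    · rw [hc]; simp
    · rw [hd]; simp
    · intro x hx h1 h2
      obtain ⟨y, hy⟩ := hm ⟨x, hx⟩ ⟨⟨_, h1⟩, Subtype.ext (by simp)⟩ ⟨⟨_, h2⟩, Subtype.ext (by simp)⟩
      have : x = m * y := congrArg Subtype.val hy
      rw [this]
      simp
  · intro a ha b hb c hc hc1 h1 h2
    obtain ⟨d, ⟨⟨x, hx⟩, ⟨y, hy⟩, hd⟩, h⟩ :=
      (hS ⟨a, ((hleft a).1 ha).1⟩ ⟨b, ((hleft b).1 hb).1⟩ ha hb).1
    rcases h with rfl | rfl | rfl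
    · left
      have : b = a * y := congrArg Subtype.val hy
      rw [this]; simp
    · right
      have : a = b * x := congrArg Subtype.val hx
      rw [this]; simp
    · obtain ⟨z, hz⟩ := hd ⟨c, hc⟩ ⟨⟨_, h1⟩, Subtype.ext (by simp)⟩ ⟨⟨_, h2⟩, Subtype.ext (by simp)⟩
      have : 1 = c * z := congrArg Subtype.val hz
      refine absurd (hone c hc ?_) hc1
      rw [← eq_inv_of_mul_eq_one_right this.symm]
      exact z.2
  · intro a ha b hb c hc hc1 h1 h2
    obtain ⟨d, ⟨⟨x, hx⟩, ⟨y, hy⟩, hd⟩, h⟩ :=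
      (hS ⟨a, ((hleft a).1 ha).1⟩ ⟨b, ((hleft b).1 hb).1⟩ ha hb).2
    rcases h with rfl | rfl | rfl
    · left
      have : b = y * a := congrArg Subtype.val hy
      rw [this]; simp
    · right
      have : a = x * b := congrArg Subtype.val hx
      rw [this]; simp
    · obtain ⟨z, hz⟩ := hd ⟨c, hc⟩ ⟨⟨_, h1⟩, Subtype.ext (by simp)⟩ ⟨⟨_, h2⟩, Subtype.ext (by simp)⟩
      have : 1 = (z : G) * c := congrArg Subtype.val hz
      refine absurd (hone c hc ?_) hc1
      rw [← eq_inv_of_mul_eq_one_left this.symm]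
      exact z.2

theorem mem_of_isMonoidAtom {G : Type*} [Group G] {S : Set G} {x : Submonoid.closure S}
    (hx : IsMonoidAtom x) : (x : G) ∈ S := by
  obtain ⟨l, hl, hp⟩ := Submonoid.exists_list_of_mem_closure x.2
  induction l with
  | nil => exact absurd (Subtype.ext hp.symm) hx.1
  | cons a l ih =>
    have ha : a ∈ Submonoid.closure S := Submonoid.subset_closure (hl a (by simp))
    have hl' : l.prod ∈ Submonoid.closure S :=
      Submonoid.list_prod_mem _ fun y hy => Submonoid.subset_closure (hl y (by simp [hy]))
    rcases hx.2 ⟨a, ha⟩ ⟨l.prod, hl'⟩ (Subtype.ext (by simpa using hp.symm)) with h | h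
    · have : a = 1 := congrArg Subtype.val h
      exact ih (fun y hy => hl y (by simp [hy])) (by simpa [this] using hp)
    · have : l.prod = 1 := congrArg Subtype.val h
      rw [List.prod_cons, this, mul_one] at hp
      rw [← hp]
      exact hl a (by simp)

namespace IsSpindle

variable {G : Type*} [Group G] {M : Submonoid G} {S : Set G} {δ : G}

/-- One of the elements `a` and `b` is a left divisor of the other. -/
def Comp (M : Submonoid G) (a b : G) : Prop := a⁻¹ * b ∈ M ∨ b⁻¹ * a ∈ M

theorem Comp.symm {a b : G} (h : Comp M a b) : Comp M b a := Or.symm h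

/-- `s` is a simple element other than `1` and `δ`. -/
def Proper (S : Set G) (δ s : G) : Prop := s ∈ S ∧ s ≠ 1 ∧ s ≠ δ

variable (h : IsSpindle M S δ)
include h

theorem mem {s : G} (hs : s ∈ S) : s ∈ M := ((h.mem_iff_left s).1 hs).1

theorem inv_mul_mem {s : G} (hs : s ∈ S) : s⁻¹ * δ ∈ M := ((h.mem_iff_left s).1 hs).2

theorem mul_inv_mem {s : G} (hs : s ∈ S) : δ * s⁻¹ ∈ M := ((h.mem_iff_right s).1 hs).2

theorem one_mem : (1 : G) ∈ S :=
  (h.mem_iff_left 1).2 ⟨M.one_mem, by simpa using h.delta_mem_monoid⟩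

theorem delta_mem : δ ∈ S := (h.mem_iff_left δ).2 ⟨h.delta_mem_monoid, by simp⟩

theorem compl_mem {s : G} (hs : s ∈ S) : s⁻¹ * δ ∈ S :=
  (h.mem_iff_right _).2 ⟨h.inv_mul_mem hs, by simpa using h.mem hs⟩

theorem compl_mem' {s : G} (hs : s ∈ S) : δ * s⁻¹ ∈ S :=
  (h.mem_iff_left _).2 ⟨h.mul_inv_mem hs, by simpa using h.mem hs⟩

theorem left_mem {s t : G} (hs : s ∈ M) (ht : t ∈ M) (hst : s * t ∈ S) : s ∈ S :=
  (h.mem_iff_left _).2 ⟨hs, by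
    simpa [mul_assoc] using M.mul_mem ht (h.inv_mul_mem hst)⟩

theorem right_mem {s t : G} (hs : s ∈ M) (ht : t ∈ M) (hst : s * t ∈ S) : t ∈ S :=
  (h.mem_iff_right _).2 ⟨ht, by
    simpa [mul_assoc] using M.mul_mem (h.mul_inv_mem hst) hs⟩

/-- Conjugation by `δ` permutes the simple elements, since it is the square of the complement
`s ↦ s⁻¹ * δ`. -/
theorem conj_mem {s : G} (hs : s ∈ S) (k : ℤ) : δ ^ (-k) * s * δ ^ k ∈ S := by
  induction k with
  | zero => simpa using hs
  | succ k ih =>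
    have := h.compl_mem (h.compl_mem ih)
    convert this using 1
    rw [mul_inv_rev, inv_inv, neg_add, zpow_add, zpow_add, zpow_neg_one, zpow_one,
      (Commute.zpow_self δ (-(k : ℤ))).inv_right.eq]
    simp only [mul_assoc]
  | pred k ih =>
    have := h.compl_mem' (h.compl_mem' ih)
    convert this using 1
    rw [mul_inv_rev, inv_inv, neg_sub, zpow_sub, zpow_sub, zpow_one]
    simp only [zpow_neg, inv_inv, zpow_one, ← mul_assoc, ← zpow_one_add, add_comm, zpow_add]

theorem conj_mem_monoid {a : G} (ha : a ∈ M) (k : ℤ) : δ ^ (-k) * a * δ ^ k ∈ M := by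
  rw [← h.closure_eq] at ha
  induction ha using Submonoid.closure_induction with
  | mem x hx => exact h.mem (h.conj_mem hx k)
  | one => simp
  | mul x y _ _ hx hy =>
    have := M.mul_mem hx hy
    simpa [mul_assoc] using this

theorem antisymm {a b : G} (hab : a⁻¹ * b ∈ M) (hba : b⁻¹ * a ∈ M) : a = b := by
  have := h.eq_one _ hab (by simpa using hba)
  exact (inv_mul_eq_one.1 this)

/-- Two left divisors of a simple element other than `δ` are comparable. -/
theorem comp_of_le {a b u : G} (ha : a ∈ M) (hb : b ∈ M) (hu : u ∈ S) (hne : u ≠ δ)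
    (hau : a⁻¹ * u ∈ M) (hbu : b⁻¹ * u ∈ M) : Comp M a b := by
  have ha' : a ∈ S := h.left_mem ha hau (by simpa using hu)
  have hb' : b ∈ S := h.left_mem hb hbu (by simpa using hu)
  have := h.right_gcd _ (h.compl_mem ha') _ (h.compl_mem hb') _ (h.inv_mul_mem hu)
    (fun e => hne (inv_mul_eq_one.1 e)) (by simpa [mul_assoc] using hau)
    (by simpa [mul_assoc] using hbu)
  simp only [mul_inv_rev, inv_inv, mul_assoc, mul_inv_cancel_left] at this
  exact this.symm

/-- Comparability is transitive on proper simple elements. -/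
theorem comp_trans {a b c : G} (ha : Proper S δ a) (hb : Proper S δ b) (hc : Proper S δ c)
    (hab : Comp M a b) (hbc : Comp M b c) : Comp M a c := by
  rcases hab with hab | hab <;> rcases hbc with hbc | hbc
  · exact Or.inl (by simpa [mul_assoc] using M.mul_mem hab hbc)
  · exact h.comp_of_le (h.mem ha.1) (h.mem hc.1) hb.1 hb.2.2 hab hbc
  · exact h.left_gcd a ha.1 c hc.1 b (h.mem hb.1) hb.2.1 hab hbc
  · exact Or.inr (by simpa [mul_assoc] using M.mul_mem hbc hab)

theorem proper_compl {s : G} (hs : Proper S δ s) : Proper S δ (s⁻¹ * δ) :=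
  ⟨h.compl_mem hs.1, fun e => hs.2.2 (inv_mul_eq_one.1 e), fun e => hs.2.1 (by simpa using e)⟩

theorem proper_conj {s : G} (hs : Proper S δ s) (k : ℤ) : Proper S δ (δ ^ (-k) * s * δ ^ k) := by
  refine ⟨h.conj_mem hs.1 k, fun e => hs.2.1 ?_, fun e => hs.2.2 ?_⟩
  · have : s = δ ^ k * (δ ^ (-k) * s * δ ^ k) * δ ^ (-k) := by simp [mul_assoc]
    rw [this, e]; simp
  · have : s = δ ^ k * (δ ^ (-k) * s * δ ^ k) * δ ^ (-k) := by simp [mul_assoc]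
    rw [this, e, ← zpow_add_one, ← zpow_add]; simp

theorem comp_conj {a b : G} (hab : Comp M a b) (k : ℤ) :
    Comp M (δ ^ (-k) * a * δ ^ k) (δ ^ (-k) * b * δ ^ k) := by
  refine hab.imp (fun e => ?_) (fun e => ?_) <;>
  · have := h.conj_mem_monoid e k
    simpa [mul_assoc] using this

/-- The factors of a proper simple element are `1` or proper. -/
theorem proper_factors {s t : G} (hs : s ∈ M) (ht : t ∈ M) (hs1 : s ≠ 1) (ht1 : t ≠ 1)
    (hst : s * t ∈ S) : Proper S δ s ∧ Proper S δ t := by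
  refine ⟨⟨h.left_mem hs ht hst, hs1, ?_⟩, ⟨h.right_mem hs ht hst, ht1, ?_⟩⟩
  · rintro rfl
    exact ht1 (h.eq_one t ht (by simpa using h.inv_mul_mem hst))
  · rintro rfl
    exact hs1 (h.eq_one s hs (by simpa using h.mul_inv_mem hst))

end IsSpindle

/-! ### Weights of simple elements -/

namespace IsSpindle

variable {G : Type*} [Group G] {M : Submonoid G} {S : Set G} {δ : G}

/-- The left divisors of `s` other than `1`. -/
def divs (M : Submonoid G) (s : G) : Set G := {u | u ∈ M ∧ u ≠ 1 ∧ u⁻¹ * s ∈ M}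

/-- The length `h(s) + h(s⁻¹ * δ)` of the chain of left divisors of `δ` through `s`, where `h` counts
nontrivial left divisors. -/
noncomputable def chainLen (M : Submonoid G) (δ s : G) : ℕ := (divs M s).ncard + (divs M (s⁻¹ * δ)).ncard

/-- A common multiple of all the numbers `chainLen M δ s`. -/
noncomputable def fullWt (S : Set G) : ℕ := (2 * S.ncard).factorial

/-- The weight of a simple element `s`: the number of its nontrivial left divisors, scaled in such a
way that `δ` gets the same weight `fullWt S` along every chain. -/
noncomputable def wt (M : Submonoid G) (S : Set G) (δ s : G) : ℕ :=
  fullWt S / chainLen M δ s * (divs M s).ncard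

variable (h : IsSpindle M S δ)
include h

theorem divs_subset {s : G} (hs : s ∈ S) : divs M s ⊆ S := fun u hu =>
  h.left_mem hu.1 hu.2.2 (by simpa using hs)

theorem divs_finite {s : G} (hs : s ∈ S) : (divs M s).Finite := h.finite.subset (h.divs_subset hs)

theorem divs_one : divs M (1 : G) = ∅ := by
  ext u
  simp only [divs, mul_one, Set.mem_ofPred_eq, Set.mem_empty_iff_false, iff_false]
  exact fun hu => hu.2.1 (h.eq_one u hu.1 hu.2.2)

theorem ncard_divs_pos {s : G} (hs : s ∈ S) (h1 : s ≠ 1) : 0 < (divs M s).ncard :=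
  (Set.ncard_pos (h.divs_finite hs)).2 ⟨s, h.mem hs, h1, by simp⟩

/-- The left divisors of a proper simple element form a chain, so that they are counted
additively. -/
theorem ncard_divs_mul {s t : G} (hs : s ∈ M) (ht : t ∈ M) (hst : s * t ∈ S) (hne : s * t ≠ δ) :
    (divs M (s * t)).ncard = (divs M s).ncard + (divs M t).ncard := by
  have key : divs M (s * t) = divs M s ∪ (fun v => s * v) '' divs M t := by
    ext u
    constructor
    · rintro ⟨hu, hu1, hle⟩
      rcases h.comp_of_le hu hs hst hne hle (by simpa using ht) with hc | hc
      · exact Or.inl ⟨hu, hu1, hc⟩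
      · by_cases hv : s⁻¹ * u = 1
        · rw [inv_mul_eq_one] at hv
          exact Or.inl ⟨hu, hu1, by simp [hv]⟩
        · exact Or.inr ⟨s⁻¹ * u, ⟨hc, hv, by simpa [mul_assoc] using hle⟩, by simp⟩
    · rintro (⟨hu, hu1, hle⟩ | ⟨v, ⟨hv, hv1, hle⟩, rfl⟩)
      · exact ⟨hu, hu1, by simpa [mul_assoc] using M.mul_mem hle ht⟩
      · refine ⟨M.mul_mem hs hv, fun e => hv1 ?_, by simpa [mul_assoc] using hle⟩
        exact h.eq_one v hv (by rw [← eq_inv_of_mul_eq_one_left e]; exact hs)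
  have hdisj : Disjoint (divs M s) ((fun v => s * v) '' divs M t) := by
    rw [Set.disjoint_left]
    rintro _ ⟨-, -, hle⟩ ⟨v, ⟨hv, hv1, -⟩, rfl⟩
    exact hv1 (h.eq_one v hv (by simpa [mul_assoc] using hle))
  rw [key, Set.ncard_union_eq hdisj (h.divs_finite (h.left_mem hs ht hst))
    ((h.divs_finite (h.right_mem hs ht hst)).image _),
    Set.ncard_image_of_injective _ (mul_right_injective s)]

theorem ncard_divs_conj (s : G) (k : ℤ) :
    (divs M (δ ^ (-k) * s * δ ^ k)).ncard = (divs M s).ncard := by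
  have hsub : ∀ (s : G) (k : ℤ),
      (fun u => δ ^ (-k) * u * δ ^ k) '' divs M s ⊆ divs M (δ ^ (-k) * s * δ ^ k) := by
    rintro s k _ ⟨u, ⟨hu, hu1, hle⟩, rfl⟩
    refine ⟨h.conj_mem_monoid hu k, fun e => hu1 ?_, ?_⟩
    · have : u = δ ^ k * (δ ^ (-k) * u * δ ^ k) * δ ^ (-k) := by simp [mul_assoc]
      rw [this, show δ ^ (-k) * u * δ ^ k = 1 from e]; simp
    · simpa [mul_assoc] using h.conj_mem_monoid hle k
  have key : divs M (δ ^ (-k) * s * δ ^ k) = (fun u => δ ^ (-k) * u * δ ^ k) '' divs M s := by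
    refine Set.Subset.antisymm (fun u hu => ?_) (hsub s k)
    refine ⟨δ ^ k * u * δ ^ (-k), ?_, by simp [mul_assoc]⟩
    have := hsub (δ ^ (-k) * s * δ ^ k) (-k) ⟨u, hu, rfl⟩
    simpa [mul_assoc] using this
  rw [key, Set.ncard_image_of_injective]
  intro a b hab
  simpa using hab

theorem chainLen_pos {s : G} (hs : s ∈ S) : 0 < chainLen M δ s := by
  by_cases h1 : s = 1
  · subst h1
    have := h.ncard_divs_pos h.delta_mem h.ne_one
    simp only [chainLen, inv_one, one_mul]
    omega
  · have := h.ncard_divs_pos hs h1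
    simp only [chainLen]
    omega

theorem chainLen_dvd {s : G} (hs : s ∈ S) : chainLen M δ s ∣ fullWt S := by
  refine Nat.dvd_factorial (h.chainLen_pos hs) ?_
  have h1 := Set.ncard_le_ncard (h.divs_subset hs) h.finite
  have h2 := Set.ncard_le_ncard (h.divs_subset (h.compl_mem hs)) h.finite
  simp only [chainLen]
  omega

theorem wt_pos {s : G} (hs : s ∈ S) (h1 : s ≠ 1) : 0 < wt M S δ s :=
  Nat.mul_pos (Nat.div_pos (Nat.le_of_dvd (Nat.factorial_pos _) (h.chainLen_dvd hs))
    (h.chainLen_pos hs)) (h.ncard_divs_pos hs h1)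

theorem wt_one : wt M S δ 1 = 0 := by simp [wt, h.divs_one]

theorem wt_delta : wt M S δ δ = fullWt S := by
  have : chainLen M δ δ = (divs M δ).ncard := by simp [chainLen, h.divs_one]
  rw [wt, ← this]
  exact Nat.div_mul_cancel (h.chainLen_dvd h.delta_mem)

theorem wt_conj (s : G) (k : ℤ) : wt M S δ (δ ^ (-k) * s * δ ^ k) = wt M S δ s := by
  have : (δ ^ (-k) * s * δ ^ k)⁻¹ * δ = δ ^ (-k) * (s⁻¹ * δ) * δ ^ k := by
    simp only [mul_inv_rev, zpow_neg, inv_inv, mul_assoc]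
    rw [(Commute.zpow_self δ k).eq]
  rw [wt, wt, chainLen, chainLen, this, h.ncard_divs_conj, h.ncard_divs_conj]

theorem wt_mul {s t : G} (hs : s ∈ M) (ht : t ∈ M) (hst : s * t ∈ S) :
    wt M S δ (s * t) = wt M S δ s + wt M S δ t := by
  have hsS := h.left_mem hs ht hst
  have htS := h.right_mem hs ht hst
  by_cases hs1 : s = 1
  · simp [hs1, h.wt_one]
  by_cases ht1 : t = 1
  · simp [ht1, h.wt_one]
  have hconj : ∀ x : G, (divs M (δ⁻¹ * x * δ)).ncard = (divs M x).ncard := fun x => by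
    simpa using h.ncard_divs_conj x 1
  -- All the elements involved lie on the same chain.
  by_cases hne : s * t = δ
  · obtain rfl : t = s⁻¹ * δ := by rw [← hne]; simp
    have e : chainLen M δ (s⁻¹ * δ) = chainLen M δ s := by
      have := hconj s
      simp only [chainLen, mul_inv_rev, inv_inv]
      rw [this, add_comm]
    rw [hne, h.wt_delta, wt, wt, e, ← Nat.mul_add, ← chainLen]
    exact (Nat.div_mul_cancel (h.chainLen_dvd hsS)).symm
  · have hD : (s * t)⁻¹ * δ ∈ M := h.inv_mul_mem hst
    have e0 := h.ncard_divs_mul hs ht hst hne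
    have e1 : s⁻¹ * δ = t * ((s * t)⁻¹ * δ) := by simp [mul_assoc]
    have e2 : t⁻¹ * δ = ((s * t)⁻¹ * δ) * (δ⁻¹ * s * δ) := by simp [mul_assoc]
    have n1 := h.ncard_divs_mul ht hD (by rw [← e1]; exact h.compl_mem hsS)
      (by rw [← e1]; exact (h.proper_compl (h.proper_factors hs ht hs1 ht1 hst).1).2.2)
    have n2 := h.ncard_divs_mul hD
      (by simpa using h.conj_mem_monoid hs 1) (by rw [← e2]; exact h.compl_mem htS)
      (by rw [← e2]; exact (h.proper_compl (h.proper_factors hs ht hs1 ht1 hst).2).2.2)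
    rw [← e1] at n1
    rw [← e2, hconj] at n2
    have c1 : chainLen M δ s = chainLen M δ (s * t) := by
      rw [chainLen, chainLen, n1, e0]; ring
    have c2 : chainLen M δ t = chainLen M δ (s * t) := by
      rw [chainLen, chainLen, n2, e0]; ring
    rw [wt, wt, wt, c1, c2, e0, Nat.mul_add]

theorem wt_lt {s : G} (hs : Proper S δ s) : wt M S δ s < fullWt S := by
  have := h.wt_mul (h.mem hs.1) (h.inv_mul_mem hs.1) (by simpa using h.delta_mem)
  rw [mul_inv_cancel_left, h.wt_delta] at this
  have := h.wt_pos (h.proper_compl hs).1 (h.proper_compl hs).2.1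
  omega

end IsSpindle

end Garside

/-! ### Multiplication of normal forms by simple elements -/

namespace Garside

namespace IsSpindle

variable {G H : Type*} [Group G] [Group H] {M : Submonoid G} {S : Set G} {δ : G}

open Classical in
/-- Multiplication of a normal word by a simple element `u` on the right. The word is kept as a
stack, with its last letter on top; the result consists of a stack and of an exponent of `δ` that
has been split off on the right. -/
noncomputable def push (M : Submonoid G) (S : Set G) (δ : G) (L : List G) (u : G) : List G × ℤ :=
  if u = 1 then (L, 0)
  else if u = δ then (L, 1)
  else match L with
    | [] => ([u], 0)
    | s :: R =>
      if Comp M (s⁻¹ * δ) u then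
        if s * u = δ then (R, 1)
        else if s * u ∈ S then (s * u :: R, 0)
        else (s * u * δ⁻¹ :: R, 1)
      else (u :: s :: R, 0)

/-- The stack consists of proper simple elements, and the product of two neighbouring letters,
the one on top being the right one, cannot be simplified. -/
def Valid (M : Submonoid G) (S : Set G) (δ : G) (L : List G) : Prop :=
  (∀ s ∈ L, Proper S δ s) ∧ L.IsChain fun u s => ¬ Comp M (s⁻¹ * δ) u

/-- The product of the values of the letters of a stack, read from the bottom to the top. -/
def evalStack (m : G → H) : List G → H
  | [] => 1
  | s :: R => evalStack m R * m s

/-- Multiplication of the element `L * δ ^ p` by `t * δ ^ n`, for a stack `L`. -/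
noncomputable def step (M : Submonoid G) (S : Set G) (δ : G) (st : List G × ℤ) (l : G × ℤ) :
    List G × ℤ :=
  ((push M S δ st.1 (δ ^ st.2 * l.1 * δ ^ (-st.2))).1,
    st.2 + (push M S δ st.1 (δ ^ st.2 * l.1 * δ ^ (-st.2))).2 + l.2)

/-- The state reached after the multiplication by a sequence of factors `t * δ ^ n`. -/
noncomputable def run (M : Submonoid G) (S : Set G) (δ : G) (st : List G × ℤ) (w : List (G × ℤ)) :
    List G × ℤ :=
  w.foldl (step M S δ) st

theorem run_cons (st : List G × ℤ) (l : G × ℤ) (w : List (G × ℤ)) :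
    run M S δ st (l :: w) = run M S δ (step M S δ st l) w := rfl

theorem run_append (st : List G × ℤ) (v w : List (G × ℤ)) :
    run M S δ st (v ++ w) = run M S δ (run M S δ st v) w := List.foldl_append

omit [Group G] in
theorem evalStack_eq (m : G → H) (L : List G) : evalStack m L = (L.reverse.map m).prod := by
  induction L with
  | nil => rfl
  | cons s R ih => simp [evalStack, ih]

/-- A multiplicative map on the simple elements. -/
def IsGermHom (M : Submonoid G) (S : Set G) (m : G → H) : Prop :=
  ∀ s ∈ M, ∀ t ∈ M, s * t ∈ S → m (s * t) = m s * m t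

variable (h : IsSpindle M S δ)
include h

theorem conj_mem' {s : G} (hs : s ∈ S) (k : ℤ) : δ ^ k * s * δ ^ (-k) ∈ S := by
  simpa using h.conj_mem hs (-k)

theorem proper_conj' {s : G} (hs : Proper S δ s) (k : ℤ) : Proper S δ (δ ^ k * s * δ ^ (-k)) := by
  simpa using h.proper_conj hs (-k)

theorem germ_one {m : G → H} (hm : IsGermHom M S m) : m 1 = 1 := by
  have := hm 1 M.one_mem 1 M.one_mem (by simpa using h.one_mem)
  simpa using this

theorem germ_compl {m : G → H} (hm : IsGermHom M S m) {s : G} (hs : s ∈ S) :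
    m s * m (s⁻¹ * δ) = m δ := by
  have := hm s (h.mem hs) _ (h.inv_mul_mem hs) (by simpa using h.delta_mem)
  rw [← this, mul_inv_cancel_left]

theorem germ_conj {m : G → H} (hm : IsGermHom M S m) {s : G} (hs : s ∈ S) :
    m (δ * s * δ⁻¹) = m δ * m s * (m δ)⁻¹ := by
  have h1 := h.germ_compl hm (s := δ * s * δ⁻¹) (by simpa using h.conj_mem' hs 1)
  have h2 := h.germ_compl hm (h.compl_mem' hs)
  have e1 : (δ * s * δ⁻¹)⁻¹ * δ = δ * s⁻¹ := by group
  have e2 : (δ * s⁻¹)⁻¹ * δ = s := by group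
  rw [e1] at h1
  rw [e2] at h2
  rw [eq_mul_inv_iff_mul_eq, ← h2, ← mul_assoc, h1, h2]

theorem germ_conj_zpow {m : G → H} (hm : IsGermHom M S m) {s : G} (hs : s ∈ S) (k : ℤ) :
    m (δ ^ k * s * δ ^ (-k)) = m δ ^ k * m s * m δ ^ (-k) := by
  induction k with
  | zero => simp
  | succ k ih =>
    have := h.germ_conj hm (h.conj_mem' hs k)
    rw [ih] at this
    have e : δ ^ ((k : ℤ) + 1) * s * δ ^ (-((k : ℤ) + 1)) =
        δ * (δ ^ (k : ℤ) * s * δ ^ (-(k : ℤ))) * δ⁻¹ := by group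
    rw [e, this]
    group
  | pred k ih =>
    have := h.germ_conj hm (h.conj_mem' hs (-(k : ℤ) - 1))
    have e : δ * (δ ^ (-(k : ℤ) - 1) * s * δ ^ (-(-(k : ℤ) - 1))) * δ⁻¹ =
        δ ^ (-(k : ℤ)) * s * δ ^ (-(-(k : ℤ))) := by group
    rw [e, ih] at this
    have e2 : m (δ ^ (-(k : ℤ) - 1) * s * δ ^ (-(-(k : ℤ) - 1))) = (m δ)⁻¹ *
        (m δ * m (δ ^ (-(k : ℤ) - 1) * s * δ ^ (-(-(k : ℤ) - 1))) * (m δ)⁻¹) * m δ := by group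
    rw [e2, ← this]
    group

/-- If the product of two proper simple elements is comparable with `δ` but not simple, then it is
the product of `δ` and of a proper simple element. -/
theorem exists_overflow {s u : G} (hs : Proper S δ s) (hu : Proper S δ u)
    (hc : Comp M (s⁻¹ * δ) u) (hne : s * u ≠ δ) (hS : s * u ∉ S) :
    ∃ v, Proper S δ v ∧ s * u = δ * v ∧ u = s⁻¹ * δ * v := by
  rcases hc with hc | hc
  · have hv : (s⁻¹ * δ)⁻¹ * u ≠ 1 := fun e => hne (by
      rw [inv_mul_eq_one] at e
      rw [← e, mul_inv_cancel_left])
    have := h.proper_factors (h.inv_mul_mem hs.1) hc (h.proper_compl hs).2.1 hv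
      (by rw [mul_inv_cancel_left]; exact hu.1)
    exact ⟨_, this.2, by group, (mul_inv_cancel_left _ _).symm⟩
  · refine absurd ((h.mem_iff_left _).2 ⟨M.mul_mem (h.mem hs.1) (h.mem hu.1), ?_⟩) hS
    simpa [mul_assoc] using hc

theorem evalStack_push {m : G → H} (hm : IsGermHom M S m) {L : List G}
    (hL : ∀ s ∈ L, Proper S δ s) {u : G} (hu : u ∈ S) :
    evalStack m (push M S δ L u).1 * m δ ^ (push M S δ L u).2 = evalStack m L * m u := by
  unfold push
  split_ifs with h1 h2
  · simp [h1, h.germ_one hm]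
  · simp [h2]
  · cases L with
    | nil => simp [evalStack]
    | cons s R =>
      have hs := hL s (by simp)
      simp only
      split_ifs with h3 h4 h5
      · obtain rfl : u = s⁻¹ * δ := by rw [← h4]; simp
        simp [evalStack, mul_assoc, h.germ_compl hm hs.1]
      · simp [evalStack, mul_assoc, hm s (h.mem hs.1) u (h.mem hu) h5]
      · obtain ⟨v, hv, hv1, rfl⟩ := h.exists_overflow hs ⟨hu, h1, h2⟩ h3 h4 h5
        have e := hm _ (h.inv_mul_mem hs.1) v (h.mem hv.1) hu
        rw [hv1, e]
        simp only [evalStack, zpow_one]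
        rw [h.germ_conj hm hv.1, mul_assoc, inv_mul_cancel_right, mul_assoc, ← mul_assoc (m s),
          h.germ_compl hm hs.1]
      · simp [evalStack]

theorem valid_cons_of_comp {s s' : G} {R : List G} (hs' : Proper S δ s') (hss : Comp M s s')
    (hL : Valid M S δ (s :: R)) : Valid M S δ (s' :: R) := by
  refine ⟨?_, ?_⟩
  · intro x hx
    rcases List.mem_cons.1 hx with rfl | hx
    · exact hs'
    · exact hL.1 x (by simp [hx])
  · have := hL.2
    cases R with
    | nil => simp
    | cons r R =>
      rw [List.isChain_cons_cons] at this ⊢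
      refine ⟨fun hc => this.1 ?_, this.2⟩
      exact h.comp_trans (h.proper_compl (hL.1 r (by simp))) hs' (hL.1 s (by simp)) hc hss.symm

theorem valid_push {L : List G} (hL : Valid M S δ L) {u : G} (hu : u ∈ S) :
    Valid M S δ (push M S δ L u).1 := by
  unfold push
  split_ifs with h1 h2
  · exact hL
  · exact hL
  · cases L with
    | nil =>
      refine ⟨?_, by simp⟩
      intro s hs
      simp only [List.mem_singleton] at hs
      exact hs ▸ ⟨hu, h1, h2⟩
    | cons s R =>
      have hs := hL.1 s (by simp)
      simp only
      split_ifs with h3 h4 h5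
      · exact ⟨fun x hx => hL.1 x (by simp [hx]), hL.2.tail⟩
      · refine h.valid_cons_of_comp ⟨h5, fun e => h1 ?_, h4⟩ (Or.inl ?_) hL
        · exact h.eq_one u (h.mem hu) (by
            rw [← eq_inv_of_mul_eq_one_left e]; exact h.mem hs.1)
        · simpa using h.mem hu
      · obtain ⟨v, hv, hv1, hv2⟩ := h.exists_overflow hs ⟨hu, h1, h2⟩ h3 h4 h5
        refine h.valid_cons_of_comp ?_ (Or.inr ?_) hL
        · rw [hv1]
          simpa using h.proper_conj' hv 1
        · simpa [mul_assoc] using h.mul_inv_mem hu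
      · refine ⟨?_, List.isChain_cons_cons.2 ⟨h3, hL.2⟩⟩
        intro x hx
        rcases List.mem_cons.1 hx with rfl | hx
        · exact ⟨hu, h1, h2⟩
        · exact hL.1 x hx

omit h in
/-- As long as the height of the stack is at least two, its bottom is not involved. -/
theorem push_append {L : List G} {s u : G} (hlen : 2 ≤ (push M S δ (L ++ [s]) u).1.length) :
    push M S δ (L ++ [s]) u = ((push M S δ L u).1 ++ [s], (push M S δ L u).2) := by
  unfold push at hlen ⊢
  split_ifs at hlen ⊢ with h1 h2
  · rfl
  · rfl
  · cases L with
    | nil =>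
      simp only [List.nil_append] at hlen ⊢
      split_ifs at hlen ⊢ with h3 h4 h5
      · simp at hlen
      · simp at hlen
      · simp at hlen
      · rfl
    | cons r R =>
      simp only [List.cons_append] at hlen ⊢
      split_ifs <;> simp

theorem valid_step {st : List G × ℤ} (hst : Valid M S δ st.1) {l : G × ℤ} (hl : l.1 ∈ S) :
    Valid M S δ (step M S δ st l).1 := h.valid_push hst (h.conj_mem' hl _)

theorem valid_run {w : List (G × ℤ)} (hw : ∀ l ∈ w, l.1 ∈ S) {st : List G × ℤ}
    (hst : Valid M S δ st.1) : Valid M S δ (run M S δ st w).1 := by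
  induction w generalizing st with
  | nil => exact hst
  | cons l w ih =>
    exact ih (fun x hx => hw x (by simp [hx])) (h.valid_step hst (hw l (by simp)))

theorem evalStack_step {m : G → H} (hm : IsGermHom M S m) {st : List G × ℤ}
    (hst : Valid M S δ st.1) {l : G × ℤ} (hl : l.1 ∈ S) :
    evalStack m (step M S δ st l).1 * m δ ^ (step M S δ st l).2 =
      evalStack m st.1 * m δ ^ st.2 * (m l.1 * m δ ^ l.2) := by
  have := h.evalStack_push hm hst.1 (h.conj_mem' hl st.2)
  rw [h.germ_conj_zpow hm hl] at this
  simp only [step]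
  rw [add_comm st.2, zpow_add, zpow_add, ← mul_assoc, ← mul_assoc, this]
  group

/-- A multiplicative map on the simple elements does not see the simplification of words. -/
theorem evalStack_run {m : G → H} (hm : IsGermHom M S m) {w : List (G × ℤ)}
    (hw : ∀ l ∈ w, l.1 ∈ S) {st : List G × ℤ} (hst : Valid M S δ st.1) :
    evalStack m (run M S δ st w).1 * m δ ^ (run M S δ st w).2 =
      evalStack m st.1 * m δ ^ st.2 * (w.map fun l => m l.1 * m δ ^ l.2).prod := by
  induction w generalizing st with
  | nil => simp [run]
  | cons l w ih =>
    rw [run_cons, ih (fun x hx => hw x (by simp [hx])) (h.valid_step hst (hw l (by simp))),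
      h.evalStack_step hm hst (hw l (by simp))]
    simp [mul_assoc]

omit h in
theorem step_append {L : List G} {p : ℤ} {s : G} {l : G × ℤ}
    (hlen : 2 ≤ (step M S δ (L ++ [s], p) l).1.length) :
    step M S δ (L ++ [s], p) l = ((step M S δ (L, p) l).1 ++ [s], (step M S δ (L, p) l).2) := by
  simp only [step] at hlen ⊢
  rw [push_append hlen]

omit h in
/-- As long as the height of the stack is at least two, its bottom is not involved. -/
theorem run_append_stack {L : List G} {p : ℤ} {s : G} {w : List (G × ℤ)}
    (hlen : ∀ k, k < w.length → 2 ≤ (run M S δ (L ++ [s], p) (w.take (k + 1))).1.length) :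
    run M S δ (L ++ [s], p) w = ((run M S δ (L, p) w).1 ++ [s], (run M S δ (L, p) w).2) := by
  induction w generalizing L p with
  | nil => rfl
  | cons l w ih =>
    have h0 := step_append (l := l) (by simpa [run] using hlen 0 (by simp))
    rw [run_cons, run_cons, h0]
    refine ih fun k hk => ?_
    have := hlen (k + 1) (by simpa using hk)
    rwa [List.take_succ_cons, run_cons, h0] at this

end IsSpindle

end Garside

/-! ### Permutation matrices and transvections -/

namespace Garside

section Operators

variable {Ω : Type*}

variable (Ω) in
/-- The automorphisms of the free abelian group with basis `Ω`. -/
abbrev Op : Type _ := (Ω → ℤ) ≃ₗ[ℤ] (Ω → ℤ)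

/-- The automorphism that permutes the basis vectors. -/
def permOp : Equiv.Perm Ω →* Op Ω where
  toFun σ := LinearEquiv.funCongrLeft ℤ ℤ σ⁻¹
  map_one' := rfl
  map_mul' _ _ := rfl

theorem permOp_apply (σ : Equiv.Perm Ω) (f : Ω → ℤ) (x : Ω) : permOp σ f x = f (σ⁻¹ x) := rfl

variable [Fintype Ω] [DecidableEq Ω]

/-- The transvection that adds `t` times the sum of all the other coordinates to the coordinate
`o`. -/
def addOp (o : Ω) (t : ℤ) : Op Ω where
  toFun f := f + Pi.single o (t * (∑ x, f x - f o))
  map_add' f g := by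
    ext x
    by_cases hx : x = o
    · subst hx
      simp [Finset.sum_add_distrib]
      ring
    · simp [hx]
  map_smul' c f := by
    ext x
    by_cases hx : x = o
    · subst hx
      simp [← Finset.mul_sum]
      ring
    · simp [hx]
  invFun f := f - Pi.single o (t * (∑ x, f x - f o))
  left_inv f := by
    ext x
    by_cases hx : x = o
    · subst hx
      simp [Finset.sum_add_distrib]
    · simp [hx]
  right_inv f := by
    ext x
    by_cases hx : x = o
    · subst hx
      simp [Finset.sum_sub_distrib]
    · simp [hx]

theorem addOp_apply (o : Ω) (t : ℤ) (f : Ω → ℤ) :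
    addOp o t f = f + Pi.single o (t * (∑ x, f x - f o)) := rfl

theorem addOp_apply_self (o : Ω) (t : ℤ) (f : Ω → ℤ) :
    addOp o t f o = f o + t * (∑ x, f x - f o) := by simp [addOp_apply]

theorem addOp_apply_of_ne {o x : Ω} (hx : x ≠ o) (t : ℤ) (f : Ω → ℤ) :
    addOp o t f x = f x := by simp [addOp_apply, hx]

theorem permOp_mul_addOp (σ : Equiv.Perm Ω) (o : Ω) (t : ℤ) :
    permOp σ * addOp o t = addOp (σ o) t * permOp σ := by
  refine LinearEquiv.ext fun f => funext fun x => ?_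
  rw [LinearEquiv.mul_apply, LinearEquiv.mul_apply, permOp_apply]
  by_cases hx : x = σ o
  · subst hx
    have : ∑ x, permOp σ f x = ∑ x, f x := Equiv.sum_comp σ⁻¹ f
    rw [addOp_apply_self, this, permOp_apply]
    simp [addOp_apply_self]
  · rw [addOp_apply_of_ne hx, permOp_apply, addOp_apply_of_ne]
    rintro rfl
    exact hx (by simp)

theorem addOp_neg (o : Ω) (t : ℤ) : addOp o (-t) = (addOp o t)⁻¹ := by
  refine eq_inv_of_mul_eq_one_left (LinearEquiv.ext fun f => funext fun x => ?_)
  rw [LinearEquiv.mul_apply]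
  by_cases hx : x = o
  · subst hx
    rw [addOp_apply_self, addOp_apply_self]
    have : ∑ y, addOp x t f y = ∑ y, f y + t * (∑ y, f y - f x) := by
      simp [addOp_apply, Finset.sum_add_distrib]
    rw [this]
    simp
  · rw [addOp_apply_of_ne hx, addOp_apply_of_ne hx]
    rfl

omit [DecidableEq Ω] in
/-- The coordinate `x` of `f` is at least twice as large as all the other ones together. -/
def Dominant (x : Ω) (f : Ω → ℤ) : Prop := 2 * ∑ y, |f y| ≤ 3 * |f x|

omit [DecidableEq Ω] in
theorem Dominant.permOp {x : Ω} {f : Ω → ℤ} (hf : Dominant x f) (σ : Equiv.Perm Ω) :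
    Dominant (σ x) (permOp σ f) := by
  have : ∑ x, |Garside.permOp σ f x| = ∑ x, |f x| := Equiv.sum_comp σ⁻¹ fun x => |f x|
  rw [Dominant, this, permOp_apply]
  simpa [Dominant] using hf

/-- A transvection in a coordinate other than the dominant one makes that coordinate dominant. The
sum of the coordinates other than `o` is at least half of `f x` in absolute value, so that a
multiple of it by `7` is large enough compared to all the old coordinates. -/
theorem Dominant.addOp {x o : Ω} {f : Ω → ℤ} (hf : Dominant x f) (hx : x ≠ o) {t : ℤ}
    (ht : |t| = 7) : Dominant o (addOp o t f) ∧ 3 * |f x| ≤ |addOp o t f o| := by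
  have hmem : o ∈ Finset.univ.erase x := by simp [hx.symm]
  have e1 : ∑ y, f y = f x + (f o + ∑ y ∈ (Finset.univ.erase x).erase o, f y) := by
    rw [Finset.add_sum_erase _ f hmem, Finset.add_sum_erase _ f (Finset.mem_univ x)]
  have e2 : ∑ y, |f y| = |f x| + (|f o| + ∑ y ∈ (Finset.univ.erase x).erase o, |f y|) := by
    rw [Finset.add_sum_erase _ (fun y => |f y|) hmem,
      Finset.add_sum_erase _ (fun y => |f y|) (Finset.mem_univ x)]
  have e3 : ∑ y, |Garside.addOp o t f y| =
      |f x| + (|Garside.addOp o t f o| + ∑ y ∈ (Finset.univ.erase x).erase o, |f y|) := by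
    rw [← Finset.add_sum_erase _ _ (Finset.mem_univ x), addOp_apply_of_ne hx,
      ← Finset.add_sum_erase _ _ hmem]
    congr 2
    exact Finset.sum_congr rfl fun y hy => by
      rw [addOp_apply_of_ne (Finset.ne_of_mem_erase hy)]
  have habs := Finset.abs_sum_le_sum_abs f ((Finset.univ.erase x).erase o)
  have hpos : 0 ≤ |f o| := abs_nonneg _
  rw [Dominant, e2] at hf
  rw [Dominant, e3, addOp_apply_self, e1]
  generalize ∑ y ∈ (Finset.univ.erase x).erase o, f y = r at *
  generalize ∑ y ∈ (Finset.univ.erase x).erase o, |f y| = R at *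
  have h1 : |f x| - |r| ≤ |f x + r| := by
    have := abs_sub_abs_le_abs_sub (f x) (-r)
    simpa using this
  have h2 : 7 * |f x + r| - |f o| ≤ |f o + t * (f x + (f o + r) - f o)| := by
    have := abs_sub_abs_le_abs_sub (t * (f x + r)) (-f o)
    rw [abs_mul, ht, abs_neg, sub_neg_eq_add] at this
    rwa [show f o + t * (f x + (f o + r) - f o) = t * (f x + r) + f o by ring]
  have h3 : 0 ≤ |r| := abs_nonneg r
  constructor <;> linarith

end Operators

section Shift

variable {n : ℕ} {A : Type*} [Finite A]

/-- The permutation of `Fin n × A` that increases the first component by one and applies `g` to the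
second one each time the first component returns to zero. -/
noncomputable def shift (hn : 0 < n) (g : Equiv.Perm A) : Equiv.Perm (Fin n × A) :=
  Equiv.ofBijective
    (fun x => if hx : x.1 + 1 < n then (⟨x.1 + 1, hx⟩, x.2) else (⟨0, hn⟩, g x.2)) <| by
    refine Finite.injective_iff_bijective.1 ?_
    rintro ⟨i, a⟩ ⟨j, b⟩ hab
    have hi := i.2
    have hj := j.2
    dsimp only at hab
    split_ifs at hab <;> simp only [Prod.mk.injEq, Fin.mk.injEq, EmbeddingLike.apply_eq_iff_eq]
      at hab
    · exact Prod.ext (Fin.ext (by dsimp only; omega)) hab.2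
    · omega
    · omega
    · exact Prod.ext (Fin.ext (by dsimp only; omega)) hab.2

variable (hn : 0 < n) (g : Equiv.Perm A)

theorem shift_pow_apply {k : ℕ} (hk : k < n) (a : A) :
    (shift hn g ^ k) (⟨0, hn⟩, a) = (⟨k, hk⟩, a) := by
  induction k with
  | zero => rfl
  | succ k ih =>
    rw [pow_succ', Equiv.Perm.mul_apply, ih (by omega)]
    exact dif_pos hk

theorem shift_pow_self_apply (a : A) : (shift hn g ^ n) (⟨0, hn⟩, a) = (⟨0, hn⟩, g a) := by
  obtain ⟨k, rfl⟩ : ∃ k, n = k + 1 := ⟨n - 1, by omega⟩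
  rw [pow_succ', Equiv.Perm.mul_apply, shift_pow_apply hn g (Nat.lt_succ_self k)]
  exact dif_neg (lt_irrefl _)

theorem shift_pow_self_zpow_apply (q : ℤ) (a : A) :
    ((shift hn g ^ n) ^ q) (⟨0, hn⟩, a) = (⟨0, hn⟩, (g ^ q) a) := by
  induction q generalizing a with
  | zero => rfl
  | succ q ih =>
    rw [zpow_add_one, Equiv.Perm.mul_apply, shift_pow_self_apply, ih, zpow_add_one,
      Equiv.Perm.mul_apply]
  | pred q ih =>
    have h1 : (shift hn g ^ n)⁻¹ (⟨0, hn⟩, a) = (⟨0, hn⟩, g⁻¹ a) := by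
      rw [Equiv.Perm.inv_eq_iff_eq, shift_pow_self_apply]
      simp
    rw [zpow_sub_one, Equiv.Perm.mul_apply, h1, ih, zpow_sub_one, Equiv.Perm.mul_apply]

theorem shift_pow_self_zpow_eq_one {q : ℤ} : (shift hn g ^ n) ^ q = 1 ↔ g ^ q = 1 := by
  constructor
  · intro e
    refine Equiv.ext fun a => ?_
    have := shift_pow_self_zpow_apply hn g q a
    rw [e] at this
    exact (congrArg Prod.snd this).symm
  · intro e
    refine Equiv.ext fun ⟨i, a⟩ => ?_
    rw [← shift_pow_apply hn g i.2 a, ← Equiv.Perm.mul_apply]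
    have hc : Commute ((shift hn g ^ n) ^ q) (shift hn g ^ (i : ℕ)) :=
      ((Commute.refl (shift hn g)).pow_pow n i).zpow_left q
    rw [hc.eq, Equiv.Perm.mul_apply, shift_pow_self_zpow_apply, e]
    rfl

end Shift

/-! ### The representation -/

namespace IsSpindle

open scoped Pointwise

variable {G : Type*} [Group G] {M : Submonoid G} {S : Set G} {δ : G}

/-- The proper simple elements that are comparable with `s`. -/
def cls (M : Submonoid G) (S : Set G) (δ s : G) : Set {u // Proper S δ u} := {u | Comp M s u.1}

omit [Group G] in
theorem fullWt_pos (S : Set G) : 0 < fullWt S := Nat.factorial_pos _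

variable (h : IsSpindle M S δ)

/-- The permutation `s ↦ δ⁻¹ * s * δ` of the proper simple elements. -/
def conjPerm : Equiv.Perm {u // Proper S δ u} where
  toFun u := ⟨δ⁻¹ * u.1 * δ, by simpa using h.proper_conj u.2 1⟩
  invFun u := ⟨δ * u.1 * δ⁻¹, by simpa using h.proper_conj' u.2 1⟩
  left_inv u := Subtype.ext (by simp [mul_assoc])
  right_inv u := Subtype.ext (by simp [mul_assoc])

theorem conjPerm_zpow (k : ℤ) (u : {u // Proper S δ u}) :
    ((h.conjPerm ^ k) u : G) = δ ^ (-k) * u.1 * δ ^ k := by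
  induction k generalizing u with
  | zero => simp
  | succ k ih =>
    rw [zpow_add_one, Equiv.Perm.mul_apply, ih]
    simp only [conjPerm, Equiv.coe_fn_mk]
    group
  | pred k ih =>
    rw [zpow_sub_one, Equiv.Perm.mul_apply, ih]
    have : ((h.conjPerm⁻¹ u : {u // Proper S δ u}) : G) = δ * u.1 * δ⁻¹ := rfl
    rw [this]
    group

include h in
theorem finite_proper : Finite {u // Proper S δ u} :=
  Set.Finite.to_subtype (h.finite.subset fun _ hu => hu.1)

theorem cls_conj (s : G) : cls M S δ (δ⁻¹ * s * δ) = h.conjPerm • cls M S δ s := by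
  ext u
  rw [Set.mem_smul_set_iff_inv_smul_mem, Equiv.Perm.smul_def]
  have e : ((h.conjPerm⁻¹ u : {u // Proper S δ u}) : G) = δ * u.1 * δ⁻¹ := rfl
  simp only [cls, Set.mem_ofPred_eq, e]
  constructor
  · intro hc
    have := h.comp_conj hc (-1)
    simpa [mul_assoc] using this
  · intro hc
    have := h.comp_conj hc 1
    simpa [mul_assoc] using this

theorem cls_nonempty {s : G} (hs : Proper S δ s) : cls M S δ s ≠ ∅ :=
  Set.Nonempty.ne_empty ⟨⟨s, hs⟩, Or.inl (by simp)⟩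

include h in
theorem cls_eq_iff {s t : G} (hs : Proper S δ s) (ht : Proper S δ t) :
    cls M S δ s = cls M S δ t ↔ Comp M s t := by
  constructor
  · intro e
    have : (⟨t, ht⟩ : {u // Proper S δ u}) ∈ cls M S δ t := Or.inl (by simp)
    rw [← e] at this
    exact this
  · intro hc
    ext u
    exact ⟨fun hu => h.comp_trans ht hs u.2 hc.symm hu, fun hu => h.comp_trans hs ht u.2 hc hu⟩

/-- The basis of the representation. -/
abbrev Basis (S : Set G) (δ : G) : Type _ := Fin (fullWt S) × Set {u // Proper S δ u}

/-- The basis vector attached to a class of simple elements. -/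
def origin (a : Set {u // Proper S δ u}) : Basis S δ := (⟨0, fullWt_pos S⟩, a)

/-- A permutation of the basis, whose powers act according to the weights of simple elements. -/
noncomputable def rotation : Equiv.Perm (Basis S δ) :=
  haveI := h.finite_proper
  shift (fullWt_pos S) (MulAction.toPermHom _ (Set {u // Proper S δ u}) h.conjPerm⁻¹)

open Classical in
/-- The representation on simple elements: a proper simple element `s` acts as a power of the
rotation that is given by its weight, between two transvections that depend on the classes of `s`
and of its complement only. -/
noncomputable def rep [Fintype (Basis S δ)] (s : G) : Op (Basis S δ) :=
  if s = 1 then 1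
  else if s = δ then permOp (h.rotation ^ fullWt S)
  else addOp (origin (cls M S δ s)) 7 * permOp (h.rotation ^ wt M S δ s) *
    (addOp (origin (cls M S δ (s⁻¹ * δ))) 7)⁻¹

theorem rotation_pow_fullWt_origin (a : Set {u // Proper S δ u}) :
    (h.rotation ^ fullWt S) (origin a) = origin (h.conjPerm⁻¹ • a) := by
  have := h.finite_proper
  exact shift_pow_self_apply _ _ a

theorem rotation_pow_origin {k : ℕ} (hk : k < fullWt S) (a : Set {u // Proper S δ u}) :
    (h.rotation ^ k) (origin a) = (⟨k, hk⟩, a) := by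
  have := h.finite_proper
  exact shift_pow_apply _ _ hk a

theorem rotation_zpow_eq_one {q : ℤ} :
    (h.rotation ^ fullWt S) ^ q = 1 ↔ h.conjPerm ^ q = 1 := by
  have := h.finite_proper
  rw [rotation, shift_pow_self_zpow_eq_one, ← map_zpow, inv_zpow]
  constructor
  · intro e
    refine Equiv.ext fun u => ?_
    have := DFunLike.congr_fun e ((h.conjPerm ^ q) • {u})
    rw [MulAction.toPermHom_apply, MulAction.toPerm_apply, inv_smul_smul] at this
    simpa [Set.smul_set_singleton] using this.symm
  · intro e
    rw [e, inv_one, map_one]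

variable [Fintype (Basis S δ)]

theorem rep_delta : h.rep δ = permOp (h.rotation ^ fullWt S) := by
  simp [rep, h.ne_one]

theorem rep_delta_zpow_eq_one {q : ℤ} : h.rep δ ^ q = 1 ↔ h.conjPerm ^ q = 1 := by
  rw [rep_delta, ← map_zpow, ← h.rotation_zpow_eq_one]
  constructor
  · intro e
    classical
    refine Equiv.ext fun x => ?_
    have := congrArg
      (fun p : Op (Basis S δ) => p (Pi.single x 1) (((h.rotation ^ fullWt S) ^ q) x)) e
    simp only [permOp_apply, Equiv.Perm.inv_def, Equiv.symm_apply_apply, Pi.single_eq_same] at this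
    by_contra hne
    change 1 = (Pi.single x 1 : Basis S δ → ℤ) _ at this
    rw [Pi.single_eq_of_ne (show _ ≠ x from hne)] at this
    omega
  · intro e
    rw [e, map_one]

open Classical in
theorem addOp_mul_rep_delta (a : Set {u // Proper S δ u}) (t : ℤ) :
    addOp (origin a) t * h.rep δ = h.rep δ * addOp (origin (h.conjPerm • a)) t := by
  rw [rep_delta, permOp_mul_addOp, rotation_pow_fullWt_origin, inv_smul_smul]

/-- The classes of simple elements match in such a way that the transvections between neighbouring
factors of a simple element cancel. -/
theorem isGermHom_rep : IsGermHom M S h.rep := by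
  classical
  intro s hs t ht hst
  by_cases hs1 : s = 1
  · simp [hs1, rep]
  by_cases ht1 : t = 1
  · simp [ht1, rep]
  obtain ⟨hsP, htP⟩ := h.proper_factors hs ht hs1 ht1 hst
  have es : h.rep s = addOp (origin (cls M S δ s)) 7 * permOp (h.rotation ^ wt M S δ s) *
    (addOp (origin (cls M S δ (s⁻¹ * δ))) 7)⁻¹ := by simp [rep, hsP.2.1, hsP.2.2]
  have et : h.rep t = addOp (origin (cls M S δ t)) 7 * permOp (h.rotation ^ wt M S δ t) *
    (addOp (origin (cls M S δ (t⁻¹ * δ))) 7)⁻¹ := by simp [rep, htP.2.1, htP.2.2]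
  have hwt := h.wt_mul hs ht hst
  by_cases hne : s * t = δ
  · obtain rfl : t = s⁻¹ * δ := by rw [← hne]; simp
    have e : (s⁻¹ * δ)⁻¹ * δ = δ⁻¹ * s * δ := by group
    rw [hne, es, et, e, h.cls_conj]
    have := h.addOp_mul_rep_delta (cls M S δ s) 7
    rw [hne, h.wt_delta] at hwt
    calc h.rep δ = addOp (origin (cls M S δ s)) 7 * h.rep δ *
          (addOp (origin (h.conjPerm • cls M S δ s)) 7)⁻¹ := by rw [this, mul_inv_cancel_right]
      _ = _ := by
        have hp := congrArg (fun k => permOp (h.rotation ^ k)) hwt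
        simp only [pow_add, map_mul] at hp
        rw [rep_delta, hp]
        group
  · have hst1 : s * t ≠ 1 := fun e => hs1 (h.eq_one s hs (by
      rw [← eq_inv_of_mul_eq_one_right e]; exact ht))
    have hstP : Proper S δ (s * t) := ⟨hst, hst1, hne⟩
    have c1 : cls M S δ (s * t) = cls M S δ s :=
      (h.cls_eq_iff hstP hsP).2 (Or.inr (by simpa using ht))
    have c2 : cls M S δ (s⁻¹ * δ) = cls M S δ t :=
      (h.cls_eq_iff (h.proper_compl hsP) htP).2 (Or.inr (by
        simpa [mul_assoc] using h.inv_mul_mem hst))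
    have c3 : cls M S δ ((s * t)⁻¹ * δ) = cls M S δ (t⁻¹ * δ) :=
      (h.cls_eq_iff (h.proper_compl hstP) (h.proper_compl htP)).2 (Or.inl (by
        simpa [mul_assoc] using h.conj_mem_monoid hs 1))
    have est : h.rep (s * t) = addOp (origin (cls M S δ (s * t))) 7 *
        permOp (h.rotation ^ wt M S δ (s * t)) *
        (addOp (origin (cls M S δ ((s * t)⁻¹ * δ))) 7)⁻¹ := by simp [rep, hst1, hne]
    rw [est, es, et, c1, c2, c3, hwt, pow_add, map_mul]
    group

open Classical in
/-- Along a normal word, each factor hands the dominant coordinate over to the next one, and makes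
its value at least three times as large. -/
theorem exists_dominant {s : G} {R : List G} (hL : Valid M S δ (s :: R)) {x : Basis S δ}
    {f : Basis S δ → ℤ} (hf : Dominant x f) (hx : x ≠ origin (cls M S δ (s⁻¹ * δ))) :
    ∃ y, 3 * |f x| ≤ |evalStack h.rep (s :: R) f y| := by
  have step : ∀ s, Proper S δ s → ∀ x f, Dominant x f → x ≠ origin (cls M S δ (s⁻¹ * δ)) →
      Dominant (origin (cls M S δ s)) (h.rep s f) ∧
        3 * |f x| ≤ |h.rep s f (origin (cls M S δ s))| := by
    intro s hs x f hf hx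
    have es : h.rep s = addOp (origin (cls M S δ s)) 7 * permOp (h.rotation ^ wt M S δ s) *
      addOp (origin (cls M S δ (s⁻¹ * δ))) (-7) := by simp [rep, hs.2.1, hs.2.2, addOp_neg]
    obtain ⟨h1, h2⟩ := hf.addOp hx (t := -7) rfl
    have h3 := h1.permOp (h.rotation ^ wt M S δ s)
    rw [h.rotation_pow_origin (h.wt_lt hs)] at h3
    obtain ⟨h4, h5⟩ := h3.addOp (o := origin (cls M S δ s)) (t := 7) (fun e => by
      have := h.wt_pos hs.1 hs.2.1
      simp [origin] at e
      omega) rfl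
    rw [permOp_apply, ← h.rotation_pow_origin (h.wt_lt hs)] at h5
    simp only [Equiv.Perm.inv_def, Equiv.symm_apply_apply] at h5
    rw [es, LinearEquiv.mul_apply, LinearEquiv.mul_apply]
    refine ⟨h4, ?_⟩
    have := abs_nonneg (f x)
    linarith
  induction R generalizing s x f with
  | nil =>
    refine ⟨origin (cls M S δ s), ?_⟩
    simpa [evalStack] using (step s (hL.1 s (by simp)) x f hf hx).2
  | cons r R ih =>
    obtain ⟨h1, h2⟩ := step s (hL.1 s (by simp)) x f hf hx
    have hc := List.isChain_cons_cons.1 hL.2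
    obtain ⟨y, hy⟩ := ih (s := r) ⟨fun u hu => hL.1 u (List.mem_cons_of_mem _ hu), hc.2⟩ h1
      (fun e => hc.1 ((h.cls_eq_iff (h.proper_compl (hL.1 r (by simp))) (hL.1 s (by simp))).1
        (congrArg Prod.snd e).symm))
    refine ⟨y, ?_⟩
    rw [evalStack, LinearEquiv.mul_apply]
    have := abs_nonneg (f x)
    linarith

/-- A nonempty normal word does not act as a permutation of the basis. -/
theorem evalStack_ne_permOp {L : List G} (hL : Valid M S δ L) (hne : L ≠ [])
    (σ : Equiv.Perm (Basis S δ)) : evalStack h.rep L ≠ permOp σ := by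
  classical
  intro e
  obtain ⟨s, R, rfl⟩ := List.exists_cons_of_ne_nil hne
  have hs := hL.1 s (by simp)
  -- The class of a proper simple element is nonempty.
  obtain ⟨y, hy⟩ := h.exists_dominant hL (x := origin ∅) (f := Pi.single (origin ∅) 1)
    (by simp [Dominant, Pi.single_apply, apply_ite abs])
    (fun e => cls_nonempty (h.proper_compl hs) (congrArg Prod.snd e).symm)
  rw [e, permOp_apply, Pi.single_eq_same, Pi.single_apply] at hy
  split_ifs at hy <;> simp at hy

end IsSpindle

end Garside

/-! ### Recognition of simple elements and normal forms -/

namespace Garside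

namespace IsSpindle

variable {G : Type*} [Group G] {M : Submonoid G} {S : Set G} {δ : G}

theorem valid_nil : Valid M S δ [] := ⟨by simp, by simp⟩

theorem push_eq_nil {L : List G} {u : G} (hu : Proper S δ u) (hL : (push M S δ L u).1 = []) :
    ∃ s, L = [s] ∧ s * u = δ ∧ (push M S δ L u).2 = 1 := by
  unfold push at hL ⊢
  rw [if_neg hu.2.1, if_neg hu.2.2] at hL ⊢
  cases L with
  | nil => simp at hL
  | cons s R =>
    simp only at hL ⊢
    split_ifs at hL ⊢ with h1 h2 h3
    · exact ⟨s, by rw [show R = [] from hL], h2, rfl⟩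

theorem length_push_nil_le (u : G) : (push M S δ [] u).1.length ≤ 1 := by
  unfold push
  split_ifs <;> simp

section Rep

variable (h : IsSpindle M S δ) [Fintype (Basis S δ)]

theorem eq_nil_of_rep {L : List G} (hL : Valid M S δ L) {p r : ℤ}
    (e : evalStack h.rep L * h.rep δ ^ p = h.rep δ ^ r) :
    L = [] ∧ h.conjPerm ^ (p - r) = 1 := by
  have e' : evalStack h.rep L = h.rep δ ^ (r - p) := by
    rw [zpow_sub, ← e, mul_inv_cancel_right]
  have hnil : L = [] := by
    by_contra hne
    rw [h.rep_delta, ← map_zpow] at e'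
    exact h.evalStack_ne_permOp hL hne _ e'
  refine ⟨hnil, h.rep_delta_zpow_eq_one.1 ?_⟩
  rw [hnil, evalStack, one_mul] at e
  rw [zpow_sub, e, mul_inv_cancel]

open Classical in
/-- The representation determines whether the element with a given normal form is the product of a
given simple element and a power of `δ`: multiplication by the complement of that simple element
reduces this to `eq_nil_of_rep`. -/
theorem eq_of_rep {L : List G} (hL : Valid M S δ L) {p r : ℤ} {s : G} (hs : s ∈ S) (hsδ : s ≠ δ)
    (e : evalStack h.rep L * h.rep δ ^ p = h.rep s * h.rep δ ^ r) :
    L = (if s = 1 then [] else [s]) ∧ h.conjPerm ^ (p - r) = 1 := by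
  split_ifs with h1
  · rw [h1, h.germ_one h.isGermHom_rep, one_mul] at e
    exact h.eq_nil_of_rep hL e
  · have hsP : Proper S δ s := ⟨hs, h1, hsδ⟩
    have hD := h.proper_compl hsP
    have hmem : δ ^ (-r) * (s⁻¹ * δ) * δ ^ r ∈ S := h.conj_mem hD.1 r
    have hst := h.evalStack_step h.isGermHom_rep (st := (L, p)) hL
      (l := (δ ^ (-r) * (s⁻¹ * δ) * δ ^ r, -r - 1)) hmem
    have hv := h.valid_step (st := (L, p)) hL
      (l := (δ ^ (-r) * (s⁻¹ * δ) * δ ^ r, -r - 1)) hmem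
    have hc := h.germ_conj_zpow h.isGermHom_rep hD.1 (-r)
    rw [neg_neg] at hc
    simp only [e, hc] at hst
    have hone : h.rep s * h.rep δ ^ r *
        (h.rep δ ^ (-r) * h.rep (s⁻¹ * δ) * h.rep δ ^ r * h.rep δ ^ (-r - 1)) = h.rep δ ^ (0 : ℤ) := by
      have := h.germ_compl h.isGermHom_rep hs
      calc _ = h.rep s * h.rep (s⁻¹ * δ) * (h.rep δ)⁻¹ := by group
        _ = _ := by rw [this, mul_inv_cancel, zpow_zero]
    rw [hone] at hst
    obtain ⟨hnil, hp⟩ := h.eq_nil_of_rep hv hst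
    simp only [step] at hnil hp
    have hu := h.proper_conj' (h.proper_conj hD r) p
    obtain ⟨s', rfl, hs', h2⟩ := push_eq_nil hu hnil
    rw [h2, show p + 1 + (-r - 1) - 0 = p - r by ring] at hp
    refine ⟨?_, hp⟩
    have := h.conjPerm_zpow (p - r) ⟨_, hu⟩
    rw [hp] at this
    have e2 : δ ^ (-(p - r)) * (δ ^ p * (δ ^ (-r) * (s⁻¹ * δ) * δ ^ r) * δ ^ (-p)) * δ ^ (p - r) =
      s⁻¹ * δ := by group
    rw [e2] at this
    have e3 : δ ^ p * (δ ^ (-r) * (s⁻¹ * δ) * δ ^ r) * δ ^ (-p) = s⁻¹ * δ := this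
    rw [e3, ← mul_assoc] at hs'
    rw [mul_inv_eq_one.1 (mul_eq_right.1 hs')]

end Rep

section NormalForm

variable (h : IsSpindle M S δ)
include h

/-- The greedy property of words without simplifiable neighbours. -/
theorem le_head {s : G} {T : List G} (hP : ∀ u ∈ s :: T, Proper S δ u)
    (hT : (s :: T).IsChain fun s u => ¬ Comp M (s⁻¹ * δ) u) {c : G} (hc : c ∈ S)
    (hle : c⁻¹ * (s * T.prod) ∈ M) : c⁻¹ * s ∈ M := by
  induction T generalizing s c with
  | nil => simpa using hle
  | cons t T ih =>
    have hs := hP s (by simp)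
    have hTM : (t :: T).prod ∈ M :=
      M.list_prod_mem fun x hx => h.mem (hP x (List.mem_cons_of_mem _ hx)).1
    obtain ⟨m, hm, h1, h2, h3⟩ := h.lcm s (h.mem hs.1) c (h.mem hc)
    have h4 := h3 _ h.delta_mem_monoid (h.inv_mul_mem hs.1) (h.inv_mul_mem hc)
    have h5 := h3 _ (M.mul_mem (h.mem hs.1) hTM) (by simpa using hTM) hle
    have hmS : m ∈ S := (h.mem_iff_left m).2 ⟨hm, h4⟩
    have hv : s⁻¹ * m ∈ S := h.right_mem (h.mem hs.1) h1 (by simpa using hmS)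
    have hc' := List.isChain_cons_cons.1 hT
    -- The complement `s⁻¹ * m` of `s` in the lcm divides both the next letter and `s⁻¹ * δ`.
    have h6 := ih (fun u hu => hP u (List.mem_cons_of_mem _ hu)) hc'.2 hv
      (by simpa [mul_assoc] using h5)
    by_cases hv1 : s⁻¹ * m = 1
    · rw [inv_mul_eq_one] at hv1
      rwa [← hv1] at h2
    · refine absurd (h.left_gcd _ (h.compl_mem hs.1) t (hP t (by simp)).1 _ h1 hv1 ?_ h6) hc'.1
      simpa [mul_assoc] using h4

theorem isInf {A : List G} (hP : ∀ u ∈ A, Proper S δ u)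
    (hA : A.IsChain fun s u => ¬ Comp M (s⁻¹ * δ) u) (p : ℤ) :
    IsGreatest {k : ℤ | ∃ c ∈ M, ∃ c' ∈ M, δ ^ p * A.prod = c * δ ^ k * c'} p := by
  have hAM : A.prod ∈ M := M.list_prod_mem fun x hx => h.mem (hP x hx).1
  refine ⟨⟨1, M.one_mem, _, hAM, by simp⟩, ?_⟩
  rintro k ⟨c, hc, c', hc', e⟩
  by_contra hlt
  have hk : δ ^ (k - p - 1) ∈ M := by
    obtain ⟨j, hj⟩ : ∃ j : ℕ, (j : ℤ) = k - p - 1 := ⟨(k - p - 1).toNat, by omega⟩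
    rw [← hj, zpow_natCast]
    exact M.pow_mem h.delta_mem_monoid j
  have hle : δ⁻¹ * A.prod ∈ M := by
    have : δ⁻¹ * A.prod = δ ^ (k - p - 1) * (δ ^ (-k) * c * δ ^ k) * c' := by
      have : A.prod = δ ^ (-p) * (c * δ ^ k * c') := by rw [← e]; group
      rw [this]
      group
    rw [this]
    exact M.mul_mem (M.mul_mem hk (h.conj_mem_monoid hc k)) hc'
  cases A with
  | nil => exact h.ne_one (h.eq_one δ h.delta_mem_monoid (by simpa using hle))
  | cons s T =>
    have hs := hP s (by simp)
    exact hs.2.2 (h.antisymm (h.inv_mul_mem hs.1)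
      (h.le_head hP hA h.delta_mem (by simpa using hle)))

end NormalForm

end IsSpindle

/-- Words without simplifiable neighbours are normal forms. -/
theorem isLeftGarsideNormalForm {G : Type*} [Group G] {S : Set G} {Δ : Submonoid.closure S}
    (h : IsSpindle (Submonoid.closure S) S (Δ : G)) (p : ℤ) (L : List (ProperSimples S Δ))
    (hL : (L.map fun s => (s.1 : G)).IsChain
      fun s u => ¬ IsSpindle.Comp (Submonoid.closure S) (s⁻¹ * (Δ : G)) u) :
    IsLeftGarsideNormalForm S Δ ((Δ : G) ^ p * (L.map fun s => (s.1 : G)).prod) p L := by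
  have hprop : ∀ s : ProperSimples S Δ, IsSpindle.Proper S (Δ : G) (s.1 : G) := fun s =>
    ⟨s.2.1, fun e => s.2.2.1 (Subtype.ext e), fun e => s.2.2.2 (Subtype.ext e)⟩
  have hprod : ∀ T : List (ProperSimples S Δ),
      (((T.map Subtype.val).prod : Submonoid.closure S) : G) = (T.map fun s => (s.1 : G)).prod := by
    intro T
    rw [Submonoid.coe_list_prod, List.map_map]
    rfl
  have hP : ∀ u ∈ L.map fun s => (s.1 : G), IsSpindle.Proper S (Δ : G) u := by
    intro u hu
    obtain ⟨s, -, rfl⟩ := List.mem_map.1 hu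
    exact hprop s
  refine ⟨h.isInf hP hL p, ⟨?_, ?_⟩, by rw [hprod]⟩
  · intro s T hsuf
    obtain ⟨A, hA⟩ := hsuf
    obtain ⟨L1, L2, rfl, -, e⟩ := List.append_eq_map_iff.1 hA
    obtain ⟨s, T, rfl, rfl, rfl⟩ := List.map_eq_cons_iff.1 e
    refine ⟨⟨⟨_, h.inv_mul_mem s.2.1⟩, Subtype.ext (by simp)⟩, ⟨_, rfl⟩, ?_⟩
    rintro c ⟨x, hx⟩ ⟨y, hy⟩
    have hx' : (Δ : G) = c * x := congrArg Subtype.val hx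
    have hy' : (s.1 : G) * (T.map fun s => (s.1 : G)).prod = c * y := by
      rw [← hprod]
      exact congrArg Subtype.val hy
    rw [List.map_append, List.map_cons] at hL hP
    have := h.le_head (fun u hu => hP u (List.mem_append_right _ hu)) hL.right_of_append (c := c)
      ((h.mem_iff_left _).2 ⟨c.2, by rw [hx']; simp⟩) (by rw [hy']; simp)
    exact ⟨⟨_, this⟩, Subtype.ext (by simp)⟩
  · intro hne
    obtain ⟨s, -, hs⟩ := List.mem_map.1 (List.getLast_mem hne)
    rw [← hs]
    exact s.2.2.1

end Garside

/-! ### The algorithm for Garside systems of spindle type -/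

namespace Garside

section Matrices

variable {Ω : Type*} [Fintype Ω] [DecidableEq Ω]

/-- The matrix of an automorphism. -/
noncomputable def mat (g : Op Ω) : Matrix Ω Ω ℤ := LinearMap.toMatrix' (g : (Ω → ℤ) →ₗ[ℤ] Ω → ℤ)

theorem mat_one : mat (1 : Op Ω) = 1 := LinearMap.toMatrix'_id

theorem mat_mul (g g' : Op Ω) : mat (g * g') = mat g * mat g' :=
  LinearMap.toMatrix'_comp (g : (Ω → ℤ) →ₗ[ℤ] Ω → ℤ) (g' : (Ω → ℤ) →ₗ[ℤ] Ω → ℤ)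

theorem mat_injective : Function.Injective (mat : Op Ω → Matrix Ω Ω ℤ) := fun _ _ e =>
  LinearEquiv.toLinearMap_injective (LinearMap.toMatrix'.injective e)

end Matrices

namespace IsSpindle

variable {G : Type*} [Group G] {S : Set G} {Δ : Submonoid.closure S}
  (h : IsSpindle (Submonoid.closure S) S (Δ : G))

/-- The period of the conjugation by `Δ` on simple elements. -/
noncomputable def period : ℕ := orderOf h.conjPerm

theorem period_pos : 0 < h.period := by
  have := h.finite_proper
  exact orderOf_pos _

theorem conjPerm_zpow_eq_one {k : ℤ} : h.conjPerm ^ k = 1 ↔ (k : ZMod h.period) = 0 := by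
  rw [← orderOf_dvd_iff_zpow_eq_one, ZMod.intCast_zmod_eq_zero_iff_dvd]
  rfl

theorem conjPerm_zpow_val [NeZero h.period] (k : ℤ) :
    h.conjPerm ^ ((k : ZMod h.period).val : ℤ) = h.conjPerm ^ k := by
  rw [← mul_inv_eq_one, ← zpow_sub, h.conjPerm_zpow_eq_one]
  simp

/-- A proper simple element as a letter of normal forms. -/
def toProperSimple (u : {u // Proper S (Δ : G) u}) : ProperSimples S Δ :=
  ⟨⟨u.1, Submonoid.subset_closure u.2.1⟩, u.2.1, fun e => u.2.2.1 (congrArg Subtype.val e),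
    fun e => u.2.2.2 (congrArg Subtype.val e)⟩

/-- The products `s * Δ ^ r` of a simple element other than `Δ` and a power of `Δ`, the exponent
being taken modulo the period. -/
abbrev Target (h : IsSpindle (Submonoid.closure S) S (Δ : G)) : Type _ :=
  {s : G // s ∈ S ∧ s ≠ (Δ : G)} × ZMod h.period

variable {X : Type*} (lett : X → G × ℤ) [Fintype (Basis S (Δ : G))]

/-- The action of a letter. -/
noncomputable def act (l : G × ℤ) : Op (Basis S (Δ : G)) := h.rep l.1 * h.rep (Δ : G) ^ l.2

open Classical in
/-- The data of the algorithm: a letter `x` stands for the product `s * Δ ^ n` of a simple element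
and a power of `Δ` with `lett x = (s, n)`. The matrices are inverted since the algorithm
multiplies by the matrices of new letters on the left. -/
noncomputable def scheme (c : ℕ) :
    Logspace.Scheme X (Bool ⊕ ProperSimples S Δ) h.Target (Basis S (Δ : G)) h.period where
  letter x := mat (h.act (lett x))⁻¹
  target t := mat (h.act (t.1.1, (t.2.val : ℤ)))⁻¹
  letterWt x := wt (Submonoid.closure S) S (Δ : G) (lett x).1 + (lett x).2 * fullWt S
  targetWt t := wt (Submonoid.closure S) S (Δ : G) t.1.1
  unit := fullWt S
  rot t := t.2
  word r t := if ht : t.1.1 = 1 then [] else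
    [Sum.inr (toProperSimple ((h.conjPerm ^ (r.val : ℤ)) ⟨t.1.1, t.1.2.1, ht, t.1.2.2⟩))]
  up := Sum.inl true
  down := Sum.inl false
  bound := c

variable [NeZero h.period]

theorem rep_zpow_val (k : ℤ) :
    h.rep (Δ : G) ^ ((k : ZMod h.period).val : ℤ) = h.rep (Δ : G) ^ k := by
  rw [← mul_inv_eq_one, ← zpow_sub, h.rep_delta_zpow_eq_one, h.conjPerm_zpow_eq_one]
  simp

theorem exists_target {s : G} (hs : s ∈ S) (k : ℤ) :
    ∃ t : h.Target, h.act (t.1.1, (t.2.val : ℤ)) = h.act (s, k) := by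
  by_cases hδ : s = Δ
  · refine ⟨(⟨1, h.one_mem, h.ne_one.symm⟩, ((1 + k : ℤ) : ZMod h.period)), ?_⟩
    simp only [act]
    rw [h.rep_zpow_val, h.germ_one h.isGermHom_rep, hδ, one_mul, zpow_add, zpow_one]
  · exact ⟨(⟨s, hs, hδ⟩, (k : ZMod h.period)), by simp only [act]; rw [h.rep_zpow_val]⟩

open Classical in
omit [NeZero h.period] in
theorem scheme_prod [Fintype h.Target] (c : ℕ) (w : List X) :
    (h.scheme lett c).prod w = mat ((w.map fun x => h.act (lett x)).prod)⁻¹ := by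
  induction w using List.reverseRecOn with
  | nil => simp [Logspace.Scheme.prod, mat_one]
  | append_singleton w x ih =>
    rw [Logspace.Scheme.prod_append_singleton, ih]
    simp only [scheme, List.map_append, List.prod_append, List.map_cons, List.map_nil,
      List.prod_singleton, mul_inv_rev, mat_mul]

open Classical in
omit [NeZero h.period] in
theorem scheme_prod_eq_target [Fintype h.Target] (c : ℕ) (w : List X) (t : h.Target) :
    (h.scheme lett c).prod w = (h.scheme lett c).target t ↔
      (w.map fun x => h.act (lett x)).prod = h.act (t.1.1, (t.2.val : ℤ)) := by
  rw [scheme_prod]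
  exact mat_injective.eq_iff.trans inv_inj

variable {lett} (hlett : ∀ x, (lett x).1 ∈ S)
include hlett

omit [NeZero h.period] in
theorem rep_run (w : List X) (q : ℤ) :
    evalStack h.rep (run (Submonoid.closure S) S (Δ : G) ([], q) (w.map lett)).1 *
        h.rep (Δ : G) ^ (run (Submonoid.closure S) S (Δ : G) ([], q) (w.map lett)).2 =
      h.rep (Δ : G) ^ q * (w.map fun x => h.act (lett x)).prod := by
  rw [h.evalStack_run h.isGermHom_rep (by simpa using fun x _ => hlett x) valid_nil, List.map_map]
  simp only [evalStack, one_mul]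
  rfl

open Classical in
/-- If the product of a word passes the test against a target, then the normal form of the word is
this target. -/
theorem run_of_target [Fintype h.Target] {c : ℕ} {w : List X} {t : h.Target}
    (e : (h.scheme lett c).prod w = (h.scheme lett c).target t) (q : ℤ) :
    (run (Submonoid.closure S) S (Δ : G) ([], q) (w.map lett)).1 =
      (if t.1.1 = 1 then [] else [(Δ : G) ^ q * t.1.1 * (Δ : G) ^ (-q)]) ∧
    (((run (Submonoid.closure S) S (Δ : G) ([], q) (w.map lett)).2 - q : ℤ) : ZMod h.period) =
      t.2 := by
  rw [scheme_prod_eq_target] at e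
  have hr := h.rep_run hlett w q
  have hv := h.valid_run (w := w.map lett) (st := ([], q))
    (by simpa using fun x _ => hlett x) valid_nil
  have e1 : (Δ : G) ^ q * t.1.1 * (Δ : G) ^ (-q) = 1 ↔ t.1.1 = 1 := by
    rw [zpow_neg, mul_inv_eq_one, mul_eq_left]
  have e2 : (Δ : G) ^ q * t.1.1 * (Δ : G) ^ (-q) ≠ Δ := by
    intro e2
    refine t.1.2.2 ?_
    have : t.1.1 = (Δ : G) ^ (-q) * ((Δ : G) ^ q * t.1.1 * (Δ : G) ^ (-q)) * (Δ : G) ^ q := by group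
    rw [this, e2]
    group
  have hc := h.germ_conj_zpow h.isGermHom_rep t.1.2.1 q
  obtain ⟨h1, h2⟩ := h.eq_of_rep hv (s := (Δ : G) ^ q * t.1.1 * (Δ : G) ^ (-q))
    (r := q + t.2.val) (h.conj_mem' t.1.2.1 q) e2 (by
      rw [hr, e, hc, act, zpow_add]
      group)
  rw [h.conjPerm_zpow_eq_one] at h2
  refine ⟨?_, ?_⟩
  · rw [h1]
    simp only [e1]
  · rw [← sub_eq_zero, ← h2]
    push_cast
    rw [ZMod.natCast_zmod_val]
    ring

open Classical in
/-- If the normal form of a word has at most one letter, then the product of the word passes the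
test against some target. -/
theorem target_of_run [Fintype h.Target] {c : ℕ} {w : List X} {q : ℤ}
    (hlen : (run (Submonoid.closure S) S (Δ : G) ([], q) (w.map lett)).1.length ≤ 1) :
    ∃ t, (h.scheme lett c).prod w = (h.scheme lett c).target t := by
  simp only [scheme_prod_eq_target]
  have hr := h.rep_run hlett w q
  have hv := h.valid_run (w := w.map lett) (st := ([], q))
    (by simpa using fun x _ => hlett x) valid_nil
  generalize run (Submonoid.closure S) S (Δ : G) ([], q) (w.map lett) = st at *
  obtain ⟨L, p⟩ := st
  obtain ⟨s, hs, e⟩ : ∃ s ∈ S, evalStack h.rep L = h.rep s := by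
    match L, hlen with
    | [], _ => exact ⟨1, h.one_mem, (h.germ_one h.isGermHom_rep).symm⟩
    | [s], _ => exact ⟨s, (hv.1 s (by simp)).1, by simp [evalStack]⟩
  obtain ⟨t, ht⟩ := h.exists_target (h.conj_mem hs q) (p - q)
  refine ⟨t, ?_⟩
  have hc := h.germ_conj_zpow h.isGermHom_rep hs (-q)
  rw [neg_neg] at hc
  rw [ht, act]
  dsimp only at hr ⊢
  have hprod : (w.map fun x => h.act (lett x)).prod =
      h.rep (Δ : G) ^ (-q) * (h.rep s * h.rep (Δ : G) ^ p) := by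
    rw [← e, hr]
    group
  rw [hc, hprod]
  group

end IsSpindle

end Garside

/-! ### Correctness of the algorithm -/

namespace Garside

namespace IsSpindle

variable {G : Type*} [Group G] {S : Set G} {Δ : Submonoid.closure S}
  (h : IsSpindle (Submonoid.closure S) S (Δ : G)) [NeZero h.period]
  {X : Type*} {lett : X → G × ℤ} [Fintype (Basis S (Δ : G))] [Fintype h.Target]
  (hlett : ∀ x, (lett x).1 ∈ S)
include hlett

open Classical in
/-- The pieces into which the algorithm cuts a word correspond to the letters of its normal form:
after a piece that ends at the letter `s` of a stack, which is the longest possible one, the stack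
never gets down to `s` again, so that the normal form of the rest of the word is put on top of
it. -/
theorem run_of_cut {c : ℕ} {w : List X} {i : ℕ} {l : List h.Target}
    (hl : haveI : Nonempty h.Target := ⟨(⟨1, h.one_mem, h.ne_one.symm⟩, 0)⟩
      (h.scheme lett c).Cut w i l) (q : ℤ) {R : List G} {p : ℤ}
    (hrun : run (Submonoid.closure S) S (Δ : G) ([], q) ((w.drop i).map lett) = (R, p)) :
    ((p - q : ℤ) : ZMod h.period) = (l.map (h.scheme lett c).rot).sum ∧
    (R.map (wt (Submonoid.closure S) S (Δ : G))).sum = (l.map (h.scheme lett c).targetWt).sum ∧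
    ∃ L : List (ProperSimples S Δ),
      (h.scheme lett c).words ((p - q : ℤ) : ZMod h.period) l = L.map Sum.inr ∧
      L.map (fun s => (s.1 : G)) = R.reverse.map fun s => (Δ : G) ^ (-p) * s * (Δ : G) ^ p := by
  have : Nonempty h.Target := ⟨(⟨1, h.one_mem, h.ne_one.symm⟩, 0)⟩
  induction hl generalizing q R p with
  | nil =>
    rw [List.drop_length, List.map_nil, run, List.foldl_nil, Prod.mk.injEq] at hrun
    obtain ⟨rfl, rfl⟩ := hrun
    exact ⟨by simp, by simp, [], rfl, rfl⟩
  | @cons i k t l hik hk ht _ hmax hl ih =>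
    obtain ⟨h1, h2⟩ := h.run_of_target hlett ht q
    have hlen : ∀ m, k < m → m ≤ w.length → 2 ≤ (run (Submonoid.closure S) S (Δ : G) ([], q)
        ((Logspace.slice w i m).map lett)).1.length := by
      intro m hkm hm
      by_contra hlt
      obtain ⟨t', ht'⟩ := h.target_of_run (c := c) hlett (w := Logspace.slice w i m) (q := q)
        (by omega)
      exact hmax m hkm hm t' ht'
    have hdrop : w.drop i = Logspace.slice w i k ++ w.drop k := by
      rw [Logspace.slice, show k = i + (k - i) by omega, ← List.drop_drop,
        Nat.add_sub_cancel_left, List.take_append_drop]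
    have happ : ∀ u : List X, run (Submonoid.closure S) S (Δ : G) ([], q)
        ((Logspace.slice w i k ++ u).map lett) = run (Submonoid.closure S) S (Δ : G)
          (run (Submonoid.closure S) S (Δ : G) ([], q) ((Logspace.slice w i k).map lett))
          (u.map lett) := fun u => by
      rw [List.map_append, run_append]
    generalize run (Submonoid.closure S) S (Δ : G) ([], q) ((Logspace.slice w i k).map lett) = st
      at h1 h2 happ
    obtain ⟨L', p'⟩ := st
    dsimp only at h1 h2
    rw [hdrop, happ] at hrun
    by_cases hs1 : t.1.1 = 1
    · rw [if_pos hs1] at h1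
      subst h1
      -- A trivial piece can always be prolonged by a letter, so that the word ends here.
      obtain rfl : k = w.length := by
        by_contra hne
        have hlt : k < w.length := by omega
        have := hlen (k + 1) (Nat.lt_succ_self k) hlt
        rw [Logspace.slice_succ w hik.le hlt, happ] at this
        have h3 := length_push_nil_le (M := Submonoid.closure S) (S := S) (δ := (Δ : G))
          ((Δ : G) ^ p' * (lett w[k]).1 * (Δ : G) ^ (-p'))
        simp only [List.map_cons, List.map_nil, run, List.foldl_cons, List.foldl_nil, step] at this
        omega
      obtain ⟨rfl, rfl⟩ : R = [] ∧ p = p' := by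
        rw [List.drop_length, List.map_nil, run, List.foldl_nil, Prod.mk.injEq] at hrun
        exact ⟨hrun.1.symm, hrun.2.symm⟩
      obtain rfl : l = [] := by
        cases hl with
        | nil => rfl
        | cons h3 h4 => exact absurd (h3.trans_le h4) (lt_irrefl _)
      refine ⟨?_, ?_, [], ?_, rfl⟩
      · simpa [scheme] using h2
      · simp [scheme, hs1, h.wt_one]
      · simp [Logspace.Scheme.words, scheme, hs1]
    · rw [if_neg hs1] at h1
      subst h1
      have htP : Proper S (Δ : G) t.1.1 := ⟨t.1.2.1, hs1, t.1.2.2⟩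
      have key := run_append_stack (M := Submonoid.closure S) (S := S) (δ := (Δ : G)) (L := [])
        (p := p') (s := (Δ : G) ^ q * t.1.1 * (Δ : G) ^ (-q)) (w := (w.drop k).map lett) (by
          intro j hj
          rw [List.length_map, List.length_drop] at hj
          have := hlen (k + (j + 1)) (by omega) (by omega)
          rw [← Logspace.slice_append w hik.le (show k ≤ k + (j + 1) by omega), happ] at this
          rw [← List.map_take]
          simpa [Logspace.slice] using this)
      rw [List.nil_append] at key
      rw [key] at hrun
      rw [Prod.mk.injEq] at hrun
      obtain ⟨rfl, hp⟩ := hrun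
      obtain ⟨i1, i2, L, i3, i4⟩ := ih p' (R := (run (Submonoid.closure S) S (Δ : G) ([], p')
        ((w.drop k).map lett)).1) (p := p) (by rw [← hp])
      have hpq : ((p - q : ℤ) : ZMod h.period) = t.2 + ((p - p' : ℤ) : ZMod h.period) := by
        rw [← h2]
        push_cast
        ring
      refine ⟨?_, ?_, toProperSimple ((h.conjPerm ^ (p - q)) ⟨t.1.1, htP⟩) :: L, ?_, ?_⟩
      · rw [hpq, i1]
        rfl
      · rw [List.map_append, List.sum_append, i2]
        have := h.wt_conj t.1.1 (-q)
        rw [neg_neg] at this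
        simp only [List.map_cons, List.map_nil, List.sum_cons, List.sum_nil, this]
        simp only [scheme]
        ring
      · rw [Logspace.Scheme.words, List.map_cons]
        have e1 : ((p - q : ℤ) : ZMod h.period) - (h.scheme lett c).rot t =
            ((p - p' : ℤ) : ZMod h.period) := by
          rw [hpq]
          exact add_sub_cancel_left _ _
        have e2 : (h.scheme lett c).word ((p - q : ℤ) : ZMod h.period) t =
            [Sum.inr (toProperSimple ((h.conjPerm ^ (p - q)) ⟨t.1.1, htP⟩))] := by
          simp only [scheme]
          rw [dif_neg hs1, h.conjPerm_zpow_val]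
        rw [e1, e2, i3]
        rfl
      · rw [List.reverse_append, List.map_append, List.map_cons, i4]
        have e1 := h.conjPerm_zpow (p - q) ⟨t.1.1, htP⟩
        simp only [toProperSimple, e1, List.reverse_cons, List.reverse_nil, List.nil_append,
          List.map_cons, List.map_nil, List.cons_append, List.cons.injEq, and_true]
        group

end IsSpindle

end Garside

namespace Garside

namespace IsSpindle

section Weights

variable {G : Type*} [Group G] {M : Submonoid G} {S : Set G} {δ : G} (h : IsSpindle M S δ)
include h

theorem wt_run (w : List (G × ℤ)) (hw : ∀ l ∈ w, l.1 ∈ S) :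
    (((run M S δ ([], 0) w).1.map (wt M S δ)).sum : ℤ) + (run M S δ ([], 0) w).2 * fullWt S =
      (w.map fun l => (wt M S δ l.1 : ℤ) + l.2 * fullWt S).sum := by
  have hm : IsGermHom M S fun s => Multiplicative.ofAdd (wt M S δ s : ℤ) := by
    intro s hs t ht hst
    change Multiplicative.ofAdd (wt M S δ (s * t) : ℤ) = _
    rw [h.wt_mul hs ht hst, Nat.cast_add, ofAdd_add]
  have := congrArg Multiplicative.toAdd (h.evalStack_run hm hw (st := ([], 0)) valid_nil)
  have e1 : ∀ L : List G, Multiplicative.toAdd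
      (evalStack (fun s => Multiplicative.ofAdd (wt M S δ s : ℤ)) L) =
      ((L.map (wt M S δ)).sum : ℤ) := by
    intro L
    induction L with
    | nil => rfl
    | cons s R ih => simp [evalStack, ih, add_comm]
  have e2 : ∀ w : List (G × ℤ), Multiplicative.toAdd
      (w.map fun l => Multiplicative.ofAdd (wt M S δ l.1 : ℤ) *
        Multiplicative.ofAdd (wt M S δ δ : ℤ) ^ l.2).prod =
      (w.map fun l => (wt M S δ l.1 : ℤ) + l.2 * fullWt S).sum := by
    intro w
    induction w with
    | nil => rfl
    | cons l w ih =>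
      rw [List.map_cons, List.prod_cons, toAdd_mul, ih]
      simp [h.wt_delta]
  rw [toAdd_mul, toAdd_mul, toAdd_zpow, e1, e2] at this
  simpa [evalStack, h.wt_delta] using this

end Weights

variable {G : Type*} [Group G] {S : Set G} {Δ : Submonoid.closure S}
  (h : IsSpindle (Submonoid.closure S) S (Δ : G))

/-- An atom is a simple element, and the inverse of an atom `x` is the product of the simple element
`x⁻¹ * Δ` and of `Δ⁻¹`. -/
def letterOf (S : Set G) (Δ : Submonoid.closure S) (x : Atoms S × Bool) : G × ℤ :=
  if x.2 then (x.1.1, 0) else ((x.1.1 : G)⁻¹ * Δ, -1)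

include h in
theorem letterOf_mem (x : Atoms S × Bool) : (letterOf S Δ x).1 ∈ S := by
  have := mem_of_isMonoidAtom x.1.2
  unfold letterOf
  split_ifs
  · exact this
  · exact h.compl_mem this

theorem evalWord_eq (w : List (Atoms S × Bool)) :
    evalWord S w = ((w.map (letterOf S Δ)).map fun l => l.1 * (Δ : G) ^ l.2).prod := by
  rw [evalWord, List.map_map]
  congr 2
  funext x
  rcases x with ⟨x, b⟩
  cases b <;> simp [letterOf]

include h in
theorem exists_normalForm (w : List (Atoms S × Bool)) : ∃ L : List (ProperSimples S Δ),
    L.map (fun s => (s.1 : G)) =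
      (run (Submonoid.closure S) S (Δ : G) ([], 0) (w.map (letterOf S Δ))).1.reverse.map
        (fun s => (Δ : G) ^ (-(run (Submonoid.closure S) S (Δ : G) ([], 0)
          (w.map (letterOf S Δ))).2) * s * (Δ : G) ^ (run (Submonoid.closure S) S (Δ : G) ([], 0)
          (w.map (letterOf S Δ))).2) ∧
    IsLeftGarsideNormalForm S Δ (evalWord S w)
      (run (Submonoid.closure S) S (Δ : G) ([], 0) (w.map (letterOf S Δ))).2 L := by
  have hw : ∀ l ∈ w.map (letterOf S Δ), l.1 ∈ S := List.forall_mem_map.2 fun x _ => h.letterOf_mem x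
  have hv := h.valid_run hw (st := ([], 0)) valid_nil
  have he := h.evalStack_run (m := fun g : G => g) (fun _ _ _ _ _ => rfl) hw (st := ([], 0))
    valid_nil
  rw [← evalWord_eq, evalStack, one_mul, zpow_zero, one_mul] at he
  rw [← he]
  generalize run (Submonoid.closure S) S (Δ : G) ([], 0) (w.map (letterOf S Δ)) = st at *
  obtain ⟨R, p⟩ := st
  dsimp only at *
  have hP : ∀ u ∈ R.reverse.map fun s => (Δ : G) ^ (-p) * s * (Δ : G) ^ p,
      Proper S (Δ : G) u := by
    intro u hu
    obtain ⟨s, hs, rfl⟩ := List.mem_map.1 hu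
    exact h.proper_conj (hv.1 s (List.mem_reverse.1 hs)) p
  have hchain : (R.reverse.map fun s => (Δ : G) ^ (-p) * s * (Δ : G) ^ p).IsChain
      fun s u => ¬ Comp (Submonoid.closure S) (s⁻¹ * (Δ : G)) u := by
    rw [List.isChain_map, List.isChain_reverse]
    refine hv.2.imp fun u s hus hc => hus ?_
    have := h.comp_conj hc (-p)
    have e1 : (Δ : G) ^ (- -p) * (((Δ : G) ^ (-p) * s * (Δ : G) ^ p)⁻¹ * Δ) * (Δ : G) ^ (-p) =
        s⁻¹ * Δ := by group
    have e2 : (Δ : G) ^ (- -p) * ((Δ : G) ^ (-p) * u * (Δ : G) ^ p) * (Δ : G) ^ (-p) = u := by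
      group
    rwa [e1, e2] at this
  have hprod : ∀ A : List G, (Δ : G) ^ p * (A.map fun s => (Δ : G) ^ (-p) * s * (Δ : G) ^ p).prod =
      A.prod * (Δ : G) ^ p := by
    intro A
    induction A with
    | nil => simp
    | cons s A ih =>
      rw [List.map_cons, List.prod_cons, List.prod_cons, mul_assoc s, ← ih]
      group
  have hval : evalStack (fun g : G => g) R = R.reverse.prod := by
    rw [evalStack_eq, List.map_id']
  rw [hval, ← hprod]
  generalize (R.reverse.map fun s => (Δ : G) ^ (-p) * s * (Δ : G) ^ p) = A at *
  lift A to List {u // Proper S (Δ : G) u} using hP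
  refine ⟨A.map toProperSimple, ?_, ?_⟩
  · rw [List.map_map]
    rfl
  · have : (A.map toProperSimple).map (fun s : ProperSimples S Δ => (s.1 : G)) =
        A.map Subtype.val := by
      rw [List.map_map]
      rfl
    rw [← this]
    exact isLeftGarsideNormalForm h p _ (by rwa [this])

end IsSpindle

end Garside

theorem mainTheorem2 {G : Type*} [Group G] [Nontrivial G]
    (S : Set G) (Δ : Submonoid.closure S)
    (hG : Garside.IsGarsideSystem S Δ) (hS : Garside.IsSpindleType S)
    {K : Type*} [Field K] {n : ℕ} (ρ : G →* Matrix.GeneralLinearGroup (Fin n) K)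
    (hρ : Function.Injective ρ) :
    ∃ f : List (Garside.Atoms S × Bool) → List (Bool ⊕ Garside.ProperSimples S Δ),
      Logspace.IsLogspaceComputable f ∧
      ∀ w : List (Garside.Atoms S × Bool),
        ∃ (p : ℤ) (L : List (Garside.ProperSimples S Δ)),
          Garside.IsLeftGarsideNormalForm S Δ (Garside.evalWord S w) p L ∧
          f w = Garside.normalFormWord S Δ p L := by
  classical
  have h := hG.isSpindle hS
  choose L hL hL' using h.exists_normalForm
  refine ⟨fun w => Garside.normalFormWord S Δ _ (L w), ?_, fun w => ⟨_, L w, hL' w, rfl⟩⟩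
  have hSfin : Finite S := hG.finite.to_subtype
  have hX : Finite (Garside.Atoms S) := Finite.of_injective
    (fun x => (⟨x.1.1, Garside.mem_of_isMonoidAtom x.2⟩ : S)) fun x y e =>
      Subtype.ext (Subtype.ext (congrArg (Subtype.val : S → G) e))
  have hY : Finite (Garside.ProperSimples S Δ) := Finite.of_injective
    (fun x => (⟨x.1, x.2.1⟩ : S)) fun x y e => Subtype.ext (Subtype.ext (congrArg (Subtype.val : S → G) e))
  have hP := h.finite_proper
  have : NeZero h.period := ⟨h.period_pos.ne'⟩
  have hT : Finite {s : G // s ∈ S ∧ s ≠ (Δ : G)} := Finite.of_injective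
    (fun x => (⟨x.1, x.2.1⟩ : S)) fun x y e => Subtype.ext (congrArg (Subtype.val : S → G) e)
  let _ : Fintype (Garside.IsSpindle.Basis S (Δ : G)) := Fintype.ofFinite _
  let _ : Fintype h.Target := Fintype.ofFinite _
  have hne : Nonempty h.Target := ⟨(⟨1, h.one_mem, h.ne_one.symm⟩, 0)⟩
  obtain ⟨c, hc, hsep⟩ := (h.scheme (Garside.IsSpindle.letterOf S Δ) 1).exists_bound
  have hact : ∀ s ∈ S, ∀ k : ℤ, ∃ t : h.Target,
      (h.scheme (Garside.IsSpindle.letterOf S Δ) c).target t = Garside.mat (h.act (s, k))⁻¹ :=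
    fun s hs k => by
      obtain ⟨t, ht⟩ := h.exists_target hs k
      exact ⟨t, by rw [← ht]; rfl⟩
  refine Logspace.isLogspaceComputable_of_scheme (h.scheme (Garside.IsSpindle.letterOf S Δ) c) hc
    (Garside.IsSpindle.fullWt_pos S) ?_ (fun x => hact _ (h.letterOf_mem x) _) hsep _ ?_
  · obtain ⟨t, ht⟩ := hact 1 h.one_mem 0
    refine ⟨t, ht.trans ?_⟩
    rw [Garside.IsSpindle.act, h.germ_one h.isGermHom_rep, zpow_zero, one_mul, inv_one,
      Garside.mat_one]
  · intro w l hl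
    have hwt := h.wt_run (w.map (Garside.IsSpindle.letterOf S Δ))
      (List.forall_mem_map.2 fun x _ => h.letterOf_mem x)
    have hLw := hL w
    rcases hst : Garside.IsSpindle.run (Submonoid.closure S) S (Δ : G) ([], 0)
      (w.map (Garside.IsSpindle.letterOf S Δ)) with ⟨R, p⟩
    rw [hst] at hwt hLw
    obtain ⟨h1, h2, L', h3, h4⟩ := h.run_of_cut h.letterOf_mem hl 0 hst
    -- The output is determined by the values of its letters in the group.
    have hLL : L w = L' := by
      refine List.map_injective_iff.2 ?_ (hLw.trans h4.symm)
      exact fun x y e => Subtype.ext (Subtype.ext e)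
    refine ⟨p, ?_, ?_⟩
    · rw [← h2, eq_sub_iff_add_eq, add_comm]
      refine Eq.trans hwt ?_
      rw [List.map_map]
      rfl
    · rw [← h1, h3, ← hLL, Garside.normalFormWord]
      congr 2
      by_cases hp : 0 ≤ p <;> simp [Garside.IsSpindle.scheme, hp]
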